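/- **Setting.** Fix $d\ge 1$. Let $N=\{1,\dots,n\}$, let $w:N\to\mathbb{Q}^d$, let $c:\mathbb{Q}^d\to\mathbb{Q}$ be convex, and for $F\subseteq N$ put $w(F)=\sum_{j\in F}w(j)$. *Convex combinatorial optimization* over a family $\mathcal F\subseteq 2^N$ asks for some $F\in\mathcal F$ of maximum value $c(w(F))$. The family $\mathcal F$ is *edge-guaranteed* by vectors $E=(e^1,\dots,e^m)$ of $\mathbb{Q}^n$ if it is nonempty and $E$ contains a nonzero scalar multiple of $v-u$ for every edge $[u,v]$ of the polytope $\mathrm{conv}\{\mathbf 1_F: F\in\mathcal F\}$. The input consists of $n$, $m$, $E$ and $w$; the family is presented by a *linear optimization oracle*, which for $b:N\to\mathbb{Q}$ returns some $F\in\mathcal F$ of maximum weight $b(F)=\sum_{j\in F}b(j)$, and $c$ by an *evaluation oracle*, which for $x\in\mathbb{Q}^d$ returns $c(x)$. **Algorithm.** Let $\omega:\mathbb{Q}^n\to\mathbb{Q}^d$, $\omega(x)=\sum_j x_j w(j)$, and $Z=\mathrm{zone}(\omega(E))=\sum_{i=1}^m[-\omega(e^i),\omega(e^i)]$. Enumerate,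 with repetitions allowed, the vertices of $Z$, each vertex $u$ with a functional $a\in\mathbb{Q}^d$ that is maximized over $Z$ at $u$ only. For each functional $a^i$ obtained, call the linear optimization oracle on $b^i(j)=a^i\cdot w(j)$ and obtain $F^i$; then call the evaluation oracle of $c$ at $w(F^i)$. Output some $F^i$ of maximum value $c(w(F^i))$. **Theorem.** For each fixed $d\ge1$ there are a constant $C$, a polynomial $p$ and a single program for a random access machine over $\mathbb{Q}$ with these two oracles ($C$, $p$ and the program depending only on $d$) such that the following holds for all $n,m\ge 0$, all families $\mathcal F$ edge-guaranteed by $E$, and all $w$, $c$ and oracles as above. Put $\bar n=\max(n,1)$ and $\bar m=\max(m,1)$. 1. Every run of the Algorithm, for any choice of the normal functionals, outputs an optimal solution of the convex combinatorial optimization problem, and $Z$ has at most $C\,\bar m^{\,d-1}$ vertices. 2. The program halts, its output is an optimal solution, and its oracle queries and output are those of a run of the Algorithm on $E$; only if $m>3^n$ may the run be one on a subfamily of $E$ that still contains a direction of every edge of $\mathrm{conv}\{\mathbf 1_F:F\in\mathcal F\}$. 3. The program is strongly polynomial: it performs at most $C\,\bar n\,\bar m^{\,d-1}$ arithmetic operations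 (additions, subtractions, multiplications, divisions and comparisons, on rationals and on array indices), at most $C\,\bar m^{\,d-1}$ calls to the linear optimization oracle and at most $C\,\bar m^{\,d-1}$ calls to the evaluation oracle of $c$; and its running time in the bit model (the total bit length of all numbers handled) is at most $p(L)$, where $L$ is the bit length of the input plus that of the answers of the evaluation oracle. -/

import Mathlib

namespace ConvexOpt

open Finset

/-! ### Polytopes, edges, zonotopes -/

/-- The normal cone of `P` at `F`: the linear functionals (acting through the standard inner
product) whose set of maximizers over `P` is exactly `F`. -/
def normalCone {n : ℕ} (P F : Set (Fin n → ℚ)) : Set (Fin n → ℚ) :=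
  {a | {x | x ∈ P ∧ ∀ y ∈ P, a ⬝ᵥ y ≤ a ⬝ᵥ x} = F}

/-- `u` is a vertex (a zero-dimensional face) of `P`. -/
def IsVertex {n : ℕ} (P : Set (Fin n → ℚ)) (u : Fin n → ℚ) : Prop :=
  ∃ a, a ∈ normalCone P {u}

/-- `[u, v]` is an edge (a one-dimensional face) of `P`. -/
def IsEdge {n : ℕ} (P : Set (Fin n → ℚ)) (u v : Fin n → ℚ) : Prop :=
  u ≠ v ∧ ∃ a, a ∈ normalCone P (segment ℚ u v)

/-- The zonotope `∑ i, [-v i, v i]`. -/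
def zone {d : ℕ} {ι : Type} [Fintype ι] (v : ι → Fin d → ℚ) : Set (Fin d → ℚ) :=
  {x | ∃ l : ι → ℚ, (∀ i, -1 ≤ l i ∧ l i ≤ 1) ∧ x = ∑ i, l i • v i}

/-! ### Families, weightings, oracles -/

/-- The indicator vector of `F`. -/
def indicatorVec {n : ℕ} (F : Finset (Fin n)) : Fin n → ℚ := fun j => if j ∈ F then 1 else 0

/-- The polytope of a family of subsets of the ground set. -/
def familyPolytope {n : ℕ} (𝓕 : Set (Finset (Fin n))) : Set (Fin n → ℚ) :=
  convexHull ℚ (indicatorVec '' 𝓕)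

/-- `𝓕` is nonempty and the vectors `e i` contain a direction of each edge of its polytope. -/
def EdgeGuaranteed {n : ℕ} {ι : Type} (𝓕 : Set (Finset (Fin n))) (e : ι → Fin n → ℚ) : Prop :=
  𝓕.Nonempty ∧ ∀ u v, IsEdge (familyPolytope 𝓕) u v → ∃ i, ∃ r : ℚ, r ≠ 0 ∧ e i = r • (v - u)

/-- The scalar or vectorial weight of a set. -/
def weight {n : ℕ} {M : Type} [AddCommMonoid M] (w : Fin n → M) (F : Finset (Fin n)) : M :=
  ∑ j ∈ F, w j

/-- `O` answers each `b` by a member of `𝓕` of maximum weight `b(F)`. -/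
def IsLinearOracle {n : ℕ} (𝓕 : Set (Finset (Fin n))) (O : (Fin n → ℚ) → Finset (Fin n)) : Prop :=
  ∀ b, O b ∈ 𝓕 ∧ ∀ G ∈ 𝓕, weight b G ≤ weight b (O b)

/-- `F` solves convex combinatorial optimization over `𝓕`. -/
def IsConvexOptimum {n d : ℕ} (𝓕 : Set (Finset (Fin n))) (w : Fin n → Fin d → ℚ)
    (c : (Fin d → ℚ) → ℚ) (F : Finset (Fin n)) : Prop :=
  F ∈ 𝓕 ∧ ∀ G ∈ 𝓕, c (weight w G) ≤ c (weight w F)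

/-! ### The algorithm -/

/-- The linear map `ω(x) = ∑ j, x j • w j`. -/
def omega {n d : ℕ} (w : Fin n → Fin d → ℚ) (x : Fin n → ℚ) : Fin d → ℚ := ∑ j, x j • w j

/-- The weighting `b(j) = a ⬝ w(j)`. -/
def pullback {n d : ℕ} (w : Fin n → Fin d → ℚ) (a : Fin d → ℚ) : Fin n → ℚ := fun j => a ⬝ᵥ w j

/-- A run of the algorithm with direction vectors `e`: `fnl` lists functionals `a`, each in the
normal cone of some vertex of `zone (ω(e))`, at least one for every vertex; `lin` are the
resulting queries `b` of the linear optimization oracle; `ev` are the points `w(F)`, for the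
oracle's answers `F`, at which `c` is evaluated; `out` is one of the answers, of maximum value. -/
structure IsAlgorithmRun {n d : ℕ} {ι : Type} [Fintype ι] (w : Fin n → Fin d → ℚ)
    (e : ι → Fin n → ℚ) (O : (Fin n → ℚ) → Finset (Fin n)) (c : (Fin d → ℚ) → ℚ)
    (fnl : List (Fin d → ℚ)) (lin : List (Fin n → ℚ)) (ev : List (Fin d → ℚ))
    (out : Finset (Fin n)) : Prop where
  normal : ∀ a ∈ fnl, ∃ u, a ∈ normalCone (zone fun i => omega w (e i)) {u}
  all_vertices : ∀ u, IsVertex (zone fun i => omega w (e i)) u →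
    ∃ a ∈ fnl, a ∈ normalCone (zone fun i => omega w (e i)) {u}
  lin_eq : lin = fnl.map (pullback w)
  ev_eq : ev = lin.map fun b => weight w (O b)
  out_mem : out ∈ lin.map O
  out_max : ∀ F ∈ lin.map O, c (weight w F) ≤ c (weight w out)

/-! ### The machine model

Random access machine programs over the rationals, with two-dimensional arrays of natural numbers
(for indices) and of rationals (for data), and with two oracles. A scalar variable is the cell
`(0, 0)` of an array. -/

/-- Number of bits of a natural number, plus one. -/
def natSize (k : ℕ) : ℕ := Nat.size k + 1

/-- Bit length of a rational number in lowest terms. -/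
def ratSize (q : ℚ) : ℕ := natSize q.num.natAbs + natSize q.den

/-- Index expressions (`sub` is truncated subtraction). -/
inductive IExpr : Type
  | const (k : ℕ) : IExpr
  | get (arr : ℕ) (i j : IExpr) : IExpr
  | add (x y : IExpr) : IExpr
  | sub (x y : IExpr) : IExpr
  | mul (x y : IExpr) : IExpr

/-- Rational expressions. -/
inductive QExpr : Type
  | const (q : ℚ) : QExpr
  | get (arr : ℕ) (i j : IExpr) : QExpr
  | add (x y : QExpr) : QExpr
  | sub (x y : QExpr) : QExpr
  | mul (x y : QExpr) : QExpr
  | div (x y : QExpr) : QExpr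

/-- Comparisons. -/
inductive Test : Type
  | ilt (x y : IExpr) : Test
  | qlt (x y : QExpr) : Test

/-- Programs. `linOpt src i dst j` queries the linear optimization oracle on row `i` of the
rational array `src` and writes the indicator of the answer to row `j` of the index array `dst`;
`evalC src i dst j k` queries the evaluation oracle on row `i` of `src` and writes the answer to
the cell `(j, k)` of `dst`. -/
inductive Cmd : Type
  | skip : Cmd
  | iset (arr : ℕ) (i j : IExpr) (e : IExpr) : Cmd
  | qset (arr : ℕ) (i j : IExpr) (e : QExpr) : Cmd
  | seq (p q : Cmd) : Cmd
  | ite (t : Test) (p q : Cmd) : Cmd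
  | loop (t : Test) (p : Cmd) : Cmd
  | linOpt (src : ℕ) (i : IExpr) (dst : ℕ) (j : IExpr) : Cmd
  | evalC (src : ℕ) (i : IExpr) (dst : ℕ) (j k : IExpr) : Cmd

/-- A machine state: the memory, and a record of the run so far which programs cannot read. `ops`
counts the arithmetic operations and comparisons, on rationals and on indices; `bits` adds up the
bit lengths of all numbers handled (the running time under the logarithmic cost criterion);
`linLog` and `evalLog` list the oracle queries made. -/
structure State (n d : ℕ) : Type where
  imem : ℕ → ℕ → ℕ → ℕ
  qmem : ℕ → ℕ → ℕ → ℚ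
  ops : ℕ
  bits : ℕ
  linLog : List (Fin n → ℚ)
  evalLog : List (Fin d → ℚ)

variable {n d : ℕ}

/-- The value of an index expression. -/
def IExpr.eval (s : State n d) : IExpr → ℕ
  | .const k => k
  | .get arr i j => s.imem arr (i.eval s) (j.eval s)
  | .add x y => x.eval s + y.eval s
  | .sub x y => x.eval s - y.eval s
  | .mul x y => x.eval s * y.eval s

/-- The number of arithmetic operations in an index expression. -/
def IExpr.ops : IExpr → ℕ
  | .const _ => 0
  | .get _ i j => i.ops + j.ops
  | .add x y => x.ops + y.ops + 1
  | .sub x y => x.ops + y.ops + 1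
  | .mul x y => x.ops + y.ops + 1

/-- The total bit length of all values met in evaluating an index expression. -/
def IExpr.bits (s : State n d) : IExpr → ℕ
  | .const k => natSize k
  | .get arr i j => i.bits s + j.bits s + natSize (s.imem arr (i.eval s) (j.eval s))
  | .add x y => x.bits s + y.bits s + natSize (x.eval s + y.eval s)
  | .sub x y => x.bits s + y.bits s + natSize (x.eval s - y.eval s)
  | .mul x y => x.bits s + y.bits s + natSize (x.eval s * y.eval s)

/-- The value of a rational expression. -/
def QExpr.eval (s : State n d) : QExpr → ℚ
  | .const q => q
  | .get arr i j => s.qmem arr (i.eval s) (j.eval s)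
  | .add x y => x.eval s + y.eval s
  | .sub x y => x.eval s - y.eval s
  | .mul x y => x.eval s * y.eval s
  | .div x y => x.eval s / y.eval s

/-- The number of arithmetic operations in a rational expression. -/
def QExpr.ops : QExpr → ℕ
  | .const _ => 0
  | .get _ i j => i.ops + j.ops
  | .add x y => x.ops + y.ops + 1
  | .sub x y => x.ops + y.ops + 1
  | .mul x y => x.ops + y.ops + 1
  | .div x y => x.ops + y.ops + 1

/-- The total bit length of all values met in evaluating a rational expression. -/
def QExpr.bits (s : State n d) : QExpr → ℕ
  | .const q => ratSize q
  | .get arr i j => i.bits s + j.bits s + ratSize (s.qmem arr (i.eval s) (j.eval s))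
  | .add x y => x.bits s + y.bits s + ratSize (x.eval s + y.eval s)
  | .sub x y => x.bits s + y.bits s + ratSize (x.eval s - y.eval s)
  | .mul x y => x.bits s + y.bits s + ratSize (x.eval s * y.eval s)
  | .div x y => x.bits s + y.bits s + ratSize (x.eval s / y.eval s)

/-- The truth of a comparison. -/
def Test.holds (s : State n d) : Test → Prop
  | .ilt x y => x.eval s < y.eval s
  | .qlt x y => x.eval s < y.eval s

/-- The number of operations in a comparison, itself included. -/
def Test.ops : Test → ℕ
  | .ilt x y => x.ops + y.ops + 1
  | .qlt x y => x.ops + y.ops + 1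

/-- The total bit length of all values met in a comparison. -/
def Test.bits (s : State n d) : Test → ℕ
  | .ilt x y => x.bits s + y.bits s
  | .qlt x y => x.bits s + y.bits s

/-- Add to the cost counters. -/
def State.charge (s : State n d) (k b : ℕ) : State n d :=
  { s with ops := s.ops + k, bits := s.bits + b }

/-- Write the index cell `(i, j)` of the array `arr`. -/
def State.setI (s : State n d) (arr i j v : ℕ) : State n d :=
  { s with imem := fun a k l => if a = arr ∧ k = i ∧ l = j then v else s.imem a k l }

/-- Write the rational cell `(i, j)` of the array `arr`. -/
def State.setQ (s : State n d) (arr i j : ℕ) (v : ℚ) : State n d :=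
  { s with qmem := fun a k l => if a = arr ∧ k = i ∧ l = j then v else s.qmem a k l }

/-- The first `r` entries of row `i` of the rational array `arr`. -/
def State.row (s : State n d) (r arr i : ℕ) : Fin r → ℚ := fun j => s.qmem arr i j

/-- Write the indicator of `F` to the first `n` cells of row `i` of the index array `arr`. -/
def State.setSet (s : State n d) (arr i : ℕ) (F : Finset (Fin n)) : State n d :=
  { s with imem := fun a k l =>
      if a = arr ∧ k = i then
        if h : l < n then (if (⟨l, h⟩ : Fin n) ∈ F then 1 else 0) else s.imem a k l
      else s.imem a k l }

/-- Append to the query records. -/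
def State.record (s : State n d) (b : List (Fin n → ℚ)) (x : List (Fin d → ℚ)) : State n d :=
  { s with linLog := s.linLog ++ b, evalLog := s.evalLog ++ x }

/-- `Exec O c p s s'`: started in the state `s`, the program `p`, with the oracles `O` and `c`,
halts in the state `s'`. -/
inductive Exec (O : (Fin n → ℚ) → Finset (Fin n)) (c : (Fin d → ℚ) → ℚ) :
    Cmd → State n d → State n d → Prop
  | skip (s : State n d) : Exec O c .skip s s
  | iset (s : State n d) (arr : ℕ) (i j e : IExpr) :
      Exec O c (.iset arr i j e) s
        ((s.setI arr (i.eval s) (j.eval s) (e.eval s)).charge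
          (i.ops + j.ops + e.ops) (i.bits s + j.bits s + e.bits s))
  | qset (s : State n d) (arr : ℕ) (i j : IExpr) (e : QExpr) :
      Exec O c (.qset arr i j e) s
        ((s.setQ arr (i.eval s) (j.eval s) (e.eval s)).charge
          (i.ops + j.ops + e.ops) (i.bits s + j.bits s + e.bits s))
  | seq {p q : Cmd} {s s' s'' : State n d} :
      Exec O c p s s' → Exec O c q s' s'' → Exec O c (.seq p q) s s''
  | ite_true {t : Test} {p q : Cmd} {s s' : State n d} :
      t.holds s → Exec O c p (s.charge t.ops (t.bits s)) s' → Exec O c (.ite t p q) s s'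
  | ite_false {t : Test} {p q : Cmd} {s s' : State n d} :
      ¬ t.holds s → Exec O c q (s.charge t.ops (t.bits s)) s' → Exec O c (.ite t p q) s s'
  | loop_true {t : Test} {p : Cmd} {s s' s'' : State n d} :
      t.holds s → Exec O c p (s.charge t.ops (t.bits s)) s' → Exec O c (.loop t p) s' s'' →
      Exec O c (.loop t p) s s''
  | loop_false {t : Test} {p : Cmd} {s : State n d} :
      ¬ t.holds s → Exec O c (.loop t p) s (s.charge t.ops (t.bits s))
  | linOpt (s : State n d) (src : ℕ) (i : IExpr) (dst : ℕ) (j : IExpr) :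
      Exec O c (.linOpt src i dst j) s
        (((s.setSet dst (j.eval s) (O (s.row n src (i.eval s)))).charge
          (i.ops + j.ops)
          (i.bits s + j.bits s + (∑ l, ratSize (s.row n src (i.eval s) l)) + n)).record
          [s.row n src (i.eval s)] [])
  | evalC (s : State n d) (src : ℕ) (i : IExpr) (dst : ℕ) (j k : IExpr) :
      Exec O c (.evalC src i dst j k) s
        (((s.setQ dst (j.eval s) (k.eval s) (c (s.row d src (i.eval s)))).charge
          (i.ops + j.ops + k.ops)
          (i.bits s + j.bits s + k.bits s + (∑ l, ratSize (s.row d src (i.eval s) l))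
            + ratSize (c (s.row d src (i.eval s))))).record
          [] [s.row d src (i.eval s)])

/-- The initial state: `n` and `m` in the index arrays `0` and `1`, the vectors `w j` and `e i` as
the rows of the rational arrays `0` and `1`, and zeros elsewhere. -/
def initState {m : ℕ} (w : Fin n → Fin d → ℚ) (e : Fin m → Fin n → ℚ) : State n d where
  imem := fun a k l => if k = 0 ∧ l = 0 then (if a = 0 then n else if a = 1 then m else 0) else 0
  qmem := fun a k l =>
    if a = 0 then (if h : k < n ∧ l < d then w ⟨k, h.1⟩ ⟨l, h.2⟩ else 0)
    else if a = 1 then (if h : k < m ∧ l < n then e ⟨k, h.1⟩ ⟨l, h.2⟩ else 0)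
    else 0
  ops := 0
  bits := 0
  linLog := []
  evalLog := []

/-- The output: the set whose indicator is row `0` of the index array `2`. -/
def State.output (s : State n d) : Finset (Fin n) :=
  Finset.univ.filter fun j : Fin n => s.imem 2 0 j = 1

/-- The length of the input in bits. -/
def inputSize {m : ℕ} (w : Fin n → Fin d → ℚ) (e : Fin m → Fin n → ℚ) : ℕ :=
  n + m + (∑ j, ∑ t, ratSize (w j t)) + ∑ i, ∑ j, ratSize (e i j)

/-- The total length in bits of the answers `c x` to the queries `x` listed in `ev`. -/
def answerSize (c : (Fin d → ℚ) → ℚ) (ev : List (Fin d → ℚ)) : ℕ :=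
  (ev.map fun x => ratSize (c x)).sum

end ConvexOpt

/-! Correctness of a run. A convex function on the finitely many points `weight w F` attains its
maximum at a point exposed by some functional `a` (`exists_exposed_maximizer`). A perturbation
(`exists_generic`) makes `a` nonzero at every nonzero image ω(e i), so `a` lies in the normal cone
of a vertex of the zonotope, and the run contains a functional `a₁` of the same cone. Both have the
same signs on the images of all edge directions. A member maximal for `a₁` is therefore maximal for
`a`: otherwise an edge of the polytope would improve it for `a` (`exists_edge_weight_lt`), and the
same edge would improve it for `a₁` (`weight_le_of_sameSign`).

Enumeration of the vertices. Adjoin the unit vectors to the images, close under negation, and call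
the resulting N vectors rows. A nonsingular d-tuple of rows defines the functional with values
proportional to 1, ε, ε², … on the tuple. For small ε its sign at any row is the sign of the first
nonzero coordinate of that row in the basis given by the tuple. Every cell of the arrangement is
reached: the rows that are positive on the cell contain a basis in which all of them are
lexicographically positive (`exists_lexBasis`, `exists_tuple_sameSign`). The first basis vector can
moreover be taken to be a unit vector up to sign, so 2d·N^(d-1) tuples suffice. This bounds the
vertices and the oracle calls.

Choice of ε. It must be small against the ratios of all d×d determinants, but there is no time to
inspect N^d of them. By the three-term relation between minors, a nonzero determinant is, up to
bounded factors, a product of two minors and a difference of two slopes, where the fixed rows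
include two unit vectors (`GapBounds.separated`). For each of the O(m^(d-2)) choices of fixed rows,
sorting the O(m) slopes yields the least gap. The logarithmic factor of sorting is absorbed by n: a
direction of an edge is a multiple of a difference of 0/1 vectors, so one vector for each of at most
3^n sign patterns is enough, and the selection is made when m > 3^n.

Resources. Programs are verified in a calculus of total correctness (`WP`) whose cost bound is a
syntactic constant times a product of loop lengths. For the bit model, `height` is submultiplicative
under the four operations. Every stored rational is an input, an oracle answer, a partial sum
bounded by the input size, or the value of one of finitely many fixed expressions applied a bounded
number of times, so bit lengths grow by a factor depending on d only. -/

namespace ConvexOpt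

open Finset

/-! ### Linear alternatives and perturbation over `ℚ` -/

/-- A positive multiple of `g` can be dominated by every positive value of `f`. -/
theorem exists_pos_mul_lt {ι : Type*} (s : Finset ι) (f g : ι → ℚ) :
    ∃ ε : ℚ, 0 < ε ∧ ∀ i ∈ s, 0 < f i → ε * g i < f i := by
  classical
  induction s using Finset.induction_on with
  | empty => exact ⟨1, one_pos, by simp⟩
  | insert a s _ ih =>
    obtain ⟨ε, hε, h⟩ := ih
    by_cases hf : 0 < f a
    · have hp : 0 < |g a| + 1 := by positivity
      refine ⟨min ε (f a / (|g a| + 1)), lt_min hε (div_pos hf hp), fun i hi hfi => ?_⟩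
      rcases Finset.mem_insert.1 hi with rfl | hi
      · rcases le_or_gt (g i) 0 with hg | hg
        · exact lt_of_le_of_lt
            (mul_nonpos_of_nonneg_of_nonpos (lt_min hε (div_pos hf hp)).le hg) hf
        · calc _ ≤ f i / (|g i| + 1) * g i := by gcongr; exact min_le_right _ _
            _ < f i / (|g i| + 1) * (|g i| + 1) := by
              exact mul_lt_mul_of_pos_left (by linarith [le_abs_self (g i)]) (div_pos hf hp)
            _ = f i := div_mul_cancel₀ _ hp.ne'
      · rcases le_or_gt (g i) 0 with hg | hg
        · exact lt_of_le_of_lt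
            (mul_nonpos_of_nonneg_of_nonpos (lt_min hε (div_pos hf hp)).le hg) hfi
        · calc _ ≤ ε * g i := by gcongr; exact min_le_left _ _
            _ < _ := h i hi hfi
    · refine ⟨ε, hε, fun i hi hfi => ?_⟩
      rcases Finset.mem_insert.1 hi with rfl | hi
      · exact absurd hfi hf
      · exact h i hi hfi

theorem dotProduct_self_pos {k : ℕ} {v : Fin k → ℚ} (hv : v ≠ 0) : 0 < v ⬝ᵥ v := by
  obtain ⟨i, hi⟩ := Function.ne_iff.1 hv
  exact Finset.sum_pos' (fun _ _ => mul_self_nonneg _) ⟨i, Finset.mem_univ _, mul_self_pos.2 hi⟩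

/-- Gordan's theorem of the alternative. -/
theorem gordan {ι : Type*} [DecidableEq ι] {k : ℕ} (s : Finset ι) (t : ι → Fin k → ℚ) :
    (∃ a : Fin k → ℚ, ∀ i ∈ s, 0 < a ⬝ᵥ t i) ∨
    ∃ l : ι → ℚ, (∀ i ∈ s, 0 ≤ l i) ∧ (∃ i ∈ s, 0 < l i) ∧ ∑ i ∈ s, l i • t i = 0 := by
  induction s using Finset.induction_on generalizing t with
  | empty => exact Or.inl ⟨0, by simp⟩
  | insert i₀ s hi₀ ih =>
    have extend : ∀ (l : ι → ℚ) (x : ℚ), ∑ i ∈ s, Function.update l i₀ x i • t i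
        = ∑ i ∈ s, l i • t i := fun l x => Finset.sum_congr rfl fun i hi => by
      rw [Function.update_of_ne (by rintro rfl; exact hi₀ hi)]
    have ne : ∀ i ∈ s, i ≠ i₀ := fun i hi => by rintro rfl; exact hi₀ hi
    rcases ih t with ⟨a, ha⟩ | ⟨l, hl, ⟨i, hi, hli⟩, hs⟩
    swap
    · refine Or.inr ⟨Function.update l i₀ 0, fun i hi => ?_, ⟨i, mem_insert_of_mem hi, ?_⟩, ?_⟩
      · rcases mem_insert.1 hi with rfl | hi
        · simp
        · rw [Function.update_of_ne (ne i hi)]; exact hl i hi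
      · rwa [Function.update_of_ne (ne i hi)]
      · rw [Finset.sum_insert hi₀, extend, hs]; simp
    -- a functional that is positive on `s` and zero at `i₀` can be tilted
    have tilt : ∀ b : Fin k → ℚ, (∀ i ∈ s, 0 < b ⬝ᵥ t i) → b ⬝ᵥ t i₀ = 0 → t i₀ ≠ 0 →
        ∃ a : Fin k → ℚ, ∀ i ∈ insert i₀ s, 0 < a ⬝ᵥ t i := by
      intro b hb hb₀ ht
      obtain ⟨ε, hε, h⟩ := exists_pos_mul_lt s (fun i => b ⬝ᵥ t i) (fun i => -(t i₀ ⬝ᵥ t i))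
      refine ⟨b + ε • t i₀, fun i hi => ?_⟩
      rw [add_dotProduct, smul_dotProduct, smul_eq_mul]
      rcases mem_insert.1 hi with rfl | hi
      · rw [hb₀, zero_add]; exact mul_pos hε (dotProduct_self_pos ht)
      · have := h i hi (hb i hi); linarith
    by_cases ht : t i₀ = 0
    · refine Or.inr ⟨Pi.single i₀ 1, fun i _ => ?_, ⟨i₀, mem_insert_self _ _, by simp⟩, ?_⟩
      · by_cases h : i = i₀
        · subst h; simp
        · simp [h]
      · rw [Finset.sum_insert hi₀, ht, smul_zero, zero_add]
        exact Finset.sum_eq_zero fun i hi => by simp [ne i hi]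
    rcases lt_trichotomy (a ⬝ᵥ t i₀) 0 with h0 | h0 | h0
    · set μ : ι → ℚ := fun i => (a ⬝ᵥ t i) / -(a ⬝ᵥ t i₀) with hμ
      have hμp : ∀ i ∈ s, 0 < μ i := fun i hi => div_pos (ha i hi) (neg_pos.2 h0)
      have hμe : ∀ i, a ⬝ᵥ t i + μ i * (a ⬝ᵥ t i₀) = 0 := fun i => by
        have : μ i * -(a ⬝ᵥ t i₀) = a ⬝ᵥ t i := div_mul_cancel₀ _ (neg_pos.2 h0).ne'
        linarith
      rcases ih (fun i => t i + μ i • t i₀) with ⟨b, hb⟩ | ⟨l, hl, ⟨i, hi, hli⟩, hs⟩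
      · have hb' := tilt (b + ((b ⬝ᵥ t i₀) / -(a ⬝ᵥ t i₀)) • a) ?_ ?_ ht
        · exact Or.inl hb'
        · intro i hi
          have h1 := hb i hi
          have h2 := hμe i
          simp only [dotProduct_add, dotProduct_smul, smul_eq_mul] at h1
          simp only [add_dotProduct, smul_dotProduct, smul_eq_mul]
          have h3 : a ⬝ᵥ t i = μ i * -(a ⬝ᵥ t i₀) := by linarith
          have h4 : -(a ⬝ᵥ t i₀) ≠ 0 := (neg_pos.2 h0).ne'
          rw [h3, div_mul_eq_mul_div, mul_comm (μ i), ← mul_assoc, mul_div_right_comm,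
            mul_div_assoc, div_self h4]
          linarith
        · simp only [add_dotProduct, smul_dotProduct, smul_eq_mul]
          field_simp [h0.ne]; ring
      · refine Or.inr ⟨Function.update l i₀ (∑ i ∈ s, l i * μ i), fun i hi => ?_,
          ⟨i, mem_insert_of_mem hi, ?_⟩, ?_⟩
        · rcases mem_insert.1 hi with rfl | hi
          · rw [Function.update_self]
            exact Finset.sum_nonneg fun i hi => mul_nonneg (hl i hi) (hμp i hi).le
          · rw [Function.update_of_ne (ne i hi)]; exact hl i hi
        · rwa [Function.update_of_ne (ne i hi)]
        · rw [Finset.sum_insert hi₀, extend, Function.update_self, Finset.sum_smul, ← hs,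
            ← Finset.sum_add_distrib]
          exact Finset.sum_congr rfl fun i _ => by rw [smul_add, smul_smul, add_comm]
    · exact Or.inl (tilt a ha h0 ht)
    · exact Or.inl ⟨a, fun i hi => by
        rcases mem_insert.1 hi with rfl | hi
        exacts [h0, ha i hi]⟩

/-- A functional can be perturbed, without changing its nonzero signs, to vanish at none of
finitely many nonzero vectors. -/
theorem exists_generic {k : ℕ} (T : Finset (Fin k → ℚ)) (a : Fin k → ℚ) :
    ∃ a' : Fin k → ℚ, (∀ t ∈ T, t ≠ 0 → a' ⬝ᵥ t ≠ 0) ∧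
      ∀ t ∈ T, a ⬝ᵥ t ≠ 0 → 0 < (a ⬝ᵥ t) * (a' ⬝ᵥ t) := by
  classical
  -- Zeros are removed one vector at a time; `T` stays fixed, so that each change respects all signs
  -- fixed earlier.
  suffices h : ∀ S ⊆ T, ∃ a' : Fin k → ℚ, (∀ t ∈ S, t ≠ 0 → a' ⬝ᵥ t ≠ 0) ∧
      ∀ t ∈ T, a ⬝ᵥ t ≠ 0 → 0 < (a ⬝ᵥ t) * (a' ⬝ᵥ t) from h T Subset.rfl
  intro S
  induction S using Finset.induction_on with
  | empty => exact fun _ => ⟨a, by simp, fun t _ h => mul_self_pos.2 h⟩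
  | insert t₀ S _ ih =>
    intro hS
    obtain ⟨b, hb, hb'⟩ := ih fun x hx => hS (mem_insert_of_mem hx)
    by_cases h0 : t₀ ≠ 0 → b ⬝ᵥ t₀ ≠ 0
    · exact ⟨b, fun t ht => (mem_insert.1 ht).elim (fun h => h ▸ h0) (hb t), hb'⟩
    push Not at h0
    obtain ⟨ht0, hbt⟩ := h0
    obtain ⟨ε, hε, h⟩ := exists_pos_mul_lt T (fun t => |b ⬝ᵥ t|) (fun t => |t₀ ⬝ᵥ t|)
    have key : ∀ t ∈ T, b ⬝ᵥ t ≠ 0 → 0 < (b ⬝ᵥ t) * ((b + ε • t₀) ⬝ᵥ t) := by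
      intro t ht hbt
      have h1 := h t ht (abs_pos.2 hbt)
      rw [add_dotProduct, smul_dotProduct, smul_eq_mul, mul_add]
      have h2 : |(b ⬝ᵥ t) * (ε * (t₀ ⬝ᵥ t))| < |b ⬝ᵥ t| * |b ⬝ᵥ t| := by
        rw [abs_mul, abs_mul, abs_of_pos hε]
        exact mul_lt_mul_of_pos_left h1 (abs_pos.2 hbt)
      rw [abs_mul_abs_self] at h2
      linarith [neg_abs_le ((b ⬝ᵥ t) * (ε * (t₀ ⬝ᵥ t)))]
    refine ⟨b + ε • t₀, fun t ht htn => ?_, fun t ht hat => ?_⟩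
    · by_cases hbt' : b ⬝ᵥ t = 0
      · rcases mem_insert.1 ht with rfl | ht
        · rw [add_dotProduct, smul_dotProduct, smul_eq_mul, hbt', zero_add]
          exact (mul_pos hε (dotProduct_self_pos htn)).ne'
        · exact absurd hbt' (hb t ht htn)
      · exact right_ne_zero_of_mul (key t (hS ht) hbt').ne'
    · have h1 := hb' t ht hat
      have h2 := key t ht (right_ne_zero_of_mul h1.ne')
      have h3 : 0 < (b ⬝ᵥ t) * (b ⬝ᵥ t) := mul_self_pos.2 (right_ne_zero_of_mul h1.ne')
      have h4 := mul_pos h1 h2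
      by_contra hneg
      push Not at hneg
      have : (a ⬝ᵥ t * b ⬝ᵥ t) * (b ⬝ᵥ t * (b + ε • t₀) ⬝ᵥ t) ≤ 0 := by
        calc _ = (b ⬝ᵥ t * b ⬝ᵥ t) * (a ⬝ᵥ t * (b + ε • t₀) ⬝ᵥ t) := by ring
          _ ≤ 0 := mul_nonpos_of_nonneg_of_nonpos h3.le hneg
      linarith

/-! ### Edges of the polytope of a family -/

theorem dotProduct_indicatorVec {n : ℕ} (b : Fin n → ℚ) (F : Finset (Fin n)) :
    b ⬝ᵥ indicatorVec F = weight b F := by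
  simp [dotProduct, indicatorVec, weight]

/-- If a functional attains its maximum over the points of `S` exactly at `x` and `y`, then it
exposes the segment between them in the convex hull. -/
theorem mem_normalCone_segment {k : ℕ} {S : Set (Fin k → ℚ)} {x y a : Fin k → ℚ} (hx : x ∈ S)
    (hy : y ∈ S) (hxy : a ⬝ᵥ y = a ⬝ᵥ x)
    (h : ∀ z ∈ S, a ⬝ᵥ z < a ⬝ᵥ x ∨ z = x ∨ z = y) :
    a ∈ normalCone (convexHull ℚ S) (segment ℚ x y) := by
  have lin : ∀ (p q : ℚ) (u v : Fin k → ℚ),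
      a ⬝ᵥ (p • u + q • v) = p * (a ⬝ᵥ u) + q * (a ⬝ᵥ v) := fun p q u v => by
    rw [dotProduct_add, dotProduct_smul, dotProduct_smul, smul_eq_mul, smul_eq_mul]
  have hseg : ∀ z ∈ segment ℚ x y, a ⬝ᵥ z = a ⬝ᵥ x := by
    rintro z ⟨p, q, _, _, hpq, rfl⟩
    rw [lin, hxy, ← add_mul, hpq, one_mul]
  -- The open halfspace together with the segment on its boundary is convex and contains `S`, hence
  -- contains the hull; the face is what remains outside the open halfspace.
  have hC : Convex ℚ ({z | a ⬝ᵥ z < a ⬝ᵥ x} ∪ segment ℚ x y) := by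
    rw [convex_iff_forall_pos]
    intro u hu v hv p q hp hq hpq
    have hle : ∀ z ∈ {z | a ⬝ᵥ z < a ⬝ᵥ x} ∪ segment ℚ x y, a ⬝ᵥ z ≤ a ⬝ᵥ x := by
      rintro z (hz | hz)
      exacts [le_of_lt hz, (hseg z hz).le]
    have e : a ⬝ᵥ x = p * (a ⬝ᵥ x) + q * (a ⬝ᵥ x) := by rw [← add_mul, hpq, one_mul]
    rcases hu with hu | hu
    · left
      rw [Set.mem_ofPred_eq, lin, e]
      exact add_lt_add_of_lt_of_le (mul_lt_mul_of_pos_left hu hp)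
        (mul_le_mul_of_nonneg_left (hle v hv) hq.le)
    rcases hv with hv | hv
    · left
      rw [Set.mem_ofPred_eq, lin, e]
      exact add_lt_add_of_le_of_lt (mul_le_mul_of_nonneg_left (hle u (Or.inr hu)) hp.le)
        (mul_lt_mul_of_pos_left hv hq)
    · exact Or.inr (convex_segment x y hu hv hp.le hq.le hpq)
  have hsub : convexHull ℚ S ⊆ {z | a ⬝ᵥ z < a ⬝ᵥ x} ∪ segment ℚ x y := by
    refine convexHull_min (fun z hz => ?_) hC
    rcases h z hz with h | rfl | rfl
    exacts [Or.inl h, Or.inr (left_mem_segment ℚ _ _), Or.inr (right_mem_segment ℚ _ _)]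
  have hle : ∀ z ∈ convexHull ℚ S, a ⬝ᵥ z ≤ a ⬝ᵥ x := fun z hz =>
    (hsub hz).elim (fun h => le_of_lt h) fun h => (hseg z h).le
  ext z
  constructor
  · rintro ⟨hz, hmax⟩
    exact (hsub hz).resolve_left fun h =>
      absurd (hmax x (subset_convexHull ℚ S hx)) (not_le.2 h)
  · intro hz
    exact ⟨(convex_convexHull ℚ S).segment_subset (subset_convexHull ℚ S hx)
      (subset_convexHull ℚ S hy) hz, fun u hu => (hle u hu).trans (hseg z hz).ge⟩

theorem indicatorVec_injective {n : ℕ} : Function.Injective (@indicatorVec n) := by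
  intro F G h
  ext j
  have := congrFun h j
  by_cases hF : j ∈ F <;> by_cases hG : j ∈ G <;> simp_all [indicatorVec]

/-- Two members of a family that lie in the same direction from a third one coincide. -/
theorem eq_of_smul_sub_eq {n : ℕ} {F G H : Finset (Fin n)} {p q : ℚ} (hp : 0 < p) (hq : 0 < q)
    (h : p • (indicatorVec G - indicatorVec F) = q • (indicatorVec H - indicatorVec F)) :
    G = H := by
  ext j
  have := congrFun h j
  simp only [Pi.smul_apply, Pi.sub_apply, smul_eq_mul, indicatorVec] at this
  -- In coordinate `j` each difference is either zero or of the sign dictated by `j ∈ F`, so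
  -- positive multiples of them can agree only if both vanish or neither does.
  by_cases hF : j ∈ F <;> by_cases hG : j ∈ G <;> by_cases hH : j ∈ H <;>
    simp_all [hp.ne', hq.ne', hq.ne]

/-- From a member of a family that is not of maximum weight some edge leads to a heavier member. -/
theorem exists_edge_weight_lt {n : ℕ} (𝓕 : Set (Finset (Fin n))) (b : Fin n → ℚ)
    {F G : Finset (Fin n)} (hF : F ∈ 𝓕) (hG : G ∈ 𝓕) (hlt : weight b F < weight b G) :
    ∃ H ∈ 𝓕, IsEdge (familyPolytope 𝓕) (indicatorVec F) (indicatorVec H) ∧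
      weight b F < weight b H := by
  classical
  set x := @indicatorVec n with hx
  set S : Finset (Finset (Fin n)) := 𝓕.toFinite.toFinset with hS
  have memS : ∀ H, H ∈ S ↔ H ∈ 𝓕 := fun H => by simp [hS]
  -- A shadow-vertex argument: start from a functional `g` exposing `F` and add growing multiples of
  -- `b`. Genericity of `g` at the differences keeps `F` exposed; genericity at the brackets rules
  -- out ties in the ratio test below.
  set T : Finset (Fin n → ℚ) := S.image (fun H => x F - x H) ∪
    (S ×ˢ S).image fun p => (b ⬝ᵥ (x p.2 - x F)) • (x p.1 - x F)
      - (b ⬝ᵥ (x p.1 - x F)) • (x p.2 - x F) with hT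
  -- The vector with entries 1 on `F` and -1 off `F` exposes `F` among all 0/1 vectors.
  obtain ⟨g, hg1, hg2⟩ := exists_generic T (fun j => 2 * x F j - 1)
  have hbw : ∀ H, b ⬝ᵥ (x H - x F) = weight b H - weight b F := fun H => by
    rw [dotProduct_sub, hx, dotProduct_indicatorVec, dotProduct_indicatorVec]
  have hgp : ∀ H ∈ S, H ≠ F → 0 < g ⬝ᵥ (x F - x H) := by
    intro H hH hne
    have hp : 0 < (fun j => 2 * x F j - 1) ⬝ᵥ (x F - x H) := by
      have e : ∀ j, (2 * x F j - 1) * (x F - x H) j = (x F - x H) j * (x F - x H) j := fun j => by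
        by_cases h1 : j ∈ F <;> by_cases h2 : j ∈ H <;> simp [hx, indicatorVec, h1, h2] <;> norm_num
      have : (fun j => 2 * x F j - 1) ⬝ᵥ (x F - x H) = (x F - x H) ⬝ᵥ (x F - x H) :=
        Finset.sum_congr rfl fun j _ => e j
      rw [this]
      exact dotProduct_self_pos (sub_ne_zero.2 fun h => hne (indicatorVec_injective h).symm)
    have := hg2 (x F - x H) (mem_union_left _ (mem_image_of_mem _ hH)) hp.ne'
    exact (mul_pos_iff_of_pos_left hp).1 this
  set up := S.filter fun H => 0 < b ⬝ᵥ (x H - x F) with hup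
  have hGup : G ∈ up := mem_filter.2 ⟨(memS G).2 hG, by rw [hbw]; linarith⟩
  -- The ratio test: the least `t` at which `g + t • b` no longer prefers `F` to every other member;
  -- `H` is the member that ties first.
  obtain ⟨H, hH, hmin⟩ := Finset.exists_min_image up
    (fun H => g ⬝ᵥ (x F - x H) / b ⬝ᵥ (x H - x F)) ⟨G, hGup⟩
  obtain ⟨hHS, hHpos⟩ := mem_filter.1 hH
  have neF : ∀ K, 0 < b ⬝ᵥ (x K - x F) → K ≠ F := by
    rintro K hK rfl; simp at hK
  set t := g ⬝ᵥ (x F - x H) / b ⬝ᵥ (x H - x F) with ht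
  have htpos : 0 < t := div_pos (hgp H hHS (neF H hHpos)) hHpos
  have flip : ∀ K, g ⬝ᵥ (x K - x F) = -(g ⬝ᵥ (x F - x K)) := fun K => by
    rw [← dotProduct_neg, neg_sub]
  have htH : g ⬝ᵥ (x F - x H) = t * b ⬝ᵥ (x H - x F) := by
    rw [ht, div_mul_cancel₀ _ hHpos.ne']
  have hval : ∀ K, (g + t • b) ⬝ᵥ x K = (g + t • b) ⬝ᵥ x F
      + (t * b ⬝ᵥ (x K - x F) - g ⬝ᵥ (x F - x K)) := fun K => by
    simp only [add_dotProduct, smul_dotProduct, smul_eq_mul, dotProduct_sub]; ring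
  refine ⟨H, (memS H).1 hHS, ⟨fun h => neF H hHpos (indicatorVec_injective h).symm,
    g + t • b, ?_⟩, by rw [hbw] at hHpos; linarith⟩
  refine mem_normalCone_segment (Set.mem_image_of_mem _ hF)
    (Set.mem_image_of_mem _ ((memS H).1 hHS)) ?_ ?_
  · rw [hval H, htH]; ring
  · rintro _ ⟨K, hK, rfl⟩
    by_cases hKF : K = F
    · exact Or.inr (Or.inl (by rw [hKF]))
    by_cases hKH : K = H
    · exact Or.inr (Or.inr (by rw [hKH]))
    left
    change (g + t • b) ⬝ᵥ x K < (g + t • b) ⬝ᵥ x F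
    rw [hval K, add_lt_iff_neg_left]
    have hgK := hgp K ((memS K).2 hK) hKF
    rcases le_or_gt (b ⬝ᵥ (x K - x F)) 0 with hb | hb
    · have := mul_nonpos_of_nonneg_of_nonpos htpos.le hb
      linarith
    have h1 := hmin K (mem_filter.2 ⟨(memS K).2 hK, hb⟩)
    have h1' : t ≤ g ⬝ᵥ (x F - x K) / b ⬝ᵥ (x K - x F) := h1
    rw [le_div_iff₀ hb] at h1'
    refine lt_of_le_of_ne (by linarith) fun h2 => ?_
    -- A second tie makes `g` vanish at the bracket of `H` and `K`, so the bracket is zero, and both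
    -- members lie on one ray from `F`.
    have hbr : g ⬝ᵥ ((b ⬝ᵥ (x K - x F)) • (x H - x F) - (b ⬝ᵥ (x H - x F)) • (x K - x F)) = 0 := by
      rw [dotProduct_sub, dotProduct_smul, dotProduct_smul, smul_eq_mul, smul_eq_mul, flip H,
        flip K, htH]
      have : g ⬝ᵥ (x F - x K) = t * b ⬝ᵥ (x K - x F) := by linarith
      rw [this]; ring
    have hbr0 := mt (hg1 _ (mem_union_right _ (mem_image_of_mem _
      (mem_product.2 ⟨hHS, (memS K).2 hK⟩ : (H, K) ∈ S ×ˢ S)))) (not_not.2 hbr)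
    rw [not_not, sub_eq_zero] at hbr0
    exact hKH (eq_of_smul_sub_eq hb hHpos hbr0).symm

/-! ### Every run of the algorithm is correct -/

/-- Some maximizer of a convex function over finitely many points is the only maximizer of a
linear functional, up to its multiplicity. -/
theorem exists_exposed_maximizer {ι : Type*} {k : ℕ} (S : Finset ι) (hS : S.Nonempty)
    (p : ι → Fin k → ℚ) (c : (Fin k → ℚ) → ℚ) (hc : ConvexOn ℚ Set.univ c) :
    ∃ i ∈ S, (∀ j ∈ S, c (p j) ≤ c (p i)) ∧
      ∃ a : Fin k → ℚ, ∀ j ∈ S, p j ≠ p i → a ⬝ᵥ p j < a ⬝ᵥ p i := by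
  classical
  obtain ⟨i₁, hi₁, hmax₁⟩ := S.exists_max_image (fun i => c (p i)) hS
  -- Among the maximizers one of largest Euclidean norm is taken: it is not a convex combination of
  -- other maximizers, even where `c` is constant on a face.
  obtain ⟨i, hi, hmax⟩ := (S.filter fun i => c (p i) = c (p i₁)).exists_max_image
    (fun i => p i ⬝ᵥ p i) ⟨i₁, mem_filter.2 ⟨hi₁, rfl⟩⟩
  obtain ⟨hiS, hic⟩ := mem_filter.1 hi
  have hle : ∀ j ∈ S, c (p j) ≤ c (p i) := fun j hj => hic ▸ hmax₁ j hj
  refine ⟨i, hiS, hle, ?_⟩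
  rcases gordan (S.filter fun j => p j ≠ p i) (fun j => p i - p j) with ⟨a, ha⟩ |
    ⟨l, hl, ⟨j₀, hj₀, hlj₀⟩, hsum⟩
  · refine ⟨a, fun j hj hne => ?_⟩
    have := ha j (mem_filter.2 ⟨hj, hne⟩)
    rw [dotProduct_sub] at this
    linarith
  -- Otherwise Gordan's alternative writes `p i` as a convex combination of points different from
  -- it. By Jensen, those of positive weight are maximizers too, so their norms do not exceed that
  -- of `p i`.
  exfalso
  set R := S.filter fun j => p j ≠ p i with hR
  set Λ := ∑ j ∈ R, l j with hΛ
  have hΛpos : 0 < Λ := Finset.sum_pos' hl ⟨j₀, hj₀, hlj₀⟩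
  set q : ι → ℚ := fun j => l j / Λ with hq
  have hq0 : ∀ j ∈ R, 0 ≤ q j := fun j hj => div_nonneg (hl j hj) hΛpos.le
  have hq1 : ∑ j ∈ R, q j = 1 := by rw [hq, ← Finset.sum_div, div_self hΛpos.ne']
  have hqs : ∑ j ∈ R, q j • p j = p i := by
    have h1 : ∑ j ∈ R, q j • (p i - p j) = 0 := by
      have : ∑ j ∈ R, q j • (p i - p j) = Λ⁻¹ • ∑ j ∈ R, l j • (p i - p j) := by
        rw [Finset.smul_sum]
        exact Finset.sum_congr rfl fun j _ => by
          rw [smul_smul, ← div_eq_inv_mul]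
      rw [this, hsum, smul_zero]
    simp only [smul_sub, Finset.sum_sub_distrib, ← Finset.sum_smul, hq1, one_smul] at h1
    exact (sub_eq_zero.1 h1).symm
  have hcj : ∀ j ∈ R, 0 < q j → c (p j) = c (p i) := by
    intro j hj hqj
    have h1 := hc.map_sum_le hq0 hq1 (fun j _ => Set.mem_univ (p j))
    rw [hqs] at h1
    simp only [smul_eq_mul] at h1
    by_contra hne
    have : ∑ j ∈ R, q j * c (p j) < ∑ j ∈ R, q j * c (p i) :=
      Finset.sum_lt_sum (fun j hj => mul_le_mul_of_nonneg_left (hle j (mem_filter.1 hj).1)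
        (hq0 j hj)) ⟨j, hj, mul_lt_mul_of_pos_left
          (lt_of_le_of_ne (hle j (mem_filter.1 hj).1) hne) hqj⟩
    rw [← Finset.sum_mul, hq1, one_mul] at this
    linarith
  -- The weighted variance about the barycentre `p i` equals the mean of the squared norms minus the
  -- squared norm of `p i`, which is nonpositive by the choice of `i`.
  have hnn : ∑ j ∈ R, q j * ((p j - p i) ⬝ᵥ (p j - p i)) ≤ 0 := by
    have e : ∑ j ∈ R, q j * ((p j - p i) ⬝ᵥ (p j - p i))
        = ∑ j ∈ R, q j * (p j ⬝ᵥ p j - p i ⬝ᵥ p i) := by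
      have h1 : ∑ j ∈ R, q j * (p i ⬝ᵥ (p j - p i)) = 0 := by
        have : ∑ j ∈ R, q j * (p i ⬝ᵥ (p j - p i)) = p i ⬝ᵥ ∑ j ∈ R, q j • (p j - p i) := by
          rw [dotProduct_sum]
          exact Finset.sum_congr rfl fun j _ => by rw [dotProduct_smul, smul_eq_mul]
        rw [this]
        simp only [smul_sub, Finset.sum_sub_distrib, ← Finset.sum_smul, hq1, one_smul, hqs,
          sub_self, dotProduct_zero]
      have h2 : ∀ j, q j * ((p j - p i) ⬝ᵥ (p j - p i)) = q j * (p j ⬝ᵥ p j - p i ⬝ᵥ p i)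
          - 2 * (q j * (p i ⬝ᵥ (p j - p i))) := fun j => by
        simp only [sub_dotProduct, dotProduct_sub, dotProduct_comm (p j) (p i)]; ring
      simp only [h2, Finset.sum_sub_distrib, ← Finset.mul_sum, h1, mul_zero, sub_zero]
    rw [e]
    refine Finset.sum_nonpos fun j hj => ?_
    rcases (hq0 j hj).eq_or_lt with h | h
    · rw [← h, zero_mul]
    · refine mul_nonpos_of_nonneg_of_nonpos h.le ?_
      have := hmax j (mem_filter.2 ⟨(mem_filter.1 hj).1, (hcj j hj h).trans hic⟩)
      linarith
  have hpos : 0 < ∑ j ∈ R, q j * ((p j - p i) ⬝ᵥ (p j - p i)) := by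
    refine Finset.sum_pos' (fun j hj => mul_nonneg (hq0 j hj)
      (Finset.sum_nonneg fun _ _ => mul_self_nonneg _)) ⟨j₀, hj₀, mul_pos (div_pos hlj₀ hΛpos) ?_⟩
    exact dotProduct_self_pos (sub_ne_zero.2 (mem_filter.1 hj₀).2)
  linarith

/-! ### Vertices of zonotopes -/

theorem dotProduct_sum_smul {k : ℕ} {ι : Type} [Fintype ι] (a : Fin k → ℚ) (l : ι → ℚ)
    (v : ι → Fin k → ℚ) : a ⬝ᵥ ∑ i, l i • v i = ∑ i, l i * (a ⬝ᵥ v i) := by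
  rw [dotProduct_sum]
  exact Finset.sum_congr rfl fun i _ => by rw [dotProduct_smul, smul_eq_mul]

/-- The vertex of a zonotope at which the generic functional `a` is maximized. -/
def zoneVertex {k : ℕ} {ι : Type} [Fintype ι] (v : ι → Fin k → ℚ) (a : Fin k → ℚ) : Fin k → ℚ :=
  ∑ i, (if 0 < a ⬝ᵥ v i then 1 else -1 : ℚ) • v i

theorem zoneVertex_mem {k : ℕ} {ι : Type} [Fintype ι] (v : ι → Fin k → ℚ) (a : Fin k → ℚ) :
    zoneVertex v a ∈ zone v :=
  ⟨fun i => if 0 < a ⬝ᵥ v i then 1 else -1, fun i => by dsimp only; split_ifs <;> norm_num, rfl⟩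

theorem mul_le_sign_mul {l x : ℚ} (hl : -1 ≤ l ∧ l ≤ 1) :
    l * x ≤ (if 0 < x then 1 else -1) * x := by
  split_ifs with h
  · exact mul_le_mul_of_nonneg_right hl.2 h.le
  · exact mul_le_mul_of_nonpos_right hl.1 (not_lt.1 h)

theorem dotProduct_le_zoneVertex {k : ℕ} {ι : Type} [Fintype ι] (v : ι → Fin k → ℚ)
    (a : Fin k → ℚ) {x : Fin k → ℚ} (hx : x ∈ zone v) : a ⬝ᵥ x ≤ a ⬝ᵥ zoneVertex v a := by
  obtain ⟨l, hl, rfl⟩ := hx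
  rw [zoneVertex, dotProduct_sum_smul, dotProduct_sum_smul]
  exact Finset.sum_le_sum fun i _ => mul_le_sign_mul (hl i)

/-- Over a zonotope a linear functional is maximized coefficient by coefficient. Equality forces
each coefficient with `a ⬝ᵥ v i ≠ 0`, and the others multiply zero vectors. -/
theorem mem_normalCone_zoneVertex {k : ℕ} {ι : Type} [Fintype ι] {v : ι → Fin k → ℚ}
    {a : Fin k → ℚ} (ha : ∀ i, v i ≠ 0 → a ⬝ᵥ v i ≠ 0) :
    a ∈ normalCone (zone v) {zoneVertex v a} := by
  ext x
  constructor
  · rintro ⟨⟨l, hl, rfl⟩, hmax⟩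
    have h1 := hmax _ (zoneVertex_mem v a)
    rw [zoneVertex, dotProduct_sum_smul, dotProduct_sum_smul] at h1
    have h2 := fun i (_ : i ∈ Finset.univ) => mul_le_sign_mul (x := a ⬝ᵥ v i) (hl i)
    have h3 := (Finset.sum_eq_sum_iff_of_le h2).1 (le_antisymm (Finset.sum_le_sum h2) h1)
    refine Finset.sum_congr rfl fun i hi => ?_
    by_cases hv : v i = 0
    · rw [hv, smul_zero, smul_zero]
    · rw [mul_right_cancel₀ (ha i hv) (h3 i hi)]
  · rintro rfl
    exact ⟨zoneVertex_mem v a, fun y hy => dotProduct_le_zoneVertex v a hy⟩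

/-- If `a` vanished at a nonzero `v i`, the coefficient of `v i` could be changed at a maximizer
without changing the value, contradicting uniqueness. -/
theorem ne_zero_of_mem_normalCone {k : ℕ} {ι : Type} [Fintype ι] {v : ι → Fin k → ℚ}
    {a u : Fin k → ℚ} (ha : a ∈ normalCone (zone v) {u}) (i : ι) (hv : v i ≠ 0) :
    a ⬝ᵥ v i ≠ 0 := by
  classical
  intro h0
  have hu : ∀ x, (x ∈ zone v ∧ ∀ y ∈ zone v, a ⬝ᵥ y ≤ a ⬝ᵥ x) ↔ x = u := fun x =>
    Set.ext_iff.1 ha x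
  obtain ⟨⟨l, hl, rfl⟩, hmax⟩ := (hu u).2 rfl
  have key : ∀ r : ℚ, -1 ≤ r → r ≤ 1 →
      ∑ j, Function.update l i r j • v j = ∑ j, l j • v j := by
    intro r hr hr'
    refine (hu _).1 ⟨⟨_, fun j => ?_, rfl⟩, fun y hy => (hmax y hy).trans (le_of_eq ?_)⟩
    · by_cases h : j = i
      · subst h; simp [hr, hr']
      · rw [Function.update_of_ne h]; exact hl j
    · rw [dotProduct_sum_smul, dotProduct_sum_smul]
      refine Finset.sum_congr rfl fun j _ => ?_
      by_cases h : j = i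
      · rw [h, h0, mul_zero, mul_zero]
      · rw [Function.update_of_ne h]
  have e := (key 1 (by norm_num) le_rfl).trans (key 0 (by norm_num) (by norm_num)).symm
  rw [← sub_eq_zero, ← Finset.sum_sub_distrib,
    Finset.sum_eq_single i (fun j _ h => by simp [Function.update_of_ne h]) (by simp)] at e
  simp at e
  exact hv e

theorem eq_zoneVertex_of_mem_normalCone {k : ℕ} {ι : Type} [Fintype ι] {v : ι → Fin k → ℚ}
    {a u : Fin k → ℚ} (ha : a ∈ normalCone (zone v) {u}) : u = zoneVertex v a :=
  ((Set.ext_iff.1 ha _).1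
    ⟨zoneVertex_mem v a, fun _ hy => dotProduct_le_zoneVertex v a hy⟩).symm

/-- Two functionals in the normal cone of the same vertex have the same signs. -/
theorem mul_pos_of_mem_normalCone {k : ℕ} {ι : Type} [Fintype ι] {v : ι → Fin k → ℚ}
    {a a' u : Fin k → ℚ} (ha : a ∈ normalCone (zone v) {u}) (ha' : a' ∈ normalCone (zone v) {u})
    (i : ι) (hv : v i ≠ 0) : 0 < (a ⬝ᵥ v i) * (a' ⬝ᵥ v i) := by
  have e := (eq_zoneVertex_of_mem_normalCone ha).symm.trans (eq_zoneVertex_of_mem_normalCone ha')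
  have e1 := congrArg (fun x => a ⬝ᵥ x) e
  simp only [zoneVertex, dotProduct_sum_smul] at e1
  -- The signs of `a'` give the same vertex, so they attain the maximum for `a`; termwise equality
  -- then makes the signs agree.
  have h2 := fun i (_ : i ∈ Finset.univ) => mul_le_sign_mul (x := a ⬝ᵥ v i)
    (l := if 0 < a' ⬝ᵥ v i then 1 else -1) (by split_ifs <;> norm_num)
  have h3 := (Finset.sum_eq_sum_iff_of_le h2).1 e1.symm i (Finset.mem_univ i)
  have n1 := ne_zero_of_mem_normalCone ha i hv
  have n2 := ne_zero_of_mem_normalCone ha' i hv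
  have h4 := mul_right_cancel₀ n1 h3
  split_ifs at h4 with p q q
  · exact mul_pos q p
  · norm_num at h4
  · norm_num at h4
  · exact mul_pos_of_neg_of_neg (lt_of_le_of_ne (not_lt.1 q) n1) (lt_of_le_of_ne (not_lt.1 p) n2)

theorem dotProduct_weight {n d : ℕ} (w : Fin n → Fin d → ℚ) (a : Fin d → ℚ)
    (F : Finset (Fin n)) : weight (pullback w a) F = a ⬝ᵥ weight w F := by
  simp only [weight, pullback, dotProduct_sum]

theorem pullback_dotProduct {n d : ℕ} (w : Fin n → Fin d → ℚ) (a : Fin d → ℚ) (x : Fin n → ℚ) :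
    pullback w a ⬝ᵥ x = a ⬝ᵥ omega w x := by
  rw [omega, dotProduct_sum_smul]
  exact Finset.sum_congr rfl fun j _ => mul_comm _ _

/-- If `a` and `a'` have the same signs at the images of all edge-directions, then a member of
maximum weight for `a` is one for `a'`. -/
theorem weight_le_of_sameSign {n d : ℕ} {ι : Type} {𝓕 : Set (Finset (Fin n))}
    {w : Fin n → Fin d → ℚ} {e : ι → Fin n → ℚ} (hE : EdgeGuaranteed 𝓕 e) {a a' : Fin d → ℚ}
    (hs : ∀ i, omega w (e i) ≠ 0 → 0 < (a ⬝ᵥ omega w (e i)) * (a' ⬝ᵥ omega w (e i)))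
    {F : Finset (Fin n)} (hF : F ∈ 𝓕)
    (hmax : ∀ G ∈ 𝓕, weight (pullback w a) G ≤ weight (pullback w a) F) :
    ∀ G ∈ 𝓕, weight (pullback w a') G ≤ weight (pullback w a') F := by
  by_contra! hcon
  obtain ⟨G, hG, hlt⟩ := hcon
  obtain ⟨H, hH, hedge, hlt'⟩ := exists_edge_weight_lt 𝓕 _ hF hG hlt
  obtain ⟨i, r, hr, hei⟩ := hE.2 _ _ hedge
  have val : ∀ a : Fin d → ℚ, a ⬝ᵥ omega w (e i)
      = r * (weight (pullback w a) H - weight (pullback w a) F) := fun a => by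
    rw [← pullback_dotProduct, hei, dotProduct_smul, dotProduct_sub, dotProduct_indicatorVec,
      dotProduct_indicatorVec, smul_eq_mul]
  have hne : omega w (e i) ≠ 0 := fun h0 => by
    have := val a'
    rw [h0, dotProduct_zero] at this
    rcases mul_eq_zero.1 this.symm with h | h
    · exact hr h
    · linarith
  have h1 := hs i hne
  rw [val a, val a'] at h1
  have h2 : 0 < (weight (pullback w a) H - weight (pullback w a) F) *
      ((r * r) * (weight (pullback w a') H - weight (pullback w a') F)) := by
    calc _ < _ := h1
      _ = _ := by ring
  have h3 := (mul_pos_iff_of_pos_right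
    -- The multiple `r` enters squared, so the orientation of the direction vector is irrelevant.
    (mul_pos (mul_self_pos.2 hr) (sub_pos.2 hlt'))).1 h2
  linarith [hmax H hH]

/-- The functional exposing an optimal weight is moved into the interior of a cell of the
arrangement of the ω(e i). The functional listed for that cell has the same linear optima, so the
oracle's answer to it has the exposed, optimal weight. -/
theorem IsAlgorithmRun.isConvexOptimum {n d : ℕ} {ι : Type} [Fintype ι]
    {𝓕 : Set (Finset (Fin n))} {w : Fin n → Fin d → ℚ} {e : ι → Fin n → ℚ}
    {O : (Fin n → ℚ) → Finset (Fin n)} {c : (Fin d → ℚ) → ℚ} (hE : EdgeGuaranteed 𝓕 e)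
    (hO : IsLinearOracle 𝓕 O) (hc : ConvexOn ℚ Set.univ c) {fnl lin ev out}
    (h : IsAlgorithmRun w e O c fnl lin ev out) : IsConvexOptimum 𝓕 w c out := by
  classical
  have mem : ∀ F ∈ lin.map O, F ∈ 𝓕 := fun F hF => by
    obtain ⟨b, _, rfl⟩ := List.mem_map.1 hF
    exact (hO b).1
  obtain ⟨i, hi, hbest, a, ha⟩ := exists_exposed_maximizer 𝓕.toFinite.toFinset
    (by simpa using hE.1) (weight w) c hc
  -- The perturbation must avoid the hyperplanes of the edge directions and at the same time keep
  -- exposing `weight w i`.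
  set T : Finset (Fin d → ℚ) := (Finset.univ.image fun i => omega w (e i)) ∪
    𝓕.toFinite.toFinset.image fun G => weight w i - weight w G with hT
  obtain ⟨a', hg, hs⟩ := exists_generic T a
  have ha' : ∀ G ∈ 𝓕, weight w G ≠ weight w i → a' ⬝ᵥ weight w G < a' ⬝ᵥ weight w i := by
    intro G hG hne
    have hG' : G ∈ 𝓕.toFinite.toFinset := by simpa using hG
    have h1 := ha G hG' hne
    have h2 : 0 < a ⬝ᵥ (weight w i - weight w G) := by rw [dotProduct_sub]; linarith
    have h3 := (mul_pos_iff_of_pos_left h2).1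
      (hs _ (mem_union_right _ (mem_image_of_mem _ hG')) h2.ne')
    rw [dotProduct_sub] at h3
    linarith
  have hcone := mem_normalCone_zoneVertex (v := fun i => omega w (e i)) (a := a')
    fun i => hg _ (mem_union_left _ (mem_image_of_mem _ (Finset.mem_univ i)))
  obtain ⟨a₁, ha₁, hcone₁⟩ := h.all_vertices _ ⟨a', hcone⟩
  have hF := hO (pullback w a₁)
  have hmax := weight_le_of_sameSign (w := w) hE
    (fun i hi => mul_pos_of_mem_normalCone hcone₁ hcone i hi) hF.1 hF.2
  have heq : weight w (O (pullback w a₁)) = weight w i := by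
    by_contra hne
    have h1 := ha' _ hF.1 hne
    have h2 := hmax i (by simpa using hi)
    rw [dotProduct_weight, dotProduct_weight] at h2
    linarith
  refine ⟨mem out h.out_mem, fun G hG => (hbest G (by simpa using hG)).trans ?_⟩
  rw [← heq]
  refine h.out_max _ (List.mem_map.2 ⟨pullback w a₁, ?_, rfl⟩)
  rw [h.lin_eq]
  exact List.mem_map.2 ⟨a₁, ha₁, rfl⟩

end ConvexOpt

namespace ConvexOpt

open Finset

/-! ### Functionals defined by tuples of vectors -/

/-- The matrix whose rows are the vectors `r (t k)`. -/
def tupleMat {d : ℕ} (r : ℕ → Fin d → ℚ) (t : Fin d → ℕ) : Matrix (Fin d) (Fin d) ℚ :=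
  Matrix.of fun k => r (t k)

def tupleDet {d : ℕ} (r : ℕ → Fin d → ℚ) (t : Fin d → ℕ) : ℚ := (tupleMat r t).det

/-- The functional that takes the values `det ^ 2 * ε ^ k` at the vectors `r (t k)`. -/
def tupleFunctional {d : ℕ} (r : ℕ → Fin d → ℚ) (ε : ℚ) (t : Fin d → ℕ) : Fin d → ℚ :=
  tupleDet r t • (tupleMat r t).cramer fun k => ε ^ (k : ℕ)

variable {d : ℕ} (r : ℕ → Fin d → ℚ)

theorem tupleMat_update (t : Fin d → ℕ) (k : Fin d) (i : ℕ) :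
    tupleMat r (Function.update t k i) = (tupleMat r t).updateRow k (r i) := by
  ext a b
  by_cases h : a = k
  · subst h; simp [tupleMat]
  · simp [tupleMat, h]

/-- Cramer's rule with the denominator cleared, hence valid for singular tuples as well: the
coefficients are the coordinates of `x` times the determinant. -/
theorem tupleDet_smul (t : Fin d → ℕ) (x : Fin d → ℚ) :
    tupleDet r t • x = ∑ k, ((tupleMat r t).updateRow k x).det • r (t k) := by
  have h := Matrix.mulVec_cramer (tupleMat r t).transpose x
  rw [Matrix.det_transpose] at h
  rw [tupleDet, ← h]
  ext l
  simp only [Matrix.mulVec, dotProduct, Matrix.transpose_apply, Matrix.cramer_transpose_apply,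
    Finset.sum_apply, Pi.smul_apply, smul_eq_mul]
  exact Finset.sum_congr rfl fun k _ => mul_comm _ _

theorem tupleFunctional_dotProduct_row (ε : ℚ) (t : Fin d → ℕ) (k : Fin d) :
    tupleFunctional r ε t ⬝ᵥ r (t k) = tupleDet r t * (tupleDet r t * ε ^ (k : ℕ)) := by
  have h := congrFun (Matrix.mulVec_cramer (tupleMat r t) fun k => ε ^ (k : ℕ)) k
  rw [tupleFunctional, smul_dotProduct, dotProduct_comm]
  exact congrArg (tupleDet r t * ·) h

theorem tupleFunctional_dotProduct {ε : ℚ} {t : Fin d → ℕ} (ht : tupleDet r t ≠ 0) (i : ℕ) :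
    tupleFunctional r ε t ⬝ᵥ r i
      = tupleDet r t * ∑ k, tupleDet r (Function.update t k i) * ε ^ (k : ℕ) := by
  have h := congrArg (fun x => tupleFunctional r ε t ⬝ᵥ x) (tupleDet_smul r t (r i))
  simp only [dotProduct_smul, smul_eq_mul, dotProduct_sum_smul,
    tupleFunctional_dotProduct_row] at h
  refine mul_left_cancel₀ ht ?_
  rw [h, Finset.mul_sum, Finset.mul_sum]
  refine Finset.sum_congr rfl fun k _ => ?_
  rw [← tupleMat_update, ← tupleDet]; ring

/-- The nonzero determinants of `d`-tuples of the first `N` vectors differ in absolute value by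
a factor of at least `η` from all determinants. -/
def Separated (N : ℕ) (η : ℚ) : Prop :=
  0 < η ∧ ∀ t t' : Fin d → ℕ, (∀ k, t k < N) → (∀ k, t' k < N) → tupleDet r t' ≠ 0 →
    η * |tupleDet r t| ≤ |tupleDet r t'|

theorem exists_separated (N : ℕ) : ∃ η, Separated r N η := by
  classical
  set S : Finset (Fin d → ℕ) := Fintype.piFinset fun _ => Finset.range N with hS
  have memS : ∀ t, t ∈ S ↔ ∀ k, t k < N := fun t => by simp [hS]
  obtain ⟨η, hη, h⟩ := exists_pos_mul_lt (S ×ˢ S) (fun p => |tupleDet r p.2|)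
    (fun p => |tupleDet r p.1|)
  exact ⟨η, hη, fun t t' ht ht' h0 => (h (t, t')
    (mem_product.2 ⟨(memS t).2 ht, (memS t').2 ht'⟩) (abs_pos.2 h0)).le⟩

variable {r}

/-- The term of the first nonzero coordinate dominates: each later term is at most `|D k₀| / η * ε ^
(k₀ + 1)`, there are fewer than `d` of them, and `ε = η / (2 * d)` makes their sum at most half of
the leading term. -/
theorem tupleFunctional_leading {N : ℕ} {η : ℚ} (hη : Separated r N η) {t : Fin d → ℕ}
    (htN : ∀ k, t k < N) (ht : tupleDet r t ≠ 0) {i : ℕ} (hi : i < N) {k₀ : Fin d}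
    (hlow : ∀ k < k₀, tupleDet r (Function.update t k i) = 0)
    (hk₀ : tupleDet r (Function.update t k₀ i) ≠ 0) :
    0 < (tupleDet r t * tupleDet r (Function.update t k₀ i)) *
      (tupleFunctional r (η / (2 * d)) t ⬝ᵥ r i) := by
  have hd : (0 : ℚ) < d := Nat.cast_pos.2 (Fin.pos k₀)
  have hη0 := hη.1
  -- Separation of the determinant of `t` from itself.
  have hη1 : η ≤ 1 := by
    have := hη.2 t t htN htN ht
    exact le_of_mul_le_mul_right (by linarith) (abs_pos.2 ht)
  set ε := η / (2 * d) with hε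
  have hε0 : 0 < ε := by positivity
  have hε1 : ε ≤ 1 := by
    rw [hε, div_le_one (by positivity)]
    have : (1 : ℚ) ≤ d := by exact_mod_cast Fin.pos k₀
    linarith
  set D : Fin d → ℚ := fun k => tupleDet r (Function.update t k i) with hD
  have hupd : ∀ k k', Function.update t k i k' < N := fun k k' => by
    by_cases h : k' = k
    · subst h; simpa using hi
    · rw [Function.update_of_ne h]; exact htN k'
  have hrest : |∑ k ∈ univ.erase k₀, D k * ε ^ (k : ℕ)| < |D k₀| * ε ^ (k₀ : ℕ) := by
    have hterm : ∀ k ∈ univ.erase k₀,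
        |D k * ε ^ (k : ℕ)| ≤ |D k₀| / η * (ε ^ (k₀ : ℕ) * ε) := by
      intro k hk
      rcases lt_or_gt_of_ne (Finset.ne_of_mem_erase hk) with h | h
      · rw [hD]; simp only [hlow k h, zero_mul, abs_zero]
        exact mul_nonneg (div_nonneg (abs_nonneg _) hη0.le) (by positivity)
      · rw [abs_mul, abs_of_pos (pow_pos hε0 _), ← pow_succ]
        refine mul_le_mul ?_ (pow_le_pow_of_le_one hε0.le hε1 h) (by positivity)
          (div_nonneg (abs_nonneg _) hη0.le)
        rw [le_div_iff₀ hη0, mul_comm]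
        exact hη.2 _ _ (hupd k) (hupd k₀) hk₀
    have hpos : 0 < |D k₀| * ε ^ (k₀ : ℕ) := mul_pos (abs_pos.2 hk₀) (pow_pos hε0 _)
    calc _ ≤ ∑ k ∈ univ.erase k₀, |D k * ε ^ (k : ℕ)| := Finset.abs_sum_le_sum_abs _ _
      _ ≤ ∑ k ∈ univ.erase k₀, |D k₀| / η * (ε ^ (k₀ : ℕ) * ε) := Finset.sum_le_sum hterm
      _ ≤ d * (|D k₀| / η * (ε ^ (k₀ : ℕ) * ε)) := by
        rw [Finset.sum_const, nsmul_eq_mul]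
        refine mul_le_mul_of_nonneg_right ?_
          (mul_nonneg (div_nonneg (abs_nonneg _) hη0.le) (by positivity))
        exact_mod_cast (Finset.card_le_univ _).trans_eq (Fintype.card_fin d)
      _ = |D k₀| * ε ^ (k₀ : ℕ) / 2 := by
        rw [hε]; field_simp
      _ < _ := by linarith
  rw [tupleFunctional_dotProduct r ht, ← Finset.add_sum_erase _ _ (Finset.mem_univ k₀)]
  set R := ∑ k ∈ univ.erase k₀, D k * ε ^ (k : ℕ) with hR
  have h2 : 0 < D k₀ * (D k₀ * ε ^ (k₀ : ℕ) + R) := by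
    have h3 : |D k₀ * R| < D k₀ * (D k₀ * ε ^ (k₀ : ℕ)) := by
      rw [abs_mul, ← mul_assoc, ← abs_mul_abs_self (D k₀), mul_assoc]
      exact mul_lt_mul_of_pos_left hrest (abs_pos.2 hk₀)
    rw [mul_add]
    linarith [neg_abs_le (D k₀ * R)]
  have h4 : 0 < (tupleDet r t * tupleDet r t) * (D k₀ * (D k₀ * ε ^ (k₀ : ℕ) + R)) :=
    mul_pos (mul_self_pos.2 ht) h2
  calc 0 < _ := h4
    _ = _ := by rw [hD]; ring

/-- A nonzero vector has a nonzero coordinate in the basis given by the tuple. -/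
theorem exists_leading {t : Fin d → ℕ} (ht : tupleDet r t ≠ 0) {i : ℕ} (hi : r i ≠ 0) :
    ∃ k₀, (∀ k < k₀, tupleDet r (Function.update t k i) = 0) ∧
      tupleDet r (Function.update t k₀ i) ≠ 0 := by
  classical
  have hne : (univ.filter fun k => tupleDet r (Function.update t k i) ≠ 0).Nonempty := by
    by_contra hcon
    rw [Finset.not_nonempty_iff_eq_empty, Finset.filter_eq_empty_iff] at hcon
    have h := tupleDet_smul r t (r i)
    rw [Finset.sum_eq_zero fun k _ => ?_] at h
    · exact (smul_ne_zero ht hi) h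
    · have := hcon (Finset.mem_univ k)
      rw [not_not, tupleDet, tupleMat_update] at this
      rw [this, zero_smul]
  obtain ⟨k₀, hk₀, hmin⟩ := Finset.exists_min_image _ id hne
  refine ⟨k₀, fun k hk => ?_, (mem_filter.1 hk₀).2⟩
  by_contra h
  exact absurd (hmin k (mem_filter.2 ⟨Finset.mem_univ k, h⟩)) (not_le.2 hk)

theorem tupleFunctional_generic {N : ℕ} {η : ℚ} (hη : Separated r N η) {t : Fin d → ℕ}
    (htN : ∀ k, t k < N) (ht : tupleDet r t ≠ 0) {i : ℕ} (hi : i < N) (hr : r i ≠ 0) :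
    tupleFunctional r (η / (2 * d)) t ⬝ᵥ r i ≠ 0 := by
  obtain ⟨k₀, h1, h2⟩ := exists_leading ht hr
  exact right_ne_zero_of_mul (tupleFunctional_leading hη htN ht hi h1 h2).ne'

/-! ### Every cell contains one of these functionals -/

/-- A functional that vanishes on `S` but not at `v`. -/
theorem exists_dotProduct_ne_zero {S : Set (Fin d → ℚ)} {v : Fin d → ℚ}
    (hv : v ∉ Submodule.span ℚ S) : ∃ z : Fin d → ℚ, (∀ s ∈ S, z ⬝ᵥ s = 0) ∧ z ⬝ᵥ v < 0 := by
  obtain ⟨f, hf, hS⟩ := Submodule.exists_le_ker_of_notMem hv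
  set z : Fin d → ℚ := fun k => f (Pi.single k 1) with hz
  have hfz : ∀ x, z ⬝ᵥ x = f x := fun x => by
    conv_rhs => rw [pi_eq_sum_univ' x, map_sum]
    refine Finset.sum_congr rfl fun k _ => ?_
    rw [map_smul, smul_eq_mul, mul_comm, hz]
  have hz0 : ∀ s ∈ S, z ⬝ᵥ s = 0 := fun s hs => by
    rw [hfz]; exact hS (Submodule.subset_span hs)
  rw [← hfz] at hf
  rcases lt_or_gt_of_ne hf with h | h
  · exact ⟨z, hz0, h⟩
  · exact ⟨-z, fun s hs => by rw [neg_dotProduct, hz0 s hs, neg_zero], by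
      rw [neg_dotProduct]; linarith⟩

/-- A set of vectors in an open halfspace has a nonnegative functional whose zeros span, together
with one of the vectors, all of them. -/
theorem exists_facet (T U : Finset (Fin d → ℚ)) (hU : U ⊆ T) (hne : U.Nonempty) (x : Fin d → ℚ)
    (hx : ∀ v ∈ T, 0 < x ⬝ᵥ v) :
    ∃ y : Fin d → ℚ, ∃ b ∈ U, (∀ v ∈ T, 0 ≤ y ⬝ᵥ v) ∧ 0 < y ⬝ᵥ b ∧
      ∀ v ∈ T, v ∈ Submodule.span ℚ (insert b {u | u ∈ T ∧ y ⬝ᵥ u = 0}) := by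
  classical
  -- A good functional with as few nonzeros on `T` as possible has the required spanning property.
  -- Positivity somewhere on `U`, and not merely on `T`, is what puts `b` into `U`.
  set Good : (Fin d → ℚ) → Prop := fun y => (∀ v ∈ T, 0 ≤ y ⬝ᵥ v) ∧ ∃ b ∈ U, 0 < y ⬝ᵥ b with hG
  obtain ⟨b₀, hb₀⟩ := hne
  have hex : ∃ k, ∃ y, Good y ∧ (T.filter fun u => ¬ y ⬝ᵥ u = 0).card = k :=
    ⟨_, x, ⟨fun v hv => (hx v hv).le, b₀, hb₀, hx b₀ (hU hb₀)⟩, rfl⟩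
  obtain ⟨y, ⟨hy, b, hb, hyb⟩, hcard⟩ := Nat.find_spec hex
  refine ⟨y, b, hb, hy, hyb, fun v hv => ?_⟩
  by_contra hspan
  -- If the zeros of `y` and `b` fail to span, `y` is moved along a direction `z` that vanishes on
  -- them until it meets the first new zero. The value at `b` does not change, so the moved
  -- functional is good and has fewer nonzeros.
  obtain ⟨z, hz, hzv⟩ := exists_dotProduct_ne_zero hspan
  set W := T.filter fun u => z ⬝ᵥ u < 0 with hW
  obtain ⟨v', hv', hmin⟩ := W.exists_min_image (fun u => y ⬝ᵥ u / -(z ⬝ᵥ u))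
    ⟨v, mem_filter.2 ⟨hv, hzv⟩⟩
  obtain ⟨hv'T, hzv'⟩ := mem_filter.1 hv'
  set s := y ⬝ᵥ v' / -(z ⬝ᵥ v') with hs
  have hs0 : 0 ≤ s := div_nonneg (hy v' hv'T) (by linarith)
  have hval : ∀ u, (y + s • z) ⬝ᵥ u = y ⬝ᵥ u + s * z ⬝ᵥ u := fun u => by
    rw [add_dotProduct, smul_dotProduct, smul_eq_mul]
  have hnew : (y + s • z) ⬝ᵥ v' = 0 := by
    rw [hval, hs]; field_simp [hzv'.ne]; ring
  have hold : ∀ u ∈ T, y ⬝ᵥ u = 0 → (y + s • z) ⬝ᵥ u = 0 := fun u hu h0 => by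
    rw [hval, h0, hz u (Set.mem_insert_of_mem _ ⟨hu, h0⟩), mul_zero, add_zero]
  have hyv' : ¬ y ⬝ᵥ v' = 0 := fun h0 => by
    have := hz v' (Set.mem_insert_of_mem _ ⟨hv'T, h0⟩)
    linarith
  refine Nat.find_min hex (m := (T.filter fun u => ¬ (y + s • z) ⬝ᵥ u = 0).card) ?_
    ⟨y + s • z, ⟨fun u hu => ?_, b, hb, ?_⟩, rfl⟩
  · rw [← hcard]
    refine Finset.card_lt_card (Finset.ssubset_iff_of_subset (fun u hu => ?_) |>.2
      ⟨v', mem_filter.2 ⟨hv'T, hyv'⟩, fun h => (mem_filter.1 h).2 hnew⟩)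
    obtain ⟨h1, h2⟩ := mem_filter.1 hu
    exact mem_filter.2 ⟨h1, fun h => h2 (hold u h1 h)⟩
  · rw [hval]
    rcases le_or_gt 0 (z ⬝ᵥ u) with h | h
    · exact add_nonneg (hy u hu) (mul_nonneg hs0 h)
    · have := hmin u (mem_filter.2 ⟨hu, h⟩)
      rw [le_div_iff₀ (by linarith)] at this
      linarith
  · rw [hval, hz b (Set.mem_insert _ _), mul_zero, add_zero]
    exact hyb

/-- A finite set of vectors in an open halfspace has a basis with respect to which all its members
have lexicographically positive coordinates, as witnessed by a triangular system `y`. -/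
theorem exists_lexBasis (T : Finset (Fin d → ℚ)) (x : Fin d → ℚ) (hx : ∀ v ∈ T, 0 < x ⬝ᵥ v)
    (U : Finset (Fin d → ℚ)) (hU : U ⊆ T) (hne : T.Nonempty → U.Nonempty) :
    ∃ (k : ℕ) (y b : Fin k → Fin d → ℚ), (∀ i, b i ∈ T) ∧ (∀ i : Fin k, (i : ℕ) = 0 → b i ∈ U) ∧
      (∀ i, 0 < y i ⬝ᵥ b i) ∧ (∀ i j, i < j → y i ⬝ᵥ b j = 0) ∧
      (∀ v ∈ T, v ∈ Submodule.span ℚ (Set.range b)) ∧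
      (∀ v ∈ T, ∃ i, (∀ j < i, y j ⬝ᵥ v = 0) ∧ 0 < y i ⬝ᵥ v) := by
  classical
  induction hcard : T.card using Nat.strong_induction_on generalizing T U with
  | _ N ih =>
  rcases T.eq_empty_or_nonempty with rfl | hTne
  · exact ⟨0, Fin.elim0, Fin.elim0, fun i => i.elim0, fun i => i.elim0, fun i => i.elim0,
      fun i => i.elim0, by simp, by simp⟩
  obtain ⟨y₀, b₀, hb₀, hy₀, hyb₀, hsp⟩ := exists_facet T U hU (hne hTne) x hx
  set T₀ := T.filter fun u => y₀ ⬝ᵥ u = 0 with hT₀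
  have hsub : T₀ ⊆ T := Finset.filter_subset _ _
  have hlt : T₀.card < N := by
    rw [← hcard]
    refine Finset.card_lt_card ((Finset.ssubset_iff_of_subset hsub).2 ⟨b₀, hU hb₀, fun h => ?_⟩)
    exact hyb₀.ne' (mem_filter.1 h).2
  -- Recursion on the facet where `y₀` vanishes: the later basis vectors lie in it, which gives
  -- triangularity, and vectors off the facet have a positive first entry. Only the first basis
  -- vector is restricted to `U`.
  obtain ⟨k, y, b, hbT, _, hyb, htri, hspan, hlex⟩ := ih _ hlt T₀ (fun v hv => hx v (hsub hv)) T₀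
    Subset.rfl id rfl
  refine ⟨k + 1, Fin.cons y₀ y, Fin.cons b₀ b, ?_, ?_, ?_, ?_, ?_, ?_⟩
  · exact Fin.cases (hU hb₀) fun i => hsub (hbT i)
  · exact Fin.cases (fun _ => hb₀) fun i hi => by simp at hi
  · exact Fin.cases hyb₀ hyb
  · refine Fin.cases (Fin.cases (fun h => absurd h (lt_irrefl _)) fun j _ => ?_)
      fun i => Fin.cases (fun h => absurd h (Fin.not_lt_zero _)) fun j h => ?_
    · exact (mem_filter.1 (hbT j)).2
    · exact htri i j (Fin.succ_lt_succ_iff.1 h)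
  · intro v hv
    refine Submodule.span_le.2 ?_ (hsp v hv)
    rintro u (rfl | ⟨huT, hu0⟩)
    · exact Submodule.subset_span ⟨0, rfl⟩
    · refine Submodule.span_mono ?_ (hspan u (mem_filter.2 ⟨huT, hu0⟩))
      rintro _ ⟨i, rfl⟩
      exact ⟨i.succ, rfl⟩
  · intro v hv
    by_cases h0 : y₀ ⬝ᵥ v = 0
    · obtain ⟨i, h1, h2⟩ := hlex v (mem_filter.2 ⟨hv, h0⟩)
      exact ⟨i.succ, Fin.cases (fun _ => h0) fun j hj => h1 j (Fin.succ_lt_succ_iff.1 hj), h2⟩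
    · exact ⟨0, fun j hj => absurd hj (Fin.not_lt_zero _),
        lt_of_le_of_ne (hy₀ v hv) (Ne.symm h0)⟩

theorem linearIndependent_of_triangular {k : ℕ} {y b : Fin k → Fin d → ℚ}
    (hyb : ∀ i, 0 < y i ⬝ᵥ b i) (htri : ∀ i j, i < j → y i ⬝ᵥ b j = 0) :
    LinearIndependent ℚ b := by
  rw [Fintype.linearIndependent_iff]
  intro g hg i
  induction i using WellFoundedLT.induction with
  | _ i ih =>
  have h := congrArg (fun x => y i ⬝ᵥ x) hg
  simp only [dotProduct_sum_smul, dotProduct_zero] at h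
  rw [Finset.sum_eq_single i (fun j _ hj => ?_) (fun h => absurd (Finset.mem_univ i) h)] at h
  · exact (mul_eq_zero.1 h).resolve_right (hyb i).ne'
  · rcases lt_or_gt_of_ne hj with h | h
    · rw [ih j h, zero_mul]
    · rw [htri i j h, mul_zero]

/-! ### Symmetric systems of rows and the tuples that reach all cells. -/

/-- The unit vectors and their negatives come first among the `N` vectors, and the negative of each
vector is one of them. -/
structure SymmetricRows (r : ℕ → Fin d → ℚ) (N : ℕ) : Prop where
  le : 2 * d ≤ N
  unit : ∀ l : Fin d, r (2 * l) = Pi.single l 1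
  neg_unit : ∀ l : Fin d, r (2 * l + 1) = -Pi.single l 1
  neg : ∀ i < N, ∃ j < N, r j = -r i

/-- The tuples that are enumerated: the first entry refers to a unit vector or its negative. -/
def ValidTuple (d N : ℕ) (t : Fin d → ℕ) : Prop := ∀ k, t k < if (k : ℕ) = 0 then 2 * d else N

theorem ValidTuple.lt {N : ℕ} {t : Fin d → ℕ} (h : ValidTuple d N t) (hN : 2 * d ≤ N) (k : Fin d) :
    t k < N := by
  have := h k
  split_ifs at this
  · exact this.trans_le hN
  · exact this

/-- The rows at which `x` is positive lie in an open halfspace, so they have a lexicographic basis,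
started from a signed unit vector. The functional of that tuple is positive on all of them, and
symmetry settles the rows at which `x` is negative. -/
theorem exists_tuple_sameSign {N : ℕ} {η : ℚ} (hr : SymmetricRows r N) (hη : Separated r N η)
    (x : Fin d → ℚ) (hx : ∀ i < N, r i ≠ 0 → x ⬝ᵥ r i ≠ 0) :
    ∃ t : Fin d → ℕ, ValidTuple d N t ∧ tupleDet r t ≠ 0 ∧
      ∀ i < N, r i ≠ 0 → 0 < (x ⬝ᵥ r i) * (tupleFunctional r (η / (2 * d)) t ⬝ᵥ r i) := by
  classical
  set T : Finset (Fin d → ℚ) := ((range N).filter fun i => 0 < x ⬝ᵥ r i).image r with hT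
  set U : Finset (Fin d → ℚ) := ((range (2 * d)).filter fun i => 0 < x ⬝ᵥ r i).image r with hU
  have memT : ∀ i < N, 0 < x ⬝ᵥ r i → r i ∈ T := fun i hi h =>
    mem_image_of_mem _ (mem_filter.2 ⟨mem_range.2 hi, h⟩)
  have posT : ∀ v ∈ T, 0 < x ⬝ᵥ v := fun v hv => by
    obtain ⟨i, hi, rfl⟩ := mem_image.1 hv
    exact (mem_filter.1 hi).2
  have unit : ∀ l : Fin d, ∃ i < 2 * d, 0 < x ⬝ᵥ r i ∧
      (r i = Pi.single l 1 ∨ r i = -Pi.single l 1) := by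
    intro l
    have hl := l.2
    have h1 : (Pi.single l 1 : Fin d → ℚ) ≠ 0 := by simp
    have h2 := hx (2 * l) (by have := hr.le; omega) (by rw [hr.unit]; exact h1)
    rcases lt_or_gt_of_ne h2 with h | h
    · refine ⟨2 * l + 1, by omega, ?_, Or.inr (hr.neg_unit l)⟩
      rw [hr.neg_unit, dotProduct_neg, ← hr.unit]
      linarith
    · exact ⟨2 * l, by omega, h, Or.inl (hr.unit l)⟩
  have hUT : U ⊆ T := Finset.image_subset_image (Finset.filter_subset_filter _
    (Finset.range_subset_range.2 hr.le))
  have hUne : T.Nonempty → U.Nonempty := by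
    rintro ⟨v, hv⟩
    have hd : 0 < d := by
      rcases Nat.eq_zero_or_pos d with h | h
      · subst h
        simpa using posT v hv
      · exact h
    obtain ⟨i, hi, hpos, _⟩ := unit ⟨0, hd⟩
    exact ⟨r i, mem_image_of_mem _ (mem_filter.2 ⟨mem_range.2 hi, hpos⟩)⟩
  obtain ⟨k, y, b, hbT, hbU, hyb, htri, hspan, hlex⟩ := exists_lexBasis T x posT U hUT hUne
  have hli := linearIndependent_of_triangular hyb htri
  -- For each coordinate one of the two signed unit vectors is positive under `x`, so the basis
  -- spans and has exactly `d` members.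
  have htop : Submodule.span ℚ (Set.range b) = ⊤ := by
    rw [eq_top_iff]
    intro z _
    rw [pi_eq_sum_univ' z]
    refine Submodule.sum_mem _ fun l _ => Submodule.smul_mem _ _ ?_
    obtain ⟨i, hi, hpos, h⟩ := unit l
    have hm := hspan _ (memT i (hi.trans_le hr.le) hpos)
    rcases h with h | h
    · rw [h] at hm
      exact hm
    · rw [h, Submodule.neg_mem_iff] at hm
      exact hm
  have hkd : k = d := by
    have := Module.finrank_eq_card_basis (Module.Basis.mk hli htop.ge)
    simpa using this.symm
  subst hkd
  have hidx : ∀ i : Fin k, ∃ j, j < (if (i : ℕ) = 0 then 2 * k else N) ∧ r j = b i := by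
    intro i
    split_ifs with h0
    · obtain ⟨j, hj, hji⟩ := mem_image.1 (hbU i h0)
      exact ⟨j, mem_range.1 (mem_filter.1 hj).1, hji⟩
    · obtain ⟨j, hj, hji⟩ := mem_image.1 (hbT i)
      exact ⟨j, mem_range.1 (mem_filter.1 hj).1, hji⟩
  choose t htv htb using hidx
  have hdet : tupleDet r t ≠ 0 := by
    have hrow : (tupleMat r t).row = b := by
      ext i l
      rw [← htb]; rfl
    have := Matrix.linearIndependent_rows_iff_isUnit.1 (hrow ▸ hli)
    exact ((Matrix.isUnit_iff_isUnit_det _).1 this).ne_zero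
  have htN : ∀ k, t k < N := ValidTuple.lt htv hr.le
  have key : ∀ i < N, 0 < x ⬝ᵥ r i → 0 < tupleFunctional r (η / (2 * k)) t ⬝ᵥ r i := by
    intro i hi hpos
    obtain ⟨i₀, hlow, hi₀⟩ := hlex _ (memT i hi hpos)
    have hco : tupleDet r t • r i = ∑ l, tupleDet r (Function.update t l i) • b l := by
      rw [tupleDet_smul]
      exact Finset.sum_congr rfl fun l _ => by rw [htb, tupleDet, tupleMat_update]
    have hy : ∀ j, tupleDet r t * y j ⬝ᵥ r i
        = ∑ l, tupleDet r (Function.update t l i) * y j ⬝ᵥ b l := fun j => by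
      have := congrArg (fun v => y j ⬝ᵥ v) hco
      simpa only [dotProduct_smul, smul_eq_mul, dotProduct_sum_smul] using this
    -- Forward substitution in the triangular system: as long as the earlier coordinates vanish, the
    -- value of `y j` is the coordinate `j` times a positive number. Hence the first nonzero
    -- coordinate sits where the first nonzero value does, with the same sign.
    have hsolve : ∀ j, (∀ l < j, tupleDet r (Function.update t l i) = 0) →
        tupleDet r t * y j ⬝ᵥ r i = tupleDet r (Function.update t j i) * y j ⬝ᵥ b j := by
      intro j hj
      rw [hy j, Finset.sum_eq_single j (fun l _ hl => ?_) (fun h => absurd (Finset.mem_univ j) h)]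
      rcases lt_or_gt_of_ne hl with h | h
      · rw [hj l h, zero_mul]
      · rw [htri j l h, mul_zero]
    have hzero : ∀ j < i₀, tupleDet r (Function.update t j i) = 0 := by
      intro j
      induction j using WellFoundedLT.induction with
      | _ j ih =>
      intro hj
      have := hsolve j fun l hl => ih l hl (hl.trans hj)
      rw [hlow j hj, mul_zero] at this
      exact (mul_eq_zero.1 this.symm).resolve_right (hyb j).ne'
    have hlead := hsolve i₀ hzero
    have hpp : 0 < tupleDet r t * tupleDet r (Function.update t i₀ i) := by
      have h1 : 0 < (tupleDet r t * tupleDet r t) * y i₀ ⬝ᵥ r i :=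
        mul_pos (mul_self_pos.2 hdet) hi₀
      have h2 : (tupleDet r t * tupleDet r t) * y i₀ ⬝ᵥ r i
          = (tupleDet r t * tupleDet r (Function.update t i₀ i)) * y i₀ ⬝ᵥ b i₀ := by
        rw [mul_assoc, hlead]; ring
      rw [h2] at h1
      exact (mul_pos_iff_of_pos_right (hyb i₀)).1 h1
    exact (mul_pos_iff_of_pos_left hpp).1
      (tupleFunctional_leading hη htN hdet hi hzero (right_ne_zero_of_mul hpp.ne'))
  refine ⟨t, htv, hdet, fun i hi hri => ?_⟩
  rcases lt_or_gt_of_ne (hx i hi hri) with h | h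
  · obtain ⟨j, hj, hji⟩ := hr.neg i hi
    have h1 := key j hj (by rw [hji, dotProduct_neg]; linarith)
    rw [hji, dotProduct_neg] at h1
    exact mul_pos_of_neg_of_neg h (by linarith)
  · exact mul_pos h (key i hi h)

/-! ### The vertices of the zonotope and their number. -/

/-- The vectors `v i` and their negatives, preceded by the unit vectors and their negatives. -/
def symRows (d : ℕ) (v : ℕ → Fin d → ℚ) (i : ℕ) : Fin d → ℚ :=
  (if i % 2 = 0 then 1 else -1 : ℚ) •
    if h : i / 2 < d then Pi.single ⟨i / 2, h⟩ 1 else v (i / 2 - d)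

theorem symRows_symmetric (v : ℕ → Fin d → ℚ) (M : ℕ) :
    SymmetricRows (symRows d v) (2 * (d + M)) where
  le := by omega
  unit l := by
    have h : 2 * (l : ℕ) / 2 = l := by omega
    simp [symRows, h]
  neg_unit l := by
    have h : (2 * (l : ℕ) + 1) / 2 = l := by omega
    simp [symRows, h]
  neg i hi := by
    rcases Nat.mod_two_eq_zero_or_one i with h | h
    · refine ⟨i + 1, by omega, ?_⟩
      have h1 : (i + 1) / 2 = i / 2 := by omega
      have h2 : (i + 1) % 2 ≠ 0 := by omega
      rw [symRows, symRows, h1, if_neg h2, if_pos h, neg_smul]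
    · refine ⟨i - 1, by omega, ?_⟩
      have h1 : (i - 1) / 2 = i / 2 := by omega
      have h2 : (i - 1) % 2 = 0 := by omega
      have h3 : ¬ i % 2 = 0 := by omega
      rw [symRows, symRows, h1, if_pos h2, if_neg h3, neg_smul, neg_neg]

theorem symRows_apply (v : ℕ → Fin d → ℚ) (i : ℕ) : symRows d v (2 * (d + i)) = v i := by
  have h1 : 2 * (d + i) / 2 = d + i := by omega
  simp [symRows, h1]

/-- The functionals of all tuples with nonzero determinant, in any order and with repetitions,
enumerate the vertices of the zonotope. -/
theorem normal_and_all_vertices {ι : Type} [Fintype ι] {z : ι → Fin d → ℚ}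
    {v : ℕ → Fin d → ℚ} {M : ℕ} {η : ℚ} (hz : ∀ i, ∃ j < M, v j = z i)
    (hη : Separated (symRows d v) (2 * (d + M)) η) {L : List (Fin d → ℕ)}
    (hL : ∀ t, t ∈ L ↔ ValidTuple d (2 * (d + M)) t ∧ tupleDet (symRows d v) t ≠ 0) :
    (∀ a ∈ L.map (tupleFunctional (symRows d v) (η / (2 * d))),
      ∃ u, a ∈ normalCone (zone z) {u}) ∧
    ∀ u, IsVertex (zone z) u → ∃ a ∈ L.map (tupleFunctional (symRows d v) (η / (2 * d))),
      a ∈ normalCone (zone z) {u} := by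
  classical
  have hsym := symRows_symmetric v M
  have gen : ∀ t ∈ L, tupleFunctional (symRows d v) (η / (2 * d)) t ∈ normalCone (zone z)
      {zoneVertex z (tupleFunctional (symRows d v) (η / (2 * d)) t)} := by
    intro t ht
    obtain ⟨h1, h2⟩ := (hL t).1 ht
    refine mem_normalCone_zoneVertex fun i hi => ?_
    obtain ⟨j, hj, hji⟩ := hz i
    rw [← hji, ← symRows_apply v j] at hi ⊢
    exact tupleFunctional_generic hη (h1.lt hsym.le) h2 (by omega) hi
  constructor
  · intro a ha
    obtain ⟨t, ht, rfl⟩ := List.mem_map.1 ha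
    exact ⟨_, gen t ht⟩
  · rintro u ⟨a, ha⟩
    -- The functional `a` is nonzero at the generators but may vanish at the adjoined unit vectors,
    -- hence the perturbation.
    obtain ⟨x, hx1, hx2⟩ := exists_generic ((range (2 * (d + M))).image (symRows d v)) a
    have memr : ∀ i < 2 * (d + M),
        symRows d v i ∈ (range (2 * (d + M))).image (symRows d v) := fun i hi =>
      mem_image_of_mem _ (mem_range.2 hi)
    obtain ⟨t, h1, h2, h3⟩ := exists_tuple_sameSign hsym hη x fun i hi =>
      hx1 _ (memr i hi)
    have ht : t ∈ L := (hL t).2 ⟨h1, h2⟩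
    refine ⟨_, List.mem_map_of_mem ht, ?_⟩
    have e : u = zoneVertex z (tupleFunctional (symRows d v) (η / (2 * d)) t) := by
      rw [eq_zoneVertex_of_mem_normalCone ha]
      refine Finset.sum_congr rfl fun i _ => ?_
      by_cases hzi : z i = 0
      · rw [hzi, smul_zero, smul_zero]
      obtain ⟨j, hj, hji⟩ := hz i
      have hj' : 2 * (d + j) < 2 * (d + M) := by omega
      have ha0 := ne_zero_of_mem_normalCone ha i hzi
      rw [← hji, ← symRows_apply v j] at hzi ha0 ⊢
      have s1 := hx2 _ (memr _ hj') ha0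
      have s2 := h3 _ hj' hzi
      set p := a ⬝ᵥ symRows d v (2 * (d + j))
      set q := x ⬝ᵥ symRows d v (2 * (d + j))
      congr 2
      rw [eq_iff_iff]
      constructor
      · intro h
        exact (mul_pos_iff_of_pos_left ((mul_pos_iff_of_pos_left h).1 s1)).1 s2
      · intro h
        exact (mul_pos_iff_of_pos_right ((mul_pos_iff_of_pos_right h).1 s2)).1 s1
    rw [e]
    exact gen t ht

theorem exists_list_validTuple (d N : ℕ) : ∃ L : List (Fin d → ℕ),
    (∀ t, t ∈ L ↔ ValidTuple d N t) ∧ (1 ≤ d → L.length = 2 * d * N ^ (d - 1)) := by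
  classical
  set S : Finset (Fin d → ℕ) :=
    Fintype.piFinset fun k : Fin d => range (if (k : ℕ) = 0 then 2 * d else N) with hS
  refine ⟨S.toList, fun t => by simp [hS, ValidTuple], fun hd => ?_⟩
  rw [Finset.length_toList, hS, Fintype.card_piFinset]
  obtain ⟨k, rfl⟩ : ∃ k, d = k + 1 := ⟨d - 1, by omega⟩
  simp [Fin.prod_univ_succ]

/-- The number of vertices of a zonotope. -/
theorem zone_vertices_card {ι : Type} [Fintype ι] (hd : 1 ≤ d) (z : ι → Fin d → ℚ) :
    {u | IsVertex (zone z) u}.Finite ∧ {u | IsVertex (zone z) u}.ncard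
      ≤ 2 * d * (2 * (d + Fintype.card ι)) ^ (d - 1) := by
  classical
  set M := Fintype.card ι
  set f := Fintype.equivFin ι
  set v : ℕ → Fin d → ℚ := fun j => if h : j < M then z (f.symm ⟨j, h⟩) else 0 with hv
  have hz : ∀ i, ∃ j < M, v j = z i := fun i => ⟨f i, (f i).2, by simp [hv, M]⟩
  obtain ⟨η, hη⟩ := exists_separated (symRows d v) (2 * (d + M))
  obtain ⟨L, hL, hlen⟩ := exists_list_validTuple d (2 * (d + M))
  set L' := L.filter fun t => tupleDet (symRows d v) t ≠ 0
  obtain ⟨_, hall⟩ := normal_and_all_vertices (L := L') hz hη fun t => by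
    simp [L', hL]
  set A := L'.map (tupleFunctional (symRows d v) (η / (2 * d)))
  have hsub : {u | IsVertex (zone z) u} ⊆ (A.map (zoneVertex z)).toFinset := by
    intro u hu
    obtain ⟨a, ha, hau⟩ := hall u hu
    rw [List.coe_toFinset]
    exact List.mem_map.2 ⟨a, ha, (eq_zoneVertex_of_mem_normalCone hau).symm⟩
  refine ⟨(Finset.finite_toSet _).subset hsub, ?_⟩
  refine (Set.ncard_le_ncard hsub (Finset.finite_toSet _)).trans ?_
  rw [Set.ncard_coe_finset]
  refine (List.toFinset_card_le _).trans ?_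
  rw [List.length_map, List.length_map, ← hlen hd]
  exact List.length_filter_le _ _

end ConvexOpt

namespace ConvexOpt

open Finset

variable {d : ℕ} {r : ℕ → Fin d → ℚ}

/-! ### A lower bound for the nonzero determinants -/

/-- The exchange relation: expand `r i` over the rows of `t` by Cramer's rule and insert the
expansion into row `k` of `s`. -/
theorem tupleDet_update_sum {t : Fin d → ℕ} (s : Fin d → ℕ) (k : Fin d) (i : ℕ) :
    tupleDet r t * tupleDet r (Function.update s k i)
      = ∑ l, tupleDet r (Function.update t l i) * tupleDet r (Function.update s k (t l)) := by
  have key : ∀ x : Fin d → ℚ, tupleDet r t * ((tupleMat r s).updateRow k x).det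
      = ∑ l, ((tupleMat r t).updateRow l x).det * ((tupleMat r s).updateRow k (r (t l))).det := by
    intro x
    have h := congrArg (fun x => (tupleMat r s).transpose.cramer x) (tupleDet_smul r t x)
    simp only [map_smul, map_sum] at h
    have h := congrFun h k
    rw [Finset.sum_apply] at h
    simpa only [Pi.smul_apply, smul_eq_mul, Matrix.cramer_transpose_apply] using h
  simp only [tupleDet, tupleMat_update] at key ⊢
  exact key (r i)

theorem tupleDet_swap (t : Fin d → ℕ) {a b : Fin d} (hab : a ≠ b) :
    tupleDet r (t ∘ Equiv.swap a b) = -tupleDet r t := by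
  have h := Matrix.det_permute (Equiv.swap a b) (tupleMat r t)
  rw [Equiv.Perm.sign_swap hab] at h
  rw [tupleDet, tupleDet]
  refine Eq.trans ?_ (h.trans (by simp))
  rfl

theorem tupleDet_eq_zero {t : Fin d → ℕ} {a b : Fin d} (hab : a ≠ b) (h : t a = t b) :
    tupleDet r t = 0 :=
  Matrix.det_zero_of_row_eq hab (by ext l; simp [tupleMat, h])

theorem update_swap (t : Fin d → ℕ) (a b : Fin d) (j : ℕ) :
    Function.update (t ∘ Equiv.swap a b) a j = Function.update t b j ∘ Equiv.swap a b := by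
  ext k
  by_cases h : k = a
  · subst h; simp
  · rw [Function.update_of_ne h, Function.comp, Function.comp, Function.update_of_ne]
    intro h'
    exact h ((Equiv.swap a b).injective (h'.trans (Equiv.swap_apply_left a b).symm))

/-- The three-term relation between the minors with two varying rows. -/
theorem tupleDet_mul_update_update (t : Fin d → ℕ) {a b : Fin d} (hab : a ≠ b) (i j : ℕ) :
    tupleDet r t * tupleDet r (Function.update (Function.update t b j) a i)
      = tupleDet r (Function.update t a i) * tupleDet r (Function.update t b j)
        - tupleDet r (Function.update t b i) * tupleDet r (Function.update t a j) := by
  -- Only the summands `a` and `b` survive; every other one has a repeated row.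
  rw [tupleDet_update_sum, Fintype.sum_eq_add a b hab]
  · have h1 : Function.update (Function.update t b j) a (t a) = Function.update t b j := by
      rw [Function.update_eq_self_iff, Function.update_of_ne hab]
    have h2 : Function.update (Function.update t b j) a (t b)
        = Function.update t a j ∘ Equiv.swap a b := by
      ext k
      by_cases hka : k = a
      · subst hka; simp [hab.symm]
      by_cases hkb : k = b
      · subst hkb; simp [hka]
      · simp [hka, hkb, Equiv.swap_apply_of_ne_of_ne]
    rw [h1, h2, tupleDet_swap _ hab]
    ring
  · rintro l ⟨hla, hlb⟩
    rw [tupleDet_eq_zero (t := Function.update (Function.update t b j) a (t l)) (Ne.symm hla)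
      (by simp [hla, hlb]), mul_zero]

/-- As a function of row `k` the determinant is linear and does not vanish at the present row, so it
does not vanish at all unit vectors. -/
theorem exists_unit_update {N : ℕ} (hr : SymmetricRows r N) {t : Fin d → ℕ}
    (ht : tupleDet r t ≠ 0) (k : Fin d) : ∃ p < 2 * d, tupleDet r (Function.update t k p) ≠ 0 := by
  by_contra! hcon
  have h0 : (LinearMap.proj k ∘ₗ (tupleMat r t).transpose.cramer : (Fin d → ℚ) →ₗ[ℚ] ℚ) = 0 := by
    refine LinearMap.pi_ext fun l x => ?_
    have h1 := hcon (2 * l) (by omega)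
    rw [tupleDet, tupleMat_update, hr.unit, ← Matrix.cramer_transpose_apply] at h1
    have h2 : (Pi.single l x : Fin d → ℚ) = x • Pi.single l 1 := by
      rw [← Pi.single_smul, smul_eq_mul, mul_one]
    rw [h2, map_smul, LinearMap.comp_apply, LinearMap.proj_apply, h1, smul_zero,
      LinearMap.zero_apply]
  have h1 := LinearMap.congr_fun h0 (r (t k))
  rw [LinearMap.comp_apply, LinearMap.proj_apply, Matrix.cramer_transpose_apply,
    ← tupleMat_update, Function.update_eq_self] at h1
  exact ht h1

theorem abs_tupleDet_le {N : ℕ} {A : ℚ} (hA : ∀ i < N, ∀ l, |r i l| ≤ A) {t : Fin d → ℕ}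
    (ht : ∀ k, t k < N) : |tupleDet r t| ≤ d.factorial * A ^ d := by
  have h := Matrix.det_le (A := tupleMat r t) (abv := AbsoluteValue.abs) (x := A)
    fun i j => hA _ (ht i) j
  rw [Fintype.card_fin, nsmul_eq_mul] at h
  exact h

/-! ### Gaps between slopes. -/

/-- The tuples for which slopes are compared: the two first entries refer to unit vectors. -/
def GapTuple (d N : ℕ) (t : Fin d → ℕ) : Prop := ∀ k, t k < if (k : ℕ) < 2 then 2 * d else N

/-- Bounds for the determinants with two varying rows, one of them a unit vector, and for the gaps
between the quotients of such determinants. -/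
structure GapBounds (r : ℕ → Fin d → ℚ) (N : ℕ) (a b : Fin d) (γ μ A : ℚ) : Prop where
  gap_pos : 0 < γ
  gap_le : γ ≤ 1
  minor_pos : 0 < μ
  one_le : 1 ≤ A
  entry_le : ∀ i < N, ∀ l, r i l ≤ A
  minor_le : ∀ t, GapTuple d N t → ∀ j < N, tupleDet r (Function.update t a j) ≠ 0 →
    μ ≤ |tupleDet r (Function.update t a j)|
  gap : ∀ t, GapTuple d N t → ∀ i < N, ∀ j < N,
    tupleDet r (Function.update t b i) / tupleDet r (Function.update t a i)
      < tupleDet r (Function.update t b j) / tupleDet r (Function.update t a j) →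
    γ ≤ tupleDet r (Function.update t b j) / tupleDet r (Function.update t a j)
      - tupleDet r (Function.update t b i) / tupleDet r (Function.update t a i)

/-- Replace two rows of `t` by unit vectors, giving `t₀`. The three-term relation expresses `det t₀
* det t` as a product of two minors times a difference of slopes, so it is at least `γ * μ ^ 2` in
absolute value. Leibniz bounds `|det t₀|` and the determinant compared with by `d! * A ^ d`, whence
the square in the denominator. -/
theorem GapBounds.separated {N : ℕ} (hr : SymmetricRows r N) {a b : Fin d} (ha : (a : ℕ) = 0)
    (hb : (b : ℕ) = 1) {γ μ A : ℚ} (h : GapBounds r N a b γ μ A) :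
    Separated r N (γ * μ ^ 2 / (d.factorial * A ^ d) ^ 2) := by
  have hab : a ≠ b := fun e => by rw [e, hb] at ha; exact one_ne_zero ha
  set D : ℚ := d.factorial * A ^ d with hD
  have hA0 : 0 < A := one_pos.trans_le h.one_le
  have hD0 : 0 < D := mul_pos (by exact_mod_cast d.factorial_pos) (pow_pos hA0 _)
  have habs : ∀ i < N, ∀ l, |r i l| ≤ A := fun i hi l => by
    obtain ⟨j, hj, hji⟩ := hr.neg i hi
    have h1 := h.entry_le j hj l
    rw [hji, Pi.neg_apply] at h1
    exact abs_le.2 ⟨by linarith, h.entry_le i hi l⟩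
  have hμγ : 0 < γ * μ ^ 2 := mul_pos h.gap_pos (pow_pos h.minor_pos _)
  refine ⟨div_pos hμγ (pow_pos hD0 _), fun s t hs ht ht0 => ?_⟩
  obtain ⟨p, hp, hdp⟩ := exists_unit_update hr ht0 a
  obtain ⟨q, hq, hdq⟩ := exists_unit_update hr hdp b
  set t₀ := Function.update (Function.update t a p) b q with ht₀
  have hsmall : ∀ k : Fin d, k ≠ a → k ≠ b → ¬ (k : ℕ) < 2 := by
    intro k h1 h2 h3
    rcases Nat.lt_succ_iff_lt_or_eq.1 h3 with h4 | h4
    · exact h1 (Fin.ext (by omega))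
    · exact h2 (Fin.ext (by omega))
  have hgt : GapTuple d N t₀ := by
    intro k
    by_cases hka : k = a
    · subst hka
      rw [if_pos (by omega), ht₀, Function.update_of_ne hab, Function.update_self]; exact hp
    by_cases hkb : k = b
    · subst hkb
      rw [if_pos (by omega), ht₀, Function.update_self]; exact hq
    rw [if_neg (hsmall k hka hkb), ht₀, Function.update_of_ne hkb, Function.update_of_ne hka]
    exact ht k
  -- Minors with row `b` varied are, up to sign, minors with row `a` varied of the swapped tuple, so
  -- one bound `μ` serves both.
  have hgt' : GapTuple d N (t₀ ∘ Equiv.swap a b) := by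
    intro k
    by_cases hka : k = a
    · have := hgt b
      rw [if_pos (by omega)] at this
      rwa [hka, if_pos (by omega), Function.comp, Equiv.swap_apply_left]
    by_cases hkb : k = b
    · have := hgt a
      rw [if_pos (by omega)] at this
      rwa [hkb, if_pos (by omega), Function.comp, Equiv.swap_apply_right]
    rw [Function.comp, Equiv.swap_apply_of_ne_of_ne hka hkb]
    exact hgt k
  have ht₀N : ∀ k, t₀ k < N := fun k => by
    have := hgt k
    split_ifs at this
    · exact this.trans_le hr.le
    · exact this
  have htt : Function.update (Function.update t₀ b (t b)) a (t a) = t := by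
    ext k
    by_cases hka : k = a
    · subst hka; simp
    by_cases hkb : k = b
    · subst hkb; simp [hka]
    simp [hka, hkb, ht₀]
  have hid := tupleDet_mul_update_update (r := r) t₀ hab (t a) (t b)
  rw [htt] at hid
  set f := fun j => tupleDet r (Function.update t₀ a j) with hf
  set g := fun j => tupleDet r (Function.update t₀ b j) with hg
  have hid' : tupleDet r t₀ * tupleDet r t = f (t a) * g (t b) - g (t a) * f (t b) := hid
  have hfl : ∀ j < N, f j ≠ 0 → μ ≤ |f j| := h.minor_le t₀ hgt
  have hgl : ∀ j < N, g j ≠ 0 → μ ≤ |g j| := fun j hj hj0 => by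
    have h1 := h.minor_le _ hgt' j hj
    rw [update_swap, tupleDet_swap _ hab, abs_neg] at h1
    exact h1 (neg_ne_zero.2 hj0)
  have hne : f (t a) * g (t b) - g (t a) * f (t b) ≠ 0 := hid' ▸ mul_ne_zero hdq ht0
  have hprod : ∀ x y : ℚ, x ≠ 0 → y ≠ 0 → (x ≠ 0 → μ ≤ |x|) → (y ≠ 0 → μ ≤ |y|) →
      μ ^ 2 ≤ |x| * |y| := fun x y hx hy h1 h2 => by
    rw [sq]; exact mul_le_mul (h1 hx) (h2 hy) h.minor_pos.le (abs_nonneg _)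
  have hle1 : γ * μ ^ 2 ≤ μ ^ 2 := mul_le_of_le_one_left (sq_nonneg _) h.gap_le
  have hmain : γ * μ ^ 2 ≤ |f (t a) * g (t b) - g (t a) * f (t b)| := by
    -- If a denominator vanishes, the slope is only the default value 0 and means nothing, but then
    -- one of the two products vanishes as well. The other is at least `μ ^ 2`, which suffices
    -- because `γ ≤ 1`.
    by_cases hfa : f (t a) = 0
    · rw [hfa, zero_mul, zero_sub] at hne ⊢
      have h1 := left_ne_zero_of_mul (neg_ne_zero.1 hne)
      have h2 := right_ne_zero_of_mul (neg_ne_zero.1 hne)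
      rw [abs_neg, abs_mul]
      exact hle1.trans (hprod _ _ h1 h2 (hgl _ (ht a)) (hfl _ (ht b)))
    by_cases hfb : f (t b) = 0
    · rw [hfb, mul_zero, sub_zero] at hne ⊢
      have h1 := left_ne_zero_of_mul hne
      have h2 := right_ne_zero_of_mul hne
      rw [abs_mul]
      exact hle1.trans (hprod _ _ h1 h2 (hfl _ (ht a)) (hgl _ (ht b)))
    have e : f (t a) * g (t b) - g (t a) * f (t b)
        = (f (t a) * f (t b)) * (g (t b) / f (t b) - g (t a) / f (t a)) := by
      field_simp
    have hgap : γ ≤ |g (t b) / f (t b) - g (t a) / f (t a)| := by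
      rcases lt_trichotomy (g (t a) / f (t a)) (g (t b) / f (t b)) with h1 | h1 | h1
      · exact (h.gap t₀ hgt _ (ht a) _ (ht b) h1).trans (le_abs_self _)
      · rw [e, h1, sub_self, mul_zero] at hne
        exact absurd rfl hne
      · rw [abs_sub_comm]
        exact (h.gap t₀ hgt _ (ht b) _ (ht a) h1).trans (le_abs_self _)
    rw [e, abs_mul, abs_mul, mul_comm γ]
    exact mul_le_mul (hprod _ _ hfa hfb (hfl _ (ht a)) (hfl _ (ht b))) hgap h.gap_pos.le
      (by positivity)
  rw [← hid', abs_mul] at hmain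
  have h1 : |tupleDet r t₀| ≤ D := abs_tupleDet_le habs ht₀N
  have h2 : |tupleDet r s| ≤ D := abs_tupleDet_le habs hs
  have h3 : γ * μ ^ 2 ≤ D * |tupleDet r t| :=
    hmain.trans (mul_le_mul_of_nonneg_right h1 (abs_nonneg _))
  calc γ * μ ^ 2 / D ^ 2 * |tupleDet r s| ≤ γ * μ ^ 2 / D ^ 2 * D := by gcongr
    _ = γ * μ ^ 2 / D := by field_simp
    _ ≤ D * |tupleDet r t| / D := by gcongr
    _ = |tupleDet r t| := by field_simp

/-- In a sorted sequence the gaps between neighbours bound all gaps from below. -/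
theorem gap_le_of_sorted {X : ℕ → ℚ} {K : ℕ} {γ : ℚ} (hX : ∀ p q, p ≤ q → q < K → X p ≤ X q)
    (hγ : ∀ p, p + 1 < K → X p < X (p + 1) → γ ≤ X (p + 1) - X p) :
    ∀ p q, p < K → q < K → X p < X q → γ ≤ X q - X p := by
  intro p q hp hq hlt
  have hpq : p ≤ q := by
    by_contra h
    exact absurd (hX q p (by omega) hp) (not_le.2 hlt)
  induction q, hpq using Nat.le_induction with
  | base => exact absurd hlt (lt_irrefl _)
  | succ q hpq ih =>
    rcases (hX q (q + 1) (by omega) hq).eq_or_lt with h | h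
    · rw [← h] at hlt ⊢
      exact ih (by omega) hlt
    · have := hγ q hq h
      have := hX p q hpq (by omega)
      linarith

end ConvexOpt

namespace ConvexOpt

open Finset

/-! ### Heights of rational numbers -/

/-- The sum of the numerator, in absolute value, and the denominator. -/
def height (q : ℚ) : ℕ := q.num.natAbs + q.den

theorem height_div_le (a b : ℤ) (hb : b ≠ 0) : height ((a : ℚ) / b) ≤ a.natAbs + b.natAbs := by
  rw [← Rat.divInt_eq_div]
  refine Nat.add_le_add ?_ ?_
  · rcases eq_or_ne a 0 with rfl | ha
    · simp
    · exact Nat.le_of_dvd (Int.natAbs_pos.2 ha) (Int.natAbs_dvd_natAbs.2 (Rat.num_dvd a hb))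
  · have := Int.natAbs_dvd_natAbs.2 (Rat.den_dvd a b)
    rw [Int.natAbs_natCast] at this
    exact Nat.le_of_dvd (Int.natAbs_pos.2 hb) this

theorem height_mul (x y : ℚ) : height (x * y) ≤ height x * height y := by
  have e : x * y = ((x.num * y.num : ℤ) : ℚ) / ((x.den * y.den : ℤ) : ℚ) := by
    conv_lhs => rw [← x.num_div_den, ← y.num_div_den]
    push_cast
    rw [div_mul_div_comm]
  have h := height_div_le (x.num * y.num) (x.den * y.den) (by simp)
  rw [← e, Int.natAbs_mul, Int.natAbs_mul, Int.natAbs_natCast, Int.natAbs_natCast] at h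
  refine h.trans ?_
  unfold height
  nlinarith [Nat.zero_le (x.num.natAbs * y.den), Nat.zero_le (x.den * y.num.natAbs)]

/-- Numerator plus denominator is used because the product of two such sums dominates every term of
the unreduced fraction; reduction to lowest terms only helps. -/
theorem height_add (x y : ℚ) : height (x + y) ≤ height x * height y := by
  have hx : (x.den : ℚ) ≠ 0 := by simp
  have hy : (y.den : ℚ) ≠ 0 := by simp
  have e : x + y = ((x.num * y.den + x.den * y.num : ℤ) : ℚ) / ((x.den * y.den : ℤ) : ℚ) := by
    conv_lhs => rw [← x.num_div_den, ← y.num_div_den]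
    push_cast
    rw [div_add_div _ _ hx hy]
  have h := height_div_le (x.num * y.den + x.den * y.num) (x.den * y.den) (by simp)
  rw [← e] at h
  refine h.trans ?_
  have h1 := Int.natAbs_add_le (x.num * y.den) (x.den * y.num)
  rw [Int.natAbs_mul, Int.natAbs_mul, Int.natAbs_natCast, Int.natAbs_natCast] at h1
  rw [Int.natAbs_mul, Int.natAbs_natCast, Int.natAbs_natCast]
  unfold height
  nlinarith [Nat.zero_le (x.num.natAbs * y.num.natAbs)]

theorem height_neg (x : ℚ) : height (-x) = height x := by simp [height]

theorem height_sub (x y : ℚ) : height (x - y) ≤ height x * height y := by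
  rw [sub_eq_add_neg, ← height_neg y]
  exact height_add _ _

theorem height_inv (x : ℚ) : height x⁻¹ ≤ height x := by
  rcases eq_or_ne x 0 with rfl | hx
  · simp
  · have e : x⁻¹ = ((x.den : ℤ) : ℚ) / (x.num : ℚ) := by
      conv_lhs => rw [← x.num_div_den]
      rw [inv_div, Int.cast_natCast]
    rw [e]
    refine (height_div_le _ _ (Rat.num_ne_zero.2 hx)).trans ?_
    rw [Int.natAbs_natCast, height, add_comm]

theorem height_div (x y : ℚ) : height (x / y) ≤ height x * height y := by
  rw [div_eq_mul_inv]
  exact (height_mul _ _).trans (Nat.mul_le_mul_left _ (height_inv y))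

theorem height_zero : height 0 = 1 := rfl

theorem height_le_two_pow (q : ℚ) : height q ≤ 2 ^ ratSize q := by
  have h1 : q.num.natAbs < 2 ^ Nat.size q.num.natAbs := Nat.lt_size_self _
  have h2 : q.den < 2 ^ Nat.size q.den := Nat.lt_size_self _
  have h3 : 2 ^ Nat.size q.num.natAbs ≤ 2 ^ (Nat.size q.num.natAbs + Nat.size q.den) :=
    Nat.pow_le_pow_right (by norm_num) (by omega)
  have h4 : 2 ^ Nat.size q.den ≤ 2 ^ (Nat.size q.num.natAbs + Nat.size q.den) :=
    Nat.pow_le_pow_right (by norm_num) (by omega)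
  have h5 : 2 ^ ratSize q = 4 * 2 ^ (Nat.size q.num.natAbs + Nat.size q.den) := by
    unfold ratSize natSize
    rw [show Nat.size q.num.natAbs + 1 + (Nat.size q.den + 1)
      = Nat.size q.num.natAbs + Nat.size q.den + 2 by ring, pow_add]
    ring
  unfold height
  omega

theorem ratSize_le {q : ℚ} {k : ℕ} (h : height q ≤ 2 ^ k) : ratSize q ≤ 2 * k + 3 := by
  have hd := q.den_pos
  unfold height at h
  have h1 : Nat.size q.num.natAbs ≤ k := Nat.size_le.2 (by omega)
  have h2 : Nat.size q.den ≤ k + 1 := Nat.size_le.2 (by rw [pow_succ]; omega)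
  unfold ratSize natSize
  omega

theorem natSize_mono {x y : ℕ} (h : x ≤ y) : natSize x ≤ natSize y :=
  Nat.add_le_add_right (Nat.size_le_size h) 1

theorem natSize_pos (x : ℕ) : 1 ≤ natSize x := Nat.le_add_left _ _

theorem natSize_add (x y : ℕ) : natSize (x + y) ≤ natSize x + natSize y := by
  have h1 : x < 2 ^ Nat.size x := Nat.lt_size_self _
  have h2 : y < 2 ^ Nat.size y := Nat.lt_size_self _
  have h3 : 2 ^ Nat.size x ≤ 2 ^ (Nat.size x + Nat.size y) :=
    Nat.pow_le_pow_right (by norm_num) (by omega)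
  have h4 : 2 ^ Nat.size y ≤ 2 ^ (Nat.size x + Nat.size y) :=
    Nat.pow_le_pow_right (by norm_num) (by omega)
  have h5 : Nat.size (x + y) ≤ Nat.size x + Nat.size y + 1 :=
    Nat.size_le.2 (by rw [pow_succ]; omega)
  unfold natSize
  omega

theorem natSize_mul (x y : ℕ) : natSize (x * y) ≤ natSize x + natSize y := by
  have h1 : x < 2 ^ Nat.size x := Nat.lt_size_self _
  have h2 : y < 2 ^ Nat.size y := Nat.lt_size_self _
  have h5 : Nat.size (x * y) ≤ Nat.size x + Nat.size y :=
    Nat.size_le.2 (by rw [pow_add]; exact Nat.mul_lt_mul'' h1 h2)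
  unfold natSize
  omega

/-! ### Syntactic cost bounds -/

/-- A bound, in units of the largest size of a number in memory, for the cost of evaluating an
expression and for the size of its value. -/
def IExpr.cst : IExpr → ℕ
  | .const k => natSize k
  | .get _ i j => i.cst + j.cst + 1
  | .add x y => 2 * (x.cst + y.cst) + 1
  | .sub x y => 2 * (x.cst + y.cst) + 1
  | .mul x y => 2 * (x.cst + y.cst) + 1

def QExpr.cst : QExpr → ℕ
  | .const q => ratSize q
  | .get _ i j => i.cst + j.cst + 1
  | .add x y => 3 * (x.cst + y.cst) + 4
  | .sub x y => 3 * (x.cst + y.cst) + 4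
  | .mul x y => 3 * (x.cst + y.cst) + 4
  | .div x y => 3 * (x.cst + y.cst) + 4

def Test.cst : Test → ℕ
  | .ilt x y => x.cst + y.cst + 1
  | .qlt x y => x.cst + y.cst + 1

/-- The cost of executing every part of a program once. -/
def Cmd.cst : Cmd → ℕ
  | .skip => 0
  | .iset _ i j e => i.cst + j.cst + e.cst
  | .qset _ i j e => i.cst + j.cst + e.cst
  | .seq p q => p.cst + q.cst
  | .ite t p q => t.cst + p.cst + q.cst
  | .loop t p => t.cst + p.cst
  | .linOpt _ i _ j => i.cst + j.cst + 2
  | .evalC _ i _ j k => i.cst + j.cst + k.cst + 2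

/-- The index arrays that a program may write to. -/
@[simp] def Cmd.iw : Cmd → ℕ → Prop
  | .skip, _ => False
  | .iset arr _ _ _, a => a = arr
  | .qset _ _ _ _, _ => False
  | .seq p q, a => p.iw a ∨ q.iw a
  | .ite _ p q, a => p.iw a ∨ q.iw a
  | .loop _ p, a => p.iw a
  | .linOpt _ _ dst _, a => a = dst
  | .evalC _ _ _ _ _, _ => False

/-- The rational arrays that a program may write to. -/
@[simp] def Cmd.qw : Cmd → ℕ → Prop
  | .skip, _ => False
  | .iset _ _ _ _, _ => False
  | .qset arr _ _ _, a => a = arr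
  | .seq p q, a => p.qw a ∨ q.qw a
  | .ite _ p q, a => p.qw a ∨ q.qw a
  | .loop _ p, a => p.qw a
  | .linOpt _ _ _ _, _ => False
  | .evalC _ _ dst _ _, a => a = dst

/-- The program makes no oracle queries. -/
@[simp] def Cmd.Quiet : Cmd → Prop
  | .skip => True
  | .iset _ _ _ _ => True
  | .qset _ _ _ _ => True
  | .seq p q => p.Quiet ∧ q.Quiet
  | .ite _ p q => p.Quiet ∧ q.Quiet
  | .loop _ p => p.Quiet
  | .linOpt _ _ _ _ => False
  | .evalC _ _ _ _ _ => False

variable {n d : ℕ}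

/-- What a program leaves unchanged. -/
structure Frame (p : Cmd) (s s' : State n d) : Prop where
  imem : ∀ a, ¬ p.iw a → s'.imem a = s.imem a
  qmem : ∀ a, ¬ p.qw a → s'.qmem a = s.qmem a
  lin : p.Quiet → s'.linLog = s.linLog
  ev : p.Quiet → s'.evalLog = s.evalLog

theorem Frame.refl (p : Cmd) (s : State n d) : Frame p s s :=
  ⟨fun _ _ => rfl, fun _ _ => rfl, fun _ => rfl, fun _ => rfl⟩

theorem Frame.trans {p : Cmd} {s s' s'' : State n d} (h : Frame p s s') (h' : Frame p s' s'') :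
    Frame p s s'' :=
  ⟨fun a ha => (h'.imem a ha).trans (h.imem a ha), fun a ha => (h'.qmem a ha).trans (h.qmem a ha),
    fun hp => (h'.lin hp).trans (h.lin hp), fun hp => (h'.ev hp).trans (h.ev hp)⟩

theorem Frame.mono {p q : Cmd} {s s' : State n d} (h : Frame p s s')
    (hi : ∀ a, p.iw a → q.iw a) (hq : ∀ a, p.qw a → q.qw a) (hl : q.Quiet → p.Quiet) :
    Frame q s s' :=
  ⟨fun a ha => h.imem a fun h' => ha (hi a h'), fun a ha => h.qmem a fun h' => ha (hq a h'),
    fun hp => h.lin (hl hp), fun hp => h.ev (hl hp)⟩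

theorem Exec.frame {O : (Fin n → ℚ) → Finset (Fin n)} {c : (Fin d → ℚ) → ℚ} {p : Cmd}
    {s s' : State n d} (h : Exec O c p s s') : Frame p s s' := by
  induction h with
  | skip s => exact Frame.refl _ _
  | iset s arr i j e =>
    refine ⟨fun a ha => ?_, fun _ _ => rfl, fun _ => rfl, fun _ => rfl⟩
    funext k l
    exact if_neg fun h => ha h.1
  | qset s arr i j e =>
    refine ⟨fun _ _ => rfl, fun a ha => ?_, fun _ => rfl, fun _ => rfl⟩
    funext k l
    exact if_neg fun h => ha h.1
  | seq _ _ ih1 ih2 =>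
    exact (ih1.mono (fun _ => Or.inl) (fun _ => Or.inl) And.left).trans
      (ih2.mono (fun _ => Or.inr) (fun _ => Or.inr) And.right)
  | @ite_true t p q _ _ _ _ ih =>
    have h := ih.mono (q := .ite t p q) (fun _ => Or.inl) (fun _ => Or.inl) And.left
    exact ⟨h.imem, h.qmem, h.lin, h.ev⟩
  | @ite_false t p q _ _ _ _ ih =>
    have h := ih.mono (q := .ite t p q) (fun _ => Or.inr) (fun _ => Or.inr) And.right
    exact ⟨h.imem, h.qmem, h.lin, h.ev⟩
  | @loop_true t p _ _ _ _ _ _ ih1 ih2 =>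
    have h := ih1.mono (q := .loop t p) (fun _ => id) (fun _ => id) id
    exact Frame.trans ⟨h.imem, h.qmem, h.lin, h.ev⟩ ih2
  | loop_false _ => exact ⟨fun _ _ => rfl, fun _ _ => rfl, fun _ => rfl, fun _ => rfl⟩
  | linOpt s src i dst j =>
    refine ⟨fun a ha => ?_, fun _ _ => rfl, fun h => h.elim, fun h => h.elim⟩
    funext k l
    exact if_neg fun h => ha h.1
  | evalC s src i dst j k =>
    refine ⟨fun _ _ => rfl, fun a ha => ?_, fun h => h.elim, fun h => h.elim⟩
    funext k l
    exact if_neg fun h => ha h.1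

/-! ### Program logic -/

/-- Oracles, and bounds for the numbers in memory: `M` for indices, `2 ^ bd a` for the heights of
the entries of the rational array `a`, and `B` for the resulting sizes. -/
structure Env (n d : ℕ) where
  O : (Fin n → ℚ) → Finset (Fin n)
  c : (Fin d → ℚ) → ℚ
  bd : ℕ → ℕ
  M : ℕ
  B : ℕ
  natSize_le : natSize M ≤ B
  bd_le : ∀ a, 2 * bd a + 3 ≤ B

/-- The numbers in memory obey the bounds. -/
structure Sized (E : Env n d) (s : State n d) : Prop where
  imem : ∀ a i j, s.imem a i j ≤ E.M
  qmem : ∀ a i j, height (s.qmem a i j) ≤ 2 ^ E.bd a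

variable {E : Env n d}

theorem Env.one_le_B (E : Env n d) : 1 ≤ E.B := (natSize_pos _).trans E.natSize_le

/-- The reason for the coefficients in `QExpr.cst`: the result of an operation has size at most `2 *
(x + y) + 3`, and the bit count of the operands comes on top. -/
theorem ratSize_binary {x y z : ℚ} (h : height z ≤ height x * height y) :
    ratSize z ≤ 2 * (ratSize x + ratSize y) + 3 :=
  ratSize_le (h.trans ((Nat.mul_le_mul (height_le_two_pow x) (height_le_two_pow y)).trans_eq
    (pow_add _ _ _).symm))

section costs

variable {s : State n d} (hs : Sized E s)
include hs

theorem IExpr.cost_le (e : IExpr) : natSize (e.eval s) ≤ e.cst * E.B ∧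
    e.bits s ≤ e.cst * E.B ∧ e.ops ≤ e.cst := by
  have hB := E.one_le_B
  induction e with
  | const k =>
    simp only [IExpr.eval, IExpr.bits, IExpr.ops, IExpr.cst]
    exact ⟨Nat.le_mul_of_pos_right _ hB, Nat.le_mul_of_pos_right _ hB, Nat.zero_le _⟩
  | get a i j hi hj =>
    simp only [IExpr.eval, IExpr.bits, IExpr.ops, IExpr.cst, add_mul, one_mul]
    have := (natSize_mono (hs.imem a (i.eval s) (j.eval s))).trans E.natSize_le
    omega
  | add x y hx hy =>
    simp only [IExpr.eval, IExpr.bits, IExpr.ops, IExpr.cst, add_mul, one_mul, mul_assoc]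
    have := natSize_add (x.eval s) (y.eval s)
    omega
  | sub x y hx hy =>
    simp only [IExpr.eval, IExpr.bits, IExpr.ops, IExpr.cst, add_mul, one_mul, mul_assoc]
    have := natSize_mono (Nat.sub_le (x.eval s) (y.eval s))
    omega
  | mul x y hx hy =>
    simp only [IExpr.eval, IExpr.bits, IExpr.ops, IExpr.cst, add_mul, one_mul, mul_assoc]
    have := natSize_mul (x.eval s) (y.eval s)
    omega

theorem QExpr.cost_le (e : QExpr) : ratSize (e.eval s) ≤ e.cst * E.B ∧
    e.bits s ≤ e.cst * E.B ∧ e.ops ≤ e.cst := by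
  have hB := E.one_le_B
  induction e with
  | const k =>
    simp only [QExpr.eval, QExpr.bits, QExpr.ops, QExpr.cst]
    exact ⟨Nat.le_mul_of_pos_right _ hB, Nat.le_mul_of_pos_right _ hB, Nat.zero_le _⟩
  | get a i j =>
    have hi := i.cost_le hs
    have hj := j.cost_le hs
    simp only [QExpr.eval, QExpr.bits, QExpr.ops, QExpr.cst, add_mul, one_mul]
    have := (ratSize_le (hs.qmem a (i.eval s) (j.eval s))).trans (E.bd_le a)
    omega
  | add x y hx hy =>
    simp only [QExpr.eval, QExpr.bits, QExpr.ops, QExpr.cst, add_mul, mul_assoc]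
    have := ratSize_binary (height_add (x.eval s) (y.eval s))
    omega
  | sub x y hx hy =>
    simp only [QExpr.eval, QExpr.bits, QExpr.ops, QExpr.cst, add_mul, mul_assoc]
    have := ratSize_binary (height_sub (x.eval s) (y.eval s))
    omega
  | mul x y hx hy =>
    simp only [QExpr.eval, QExpr.bits, QExpr.ops, QExpr.cst, add_mul, mul_assoc]
    have := ratSize_binary (height_mul (x.eval s) (y.eval s))
    omega
  | div x y hx hy =>
    simp only [QExpr.eval, QExpr.bits, QExpr.ops, QExpr.cst, add_mul, mul_assoc]
    have := ratSize_binary (height_div (x.eval s) (y.eval s))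
    omega

theorem Test.cost_le (t : Test) : t.bits s ≤ t.cst * E.B ∧ t.ops ≤ t.cst := by
  cases t with
  | ilt x y =>
    have hx := x.cost_le hs
    have hy := y.cost_le hs
    simp only [Test.bits, Test.ops, Test.cst, add_mul]
    omega
  | qlt x y =>
    have hx := x.cost_le hs
    have hy := y.cost_le hs
    simp only [Test.bits, Test.ops, Test.cst, add_mul]
    omega

end costs

/-- The state `s` with other values of the cost counters. -/
def State.withCost (s : State n d) (o b : ℕ) : State n d := { s with ops := o, bits := b }

theorem IExpr.eval_withCost (s : State n d) (o b : ℕ) (e : IExpr) :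
    e.eval (s.withCost o b) = e.eval s := by
  induction e with
  | const => rfl
  | get a i j hi hj => simp only [IExpr.eval, hi, hj]; rfl
  | add x y hx hy => simp only [IExpr.eval, hx, hy]
  | sub x y hx hy => simp only [IExpr.eval, hx, hy]
  | mul x y hx hy => simp only [IExpr.eval, hx, hy]

theorem QExpr.eval_withCost (s : State n d) (o b : ℕ) (e : QExpr) :
    e.eval (s.withCost o b) = e.eval s := by
  induction e with
  | const => rfl
  | get a i j => simp only [QExpr.eval, IExpr.eval_withCost]; rfl
  | add x y hx hy => simp only [QExpr.eval, hx, hy]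
  | sub x y hx hy => simp only [QExpr.eval, hx, hy]
  | mul x y hx hy => simp only [QExpr.eval, hx, hy]
  | div x y hx hy => simp only [QExpr.eval, hx, hy]

theorem Test.holds_withCost (s : State n d) (o b : ℕ) (t : Test) :
    t.holds (s.withCost o b) ↔ t.holds s := by
  cases t with
  | ilt x y => simp only [Test.holds, IExpr.eval_withCost]
  | qlt x y => simp only [Test.holds, QExpr.eval_withCost]

theorem Sized.withCost {s : State n d} (h : Sized E s) (o b : ℕ) : Sized E (s.withCost o b) :=
  ⟨h.imem, h.qmem⟩

/-- Started in `s`, the program halts in `s'` within `t` operations and `t * B` bits. -/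
def Steps (E : Env n d) (p : Cmd) (s s' : State n d) (t : ℕ) : Prop :=
  ∀ o b, ∃ o' b', Exec E.O E.c p (s.withCost o b) (s'.withCost o' b') ∧
    o' ≤ o + t ∧ b' ≤ b + t * E.B

/-- Total correctness, with the cost bound `p.cst * f`. -/
def WP (E : Env n d) (p : Cmd) (f : ℕ) (Q : State n d → Prop) (s : State n d) : Prop :=
  Sized E s → ∃ s', Steps E p s s' (p.cst * f) ∧ Sized E s' ∧ Q s'

theorem Steps.frame {p : Cmd} {s s' : State n d} {t : ℕ} (h : Steps E p s s' t) :
    Frame p s s' := by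
  obtain ⟨_, _, h, _⟩ := h 0 0
  have := h.frame
  exact ⟨this.imem, this.qmem, this.lin, this.ev⟩

theorem Steps.mono {p : Cmd} {s s' : State n d} {t t' : ℕ} (h : Steps E p s s' t) (ht : t ≤ t') :
    Steps E p s s' t' := by
  intro o b
  obtain ⟨o', b', h1, h2, h3⟩ := h o b
  exact ⟨o', b', h1, h2.trans (by omega),
    h3.trans (Nat.add_le_add_left (Nat.mul_le_mul_right _ ht) _)⟩

theorem Steps.seq {p q : Cmd} {s s' s'' : State n d} {t t' : ℕ} (h : Steps E p s s' t)
    (h' : Steps E q s' s'' t') : Steps E (.seq p q) s s'' (t + t') := by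
  intro o b
  obtain ⟨o', b', h1, h2, h3⟩ := h o b
  obtain ⟨o'', b'', h1', h2', h3'⟩ := h' o' b'
  exact ⟨o'', b'', h1.seq h1', by omega, by rw [add_mul]; omega⟩

variable {p q : Cmd} {f : ℕ} {Q Q' : State n d → Prop} {s : State n d}

theorem WP.mono {f' : ℕ} (h : WP E p f Q s) (hf : f ≤ f') (hQ : ∀ s', Q s' → Q' s') :
    WP E p f' Q' s := by
  intro hs
  obtain ⟨s', h1, h2, h3⟩ := h hs
  exact ⟨s', h1.mono (Nat.mul_le_mul_left _ hf), h2, hQ _ h3⟩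

theorem WP.frame (h : WP E p f Q s) : WP E p f (fun s' => Q s' ∧ Frame p s s') s := by
  intro hs
  obtain ⟨s', h1, h2, h3⟩ := h hs
  exact ⟨s', h1, h2, h3, h1.frame⟩

theorem WP.of_sized (h : Sized E s → WP E p f Q s) : WP E p f Q s := fun hs => h hs hs

theorem WP.skip (h : Q s) : WP E .skip f Q s := fun hs =>
  ⟨s, fun o b => ⟨o, b, Exec.skip _, by omega, by omega⟩, hs, h⟩

/-- Both parts share the factor `f` because `Cmd.cst` is additive; iteration is paid for by
enlarging `f`. -/
theorem WP.seq (h : WP E p f (WP E q f Q) s) : WP E (.seq p q) f Q s := by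
  intro hs
  obtain ⟨s', h1, h2, h3⟩ := h hs
  obtain ⟨s'', h1', h2', h3'⟩ := h3 h2
  exact ⟨s'', (h1.seq h1').mono (by rw [Cmd.cst, add_mul]), h2', h3'⟩

theorem WP.seq' {R : State n d → Prop} (h : WP E p f R s)
    (h' : ∀ s', Frame p s s' → R s' → WP E q f Q s') : WP E (.seq p q) f Q s :=
  WP.seq (h.frame.mono le_rfl fun s' hs' => h' s' hs'.2 hs'.1)

theorem Steps.of_eq {s' : State n d} {t : ℕ}
    (h : ∀ o b, ∃ k l, Exec E.O E.c p (s.withCost o b) ((s'.withCost o b).charge k l) ∧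
      k ≤ t ∧ l ≤ t * E.B) : Steps E p s s' t := by
  intro o b
  obtain ⟨k, l, h1, h2, h3⟩ := h o b
  exact ⟨o + k, b + l, h1, by omega, by omega⟩

theorem WP.iset {arr : ℕ} {i j e : IExpr} (hf : 1 ≤ f) (hM : e.eval s ≤ E.M)
    (h : Q (s.setI arr (i.eval s) (j.eval s) (e.eval s))) : WP E (.iset arr i j e) f Q s := by
  intro hs
  refine ⟨s.setI arr (i.eval s) (j.eval s) (e.eval s),
    Steps.of_eq fun o b => ?_, ⟨fun a k l => ?_, hs.qmem⟩, h⟩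
  · have hx := Exec.iset (O := E.O) (c := E.c) (s.withCost o b) arr i j e
    simp only [IExpr.eval_withCost] at hx
    refine ⟨_, _, hx, ?_⟩
    have h1 := i.cost_le (hs.withCost o b)
    have h2 := j.cost_le (hs.withCost o b)
    have h3 := e.cost_le (hs.withCost o b)
    have h4 : i.cst + j.cst + e.cst ≤ (Cmd.iset arr i j e).cst * f := Nat.le_mul_of_pos_right _ hf
    have h5 := Nat.mul_le_mul_right E.B h4
    rw [add_mul, add_mul] at h5
    omega
  · simp only [State.setI]
    split_ifs
    exacts [hM, hs.imem a k l]

theorem WP.qset {arr : ℕ} {i j : IExpr} {e : QExpr} (hf : 1 ≤ f)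
    (hM : Sized E s → height (e.eval s) ≤ 2 ^ E.bd arr)
    (h : Q (s.setQ arr (i.eval s) (j.eval s) (e.eval s))) : WP E (.qset arr i j e) f Q s := by
  intro hs
  refine ⟨s.setQ arr (i.eval s) (j.eval s) (e.eval s),
    Steps.of_eq fun o b => ?_, ⟨hs.imem, fun a k l => ?_⟩, h⟩
  · have hx := Exec.qset (O := E.O) (c := E.c) (s.withCost o b) arr i j e
    simp only [IExpr.eval_withCost, QExpr.eval_withCost] at hx
    refine ⟨_, _, hx, ?_⟩
    have h1 := i.cost_le (hs.withCost o b)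
    have h2 := j.cost_le (hs.withCost o b)
    have h3 := e.cost_le (hs.withCost o b)
    have h4 : i.cst + j.cst + e.cst ≤ (Cmd.qset arr i j e).cst * f := Nat.le_mul_of_pos_right _ hf
    have h5 := Nat.mul_le_mul_right E.B h4
    rw [add_mul, add_mul] at h5
    omega
  · simp only [State.setQ]
    split_ifs with h
    · rw [h.1]; exact hM hs
    · exact hs.qmem a k l

theorem WP.ite {t : Test} (hf : 1 ≤ f) (h1 : t.holds s → WP E p f Q s)
    (h2 : ¬ t.holds s → WP E q f Q s) : WP E (.ite t p q) f Q s := by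
  intro hs
  have ht : t.cst ≤ t.cst * f := Nat.le_mul_of_pos_right _ hf
  by_cases h : t.holds s
  · obtain ⟨s', h1, h2, h3⟩ := h1 h hs
    refine ⟨s', fun o b => ?_, h2, h3⟩
    obtain ⟨o', b', h1, h2, h3⟩ := h1 (o + t.ops) (b + t.bits (s.withCost o b))
    refine ⟨o', b', Exec.ite_true ((Test.holds_withCost _ _ _ _).2 h) h1, ?_⟩
    have hc := t.cost_le (hs.withCost o b)
    have := Nat.mul_le_mul_right E.B ht
    rw [Cmd.cst, add_mul, add_mul, add_mul, add_mul]
    omega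
  · obtain ⟨s', h1, h2, h3⟩ := h2 h hs
    refine ⟨s', fun o b => ?_, h2, h3⟩
    obtain ⟨o', b', h1, h2, h3⟩ := h1 (o + t.ops) (b + t.bits (s.withCost o b))
    refine ⟨o', b', Exec.ite_false (fun h' => h ((Test.holds_withCost _ _ _ _).1 h')) h1, ?_⟩
    have hc := t.cost_le (hs.withCost o b)
    have := Nat.mul_le_mul_right E.B ht
    rw [Cmd.cst, add_mul, add_mul, add_mul, add_mul]
    omega

/-- A query handles `n` rationals of size at most `B` and `n` answer bits; the factor `n + 1` and
the summand 2 in `Cmd.cst` pay for them. -/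
theorem WP.linOpt {src dst : ℕ} {i j : IExpr} (hf : n + 1 ≤ f) (hM : 1 ≤ E.M)
    (h : Q ((s.setSet dst (j.eval s) (E.O (s.row n src (i.eval s)))).record
      [s.row n src (i.eval s)] [])) : WP E (.linOpt src i dst j) f Q s := by
  intro hs
  refine ⟨(s.setSet dst (j.eval s) (E.O (s.row n src (i.eval s)))).record
    [s.row n src (i.eval s)] [],
    Steps.of_eq fun o b => ?_, ⟨fun a k l => ?_, hs.qmem⟩, h⟩
  · have hx := Exec.linOpt (O := E.O) (c := E.c) (s.withCost o b) src i dst j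
    simp only [IExpr.eval_withCost] at hx
    refine ⟨_, _, hx, ?_⟩
    have h1 := i.cost_le (hs.withCost o b)
    have h2 := j.cost_le (hs.withCost o b)
    have hB := E.one_le_B
    have hr : ∑ l, ratSize (s.row n src (i.eval s) l) ≤ n * E.B := by
      refine (Finset.sum_le_card_nsmul _ _ E.B fun l _ => ?_).trans_eq (by simp)
      exact (ratSize_le (hs.qmem _ _ _)).trans (E.bd_le _)
    have h4 : i.cst + j.cst + 2 * n ≤ (Cmd.linOpt src i dst j).cst * f := by
      rw [Cmd.cst, add_mul]
      have := Nat.le_mul_of_pos_right (i.cst + j.cst) (show 0 < f by omega)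
      omega
    have h5 := Nat.mul_le_mul_right E.B h4
    have h6 : n ≤ n * E.B := Nat.le_mul_of_pos_right _ hB
    simp only [add_mul, mul_assoc] at h5
    have hr' : ∑ l, ratSize ((s.withCost o b).row n src (i.eval s) l) ≤ n * E.B := hr
    refine ⟨by omega, ?_⟩
    simp only [mul_assoc]
    omega
  · simp only [State.record, State.setSet]
    split_ifs
    exacts [hM, Nat.zero_le _, hs.imem a k l, hs.imem a k l]

theorem WP.evalC {src dst : ℕ} {i j k : IExpr} (hf : d + 1 ≤ f)
    (hM : height (E.c (s.row d src (i.eval s))) ≤ 2 ^ E.bd dst)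
    (h : Q ((s.setQ dst (j.eval s) (k.eval s) (E.c (s.row d src (i.eval s)))).record
      [] [s.row d src (i.eval s)])) : WP E (.evalC src i dst j k) f Q s := by
  intro hs
  refine ⟨(s.setQ dst (j.eval s) (k.eval s) (E.c (s.row d src (i.eval s)))).record
    [] [s.row d src (i.eval s)],
    Steps.of_eq fun o b => ?_, ⟨hs.imem, fun a k l => ?_⟩, h⟩
  · have hx := Exec.evalC (O := E.O) (c := E.c) (s.withCost o b) src i dst j k
    simp only [IExpr.eval_withCost] at hx
    refine ⟨_, _, hx, ?_⟩
    have h1 := i.cost_le (hs.withCost o b)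
    have h2 := j.cost_le (hs.withCost o b)
    have h3 := k.cost_le (hs.withCost o b)
    have hr : ∑ l, ratSize (s.row d src (i.eval s) l) ≤ d * E.B := by
      refine (Finset.sum_le_card_nsmul _ _ E.B fun l _ => ?_).trans_eq (by simp)
      exact (ratSize_le (hs.qmem _ _ _)).trans (E.bd_le _)
    have hc : ratSize (E.c (s.row d src (i.eval s))) ≤ E.B := (ratSize_le hM).trans (E.bd_le _)
    have h4 : i.cst + j.cst + k.cst + (d + 1) ≤ (Cmd.evalC src i dst j k).cst * f := by
      rw [Cmd.cst, add_mul]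
      have := Nat.le_mul_of_pos_right (i.cst + j.cst + k.cst) (show 0 < f by omega)
      omega
    have h5 := Nat.mul_le_mul_right E.B h4
    simp only [add_mul, one_mul] at h5
    have hr' : ∑ l, ratSize ((s.withCost o b).row d src (i.eval s) l) ≤ d * E.B := hr
    have hc' : ratSize (E.c ((s.withCost o b).row d src (i.eval s))) ≤ E.B := hc
    refine ⟨by omega, by omega⟩
  · simp only [State.record, State.setQ]
    split_ifs with h
    · rw [h.1]; exact hM
    · exact hs.qmem a k l

/-! ### Counting loops -/

/-- The scalar variable `a`. -/
abbrev IExpr.var (a : ℕ) : IExpr := .get a (.const 0) (.const 0)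

abbrev QExpr.var (a : ℕ) : QExpr := .get a (.const 0) (.const 0)

/-- Assignment to the scalar variable `a`. -/
abbrev Cmd.iassign (a : ℕ) (e : IExpr) : Cmd := .iset a (.const 0) (.const 0) e

abbrev Cmd.qassign (a : ℕ) (e : QExpr) : Cmd := .qset a (.const 0) (.const 0) e

/-- `for a in [0, b) do p`. -/
def Cmd.for (a : ℕ) (b : IExpr) (p : Cmd) : Cmd :=
  .seq (.iassign a (.const 0)) (.loop (.ilt (.var a) b)
    (.seq p (.iassign a (.add (.var a) (.const 1)))))

@[simp] theorem Cmd.for_iw (a : ℕ) (b : IExpr) (p : Cmd) (x : ℕ) :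
    (Cmd.for a b p).iw x ↔ x = a ∨ p.iw x := by
  simp only [Cmd.for, Cmd.iw]; tauto

@[simp] theorem Cmd.for_qw (a : ℕ) (b : IExpr) (p : Cmd) (x : ℕ) :
    (Cmd.for a b p).qw x ↔ p.qw x := by simp [Cmd.for]

@[simp] theorem Cmd.for_quiet (a : ℕ) (b : IExpr) (p : Cmd) :
    (Cmd.for a b p).Quiet ↔ p.Quiet := by simp [Cmd.for]

@[simp] theorem State.setI_imem (s : State n d) (a i j v a' i' j' : ℕ) :
    (s.setI a i j v).imem a' i' j' = if a' = a ∧ i' = i ∧ j' = j then v else s.imem a' i' j' := rfl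

@[simp] theorem State.setI_qmem (s : State n d) (a i j v : ℕ) :
    (s.setI a i j v).qmem = s.qmem := rfl

@[simp] theorem State.setI_linLog (s : State n d) (a i j v : ℕ) :
    (s.setI a i j v).linLog = s.linLog := rfl

@[simp] theorem State.setI_evalLog (s : State n d) (a i j v : ℕ) :
    (s.setI a i j v).evalLog = s.evalLog := rfl

@[simp] theorem State.setQ_qmem (s : State n d) (a i j : ℕ) (v : ℚ) (a' i' j' : ℕ) :
    (s.setQ a i j v).qmem a' i' j' = if a' = a ∧ i' = i ∧ j' = j then v else s.qmem a' i' j' := rfl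

@[simp] theorem State.setQ_imem (s : State n d) (a i j : ℕ) (v : ℚ) :
    (s.setQ a i j v).imem = s.imem := rfl

@[simp] theorem State.setQ_linLog (s : State n d) (a i j : ℕ) (v : ℚ) :
    (s.setQ a i j v).linLog = s.linLog := rfl

@[simp] theorem State.setQ_evalLog (s : State n d) (a i j : ℕ) (v : ℚ) :
    (s.setQ a i j v).evalLog = s.evalLog := rfl

/-- The invariant is indexed by the number of finished passes and must not depend on the counter
cell (`hI`). The bound need not be a constant, only evaluate to `N` in every state that differs from
`s` within what the loop may write. -/
theorem WP.for {a : ℕ} {b : IExpr} {fb : ℕ} (N : ℕ) (I : ℕ → State n d → Prop)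
    (hf : (N + 1) * fb ≤ f) (hfb : 1 ≤ fb) (ha : ¬ p.iw a) (hN : N ≤ E.M)
    (hb : ∀ s', Frame (.for a b p) s s' → b.eval s' = N)
    (hI : ∀ k s' v, I k s' → I k (s'.setI a 0 0 v))
    (h0 : I 0 s)
    (hstep : ∀ k < N, ∀ s', Frame (.for a b p) s s' → s'.imem a 0 0 = k → I k s' →
      WP E p fb (I (k + 1)) s')
    (hQ : ∀ s', I N s' → Q s') :
    WP E (.for a b p) f Q s := by
  intro hs
  set inc : Cmd := .iassign a (.add (.var a) (.const 1)) with hinc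
  set tst : Test := .ilt (.var a) b with htst
  have hset : ∀ (s' : State n d) (v : ℕ), Frame (.for a b p) s s' →
      Frame (.for a b p) s (s'.setI a 0 0 v) := fun s' v h =>
    h.trans ⟨fun x hx => by
      funext k l
      have : x ≠ a := fun e => hx (by simp [e])
      simp [this], fun _ _ => rfl, fun _ => rfl, fun _ => rfl⟩
  -- Induction on the number `r` of remaining passes; `r + 1` tests are made, the last one failing.
  have hloop : ∀ r k, k + r = N → ∀ s', Frame (.for a b p) s s' → s'.imem a 0 0 = k → I k s' →
      Sized E s' → ∃ s'', Steps E (.loop tst (.seq p inc)) s' s''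
        ((r + 1) * tst.cst + r * (p.cst * fb + inc.cst)) ∧ Sized E s'' ∧ I N s'' := by
    intro r
    induction r with
    | zero =>
      intro k hk s' hF hc hI' hs'
      have hk' : k = N := by omega
      subst hk'
      refine ⟨s', Steps.of_eq fun o b' => ⟨_, _, Exec.loop_false ?_, ?_⟩, hs', hI'⟩
      · rw [Test.holds_withCost]
        simp [htst, Test.holds, IExpr.eval, hc, hb s' hF]
      · have := tst.cost_le (hs'.withCost o b')
        simpa using this.symm
    | succ r ih =>
      intro k hk s' hF hc hI' hs'
      obtain ⟨s₁, h1, h2, h3⟩ := (hstep k (by omega) s' hF hc hI').frame hs'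
      have hF₁ : Frame (.for a b p) s s₁ := hF.trans (h3.2.mono (fun x hx => by simp [hx])
        (fun x hx => by simp [hx]) fun hx => by simpa using hx)
      have hc₁ : s₁.imem a 0 0 = k := by rw [h3.2.imem a ha, hc]
      have hW : WP E inc 1 (fun s₂ => s₂ = s₁.setI a 0 0 (k + 1)) s₁ := by
        refine WP.iset le_rfl ?_ ?_ <;> simp only [IExpr.eval, hc₁]
        omega
      obtain ⟨s₂, h1', h2', rfl⟩ := hW h2
      obtain ⟨s₃, h4, h5, h6⟩ := ih (k + 1) (by omega) _ (hset _ _ hF₁) (by simp)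
        (hI _ _ _ h3.1) h2'
      refine ⟨s₃, fun o b' => ?_, h5, h6⟩
      obtain ⟨o₁, b₁, e₁, e₂, e₃⟩ := (h1.seq h1') (o + tst.ops) (b' + tst.bits (s'.withCost o b'))
      obtain ⟨o₂, b₂, e₁', e₂', e₃'⟩ := h4 o₁ b₁
      have hcost := tst.cost_le (hs'.withCost o b')
      refine ⟨o₂, b₂, Exec.loop_true ?_ e₁ e₁', ?_, ?_⟩
      · rw [Test.holds_withCost]
        simp [htst, Test.holds, IExpr.eval, hc, hb s' hF]
        omega
      · have e : (r + 1 + 1) * tst.cst + (r + 1) * (p.cst * fb + inc.cst)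
          = tst.cst + (p.cst * fb + inc.cst) + ((r + 1) * tst.cst + r * (p.cst * fb + inc.cst)) := by
          ring
        omega
      · have e : ((r + 1 + 1) * tst.cst + (r + 1) * (p.cst * fb + inc.cst)) * E.B
          = tst.cst * E.B + (p.cst * fb + inc.cst * 1) * E.B
            + ((r + 1) * tst.cst + r * (p.cst * fb + inc.cst)) * E.B := by
          ring
        omega
  have hW : WP E (.iassign a (.const 0)) 1 (fun s₂ => s₂ = s.setI a 0 0 0) s :=
    WP.iset le_rfl (Nat.zero_le _) rfl
  obtain ⟨s₁, h1, h2, rfl⟩ := hW hs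
  obtain ⟨s₂, h3, h4, h5⟩ := hloop N 0 (by omega) _ (hset _ _ (Frame.refl _ _)) (by simp)
    (hI _ _ _ h0) h2
  refine ⟨s₂, (h1.seq h3).mono ?_, h4, hQ _ h5⟩
  have e : (Cmd.for a b p).cst = (Cmd.iassign a (.const 0)).cst + tst.cst + p.cst + inc.cst := by
    simp only [Cmd.for, Cmd.cst, htst, hinc]; ring
  rw [e]
  refine le_trans ?_ (Nat.mul_le_mul_left _ hf)
  generalize (Cmd.iassign a (.const 0)).cst = x
  generalize tst.cst = y
  generalize p.cst = z
  generalize inc.cst = u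
  obtain ⟨g, rfl⟩ : ∃ g, fb = g + 1 := ⟨fb - 1, by omega⟩
  -- One initialization, `N + 1` tests, `N` bodies and `N` increments fit into the syntactic cost
  -- times `(N + 1) * fb`; the last bracket is the slack.
  have : (x + y + z + u) * ((N + 1) * (g + 1)) = x * 1 + ((N + 1) * y + N * (z * (g + 1) + u))
      + (x * (N * g + N + g) + y * (N + 1) * g + z * (g + 1) + u * (N * g + g + 1)) := by ring
  omega

end ConvexOpt

namespace ConvexOpt

open Finset

variable {n d : ℕ} {E : Env n d}

/-! ### Sums and determinants as expressions -/

/-- The arrays that an expression reads. -/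
@[simp] def QExpr.Reads : QExpr → ℕ → Prop
  | .const _, _ => False
  | .get arr _ _, a => a = arr
  | .add x y, a => x.Reads a ∨ y.Reads a
  | .sub x y, a => x.Reads a ∨ y.Reads a
  | .mul x y, a => x.Reads a ∨ y.Reads a
  | .div x y, a => x.Reads a ∨ y.Reads a

/-- Logarithms of heights add under each operation, so a fixed expression multiplies the exponent by
a constant, and the syntactic cost is large enough to be that constant. -/
theorem QExpr.height_eval_le {s : State n d} (hs : Sized E s) {X : ℕ} (hX : 1 ≤ X) (e : QExpr)
    (h : ∀ a, e.Reads a → E.bd a ≤ X) : height (e.eval s) ≤ 2 ^ (e.cst * X) := by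
  have bin : ∀ {u v z : ℚ} {x y : ℕ}, height u ≤ 2 ^ (x * X) → height v ≤ 2 ^ (y * X) →
      height z ≤ height u * height v → height z ≤ 2 ^ ((3 * (x + y) + 4) * X) := by
    intro u v z x y hu hv hz
    refine (hz.trans (Nat.mul_le_mul hu hv)).trans ?_
    rw [← pow_add, ← add_mul]
    exact Nat.pow_le_pow_right (by norm_num) (Nat.mul_le_mul_right _ (by omega))
  induction e with
  | const q =>
    exact (height_le_two_pow q).trans
      (Nat.pow_le_pow_right (by norm_num) (Nat.le_mul_of_pos_right _ hX))
  | get a i j =>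
    refine (hs.qmem _ _ _).trans (Nat.pow_le_pow_right (by norm_num) ((h a rfl).trans ?_))
    exact Nat.le_mul_of_pos_left _ (by simp [QExpr.cst])
  | add x y hx hy =>
    exact bin (hx fun a ha => h a (Or.inl ha)) (hy fun a ha => h a (Or.inr ha)) (height_add _ _)
  | sub x y hx hy =>
    exact bin (hx fun a ha => h a (Or.inl ha)) (hy fun a ha => h a (Or.inr ha)) (height_sub _ _)
  | mul x y hx hy =>
    exact bin (hx fun a ha => h a (Or.inl ha)) (hy fun a ha => h a (Or.inr ha)) (height_mul _ _)
  | div x y hx hy =>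
    exact bin (hx fun a ha => h a (Or.inl ha)) (hy fun a ha => h a (Or.inr ha)) (height_div _ _)

theorem QExpr.height_eval_le' {s : State n d} (hs : Sized E s) {X Y : ℕ} (hX : 1 ≤ X) (e : QExpr)
    (h : ∀ a, e.Reads a → E.bd a ≤ X) (hY : e.cst * X ≤ Y) : height (e.eval s) ≤ 2 ^ Y :=
  (e.height_eval_le hs hX h).trans (Nat.pow_le_pow_right (by norm_num) hY)

/-- `∑ i, f i`. -/
def sumE : (k : ℕ) → (Fin k → QExpr) → QExpr
  | 0, _ => .const 0
  | k + 1, f => .add (f 0) (sumE k fun i => f i.succ)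

theorem sumE_eval (s : State n d) (k : ℕ) (f : Fin k → QExpr) :
    (sumE k f).eval s = ∑ i, (f i).eval s := by
  induction k with
  | zero => simp [sumE, QExpr.eval]
  | succ k ih => rw [sumE, QExpr.eval, ih, Fin.sum_univ_succ]

theorem sumE_reads {k : ℕ} {f : Fin k → QExpr} {a : ℕ} (h : (sumE k f).Reads a) :
    ∃ i, (f i).Reads a := by
  induction k with
  | zero => exact h.elim
  | succ k ih =>
    rcases h with h | h
    · exact ⟨0, h⟩
    · obtain ⟨i, hi⟩ := ih h
      exact ⟨i.succ, hi⟩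

/-- The determinant, expanded along the first row. -/
def detE : (k : ℕ) → (Fin k → Fin k → QExpr) → QExpr
  | 0, _ => .const 1
  | k + 1, A => sumE (k + 1) fun j => .mul (.mul (.const ((-1) ^ (j : ℕ))) (A 0 j))
      (detE k fun i l => A i.succ (j.succAbove l))

theorem detE_eval (s : State n d) (k : ℕ) (A : Fin k → Fin k → QExpr) :
    (detE k A).eval s = (Matrix.of fun i j => (A i j).eval s).det := by
  induction k with
  | zero => simp [detE, QExpr.eval]
  | succ k ih =>
    rw [detE, sumE_eval, Matrix.det_succ_row_zero]
    refine Finset.sum_congr rfl fun j _ => ?_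
    simp only [QExpr.eval, ih]
    rfl

theorem detE_reads {k : ℕ} {A : Fin k → Fin k → QExpr} {a : ℕ} (h : (detE k A).Reads a) :
    ∃ i j, (A i j).Reads a := by
  induction k with
  | zero => exact h.elim
  | succ k ih =>
    obtain ⟨j, hj⟩ := sumE_reads h
    rcases hj with (hj | hj) | hj
    · exact hj.elim
    · exact ⟨0, j, hj⟩
    · obtain ⟨i, l, hil⟩ := ih hj
      exact ⟨i.succ, _, hil⟩

/-- `x ^ k`. -/
def powE (x : QExpr) : ℕ → QExpr
  | 0 => .const 1
  | k + 1 => .mul (powE x k) x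

theorem powE_eval (s : State n d) (x : QExpr) (k : ℕ) : (powE x k).eval s = x.eval s ^ k := by
  induction k with
  | zero => simp [powE, QExpr.eval]
  | succ k ih => rw [powE, QExpr.eval, ih, pow_succ]

theorem powE_reads {x : QExpr} {k a : ℕ} (h : (powE x k).Reads a) : x.Reads a := by
  induction k with
  | zero => exact h.elim
  | succ k ih => exact h.elim ih id

/-! ### Repetition of a program for each number below a constant -/

def Cmd.each (p : ℕ → Cmd) : ℕ → Cmd
  | 0 => .skip
  | k + 1 => .seq (Cmd.each p k) (p k)

theorem Cmd.each_iw {p : ℕ → Cmd} {k a : ℕ} : (Cmd.each p k).iw a ↔ ∃ i < k, (p i).iw a := by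
  induction k with
  | zero => simp [Cmd.each]
  | succ k ih => 
    simp only [Cmd.each, Cmd.iw, Cmd.qw, ih, Nat.lt_succ_iff_lt_or_eq, or_and_right, exists_or,
      exists_eq_left]

theorem Cmd.each_qw {p : ℕ → Cmd} {k a : ℕ} : (Cmd.each p k).qw a ↔ ∃ i < k, (p i).qw a := by
  induction k with
  | zero => simp [Cmd.each]
  | succ k ih => 
    simp only [Cmd.each, Cmd.iw, Cmd.qw, ih, Nat.lt_succ_iff_lt_or_eq, or_and_right, exists_or,
      exists_eq_left]

theorem Cmd.each_quiet {p : ℕ → Cmd} {k : ℕ} (h : ∀ i < k, (p i).Quiet) :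
    (Cmd.each p k).Quiet := by
  induction k with
  | zero => trivial
  | succ k ih => exact ⟨ih fun i hi => h i (by omega), h k (by omega)⟩

/-- The number of repetitions is fixed in the program, so it is counted in `Cmd.cst` and the factor
`f` is unchanged. -/
theorem WP.each {p : ℕ → Cmd} {k f : ℕ} (I : ℕ → State n d → Prop) {s : State n d}
    (h0 : I 0 s) (hstep : ∀ i < k, ∀ s', Frame (Cmd.each p k) s s' → I i s' →
      WP E (p i) f (I (i + 1)) s') : WP E (Cmd.each p k) f (I k) s := by
  induction k with
  | zero => exact WP.skip h0
  | succ k ih =>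
    refine WP.seq' (ih fun i hi s' hF hs' => hstep i (by omega) s' (hF.mono ?_ ?_ ?_) hs')
      fun s' hF hs' => hstep k (by omega) s' (hF.mono ?_ ?_ ?_) hs'
    all_goals first
      | exact fun _ h => Or.inl h
      | exact fun h => h.1

/-! ### Nested loops -/

/-- `k` nested loops, with the counters `100, …, 100 + k - 1` and the bounds `b`. -/
def Cmd.nest (b : ℕ → IExpr) (p : Cmd) : ℕ → Cmd
  | 0 => p
  | k + 1 => .for (100 + k) (b k) (Cmd.nest b p k)

theorem Cmd.nest_iw {b : ℕ → IExpr} {p : Cmd} {k a : ℕ} :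
    (Cmd.nest b p k).iw a ↔ p.iw a ∨ ∃ j < k, a = 100 + j := by
  induction k with
  | zero => simp [Cmd.nest]
  | succ k ih =>
    simp only [Cmd.nest, Cmd.for_iw, ih, Nat.lt_succ_iff_lt_or_eq, or_and_right, exists_or,
      exists_eq_left]
    rw [or_comm, or_assoc]

@[simp] theorem Cmd.nest_qw {b : ℕ → IExpr} {p : Cmd} {k a : ℕ} :
    (Cmd.nest b p k).qw a ↔ p.qw a := by
  induction k with
  | zero => simp [Cmd.nest]
  | succ k ih => simp [Cmd.nest, ih]

@[simp] theorem Cmd.nest_quiet {b : ℕ → IExpr} {p : Cmd} {k : ℕ} :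
    (Cmd.nest b p k).Quiet ↔ p.Quiet := by
  induction k with
  | zero => simp [Cmd.nest]
  | succ k ih => simp [Cmd.nest, ih]

/-- The tuples `τ` with `τ j < N j` for `j < k` that agree with `σ` from `k` on. -/
def tupleList (N : ℕ → ℕ) : ℕ → (ℕ → ℕ) → List (ℕ → ℕ)
  | 0, σ => [σ]
  | k + 1, σ => (List.range (N k)).flatMap fun i => tupleList N k (Function.update σ k i)

theorem mem_tupleList {N : ℕ → ℕ} {k : ℕ} {σ τ : ℕ → ℕ} :
    τ ∈ tupleList N k σ ↔ (∀ j < k, τ j < N j) ∧ ∀ j, k ≤ j → τ j = σ j := by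
  induction k generalizing σ with
  | zero =>
    simp only [tupleList, List.mem_singleton, Nat.not_lt_zero, false_imp_iff, implies_true,
      true_and, Nat.zero_le, true_imp_iff]
    exact funext_iff
  | succ k ih =>
    simp only [tupleList, List.mem_flatMap, List.mem_range, ih]
    constructor
    · rintro ⟨i, hi, h1, h2⟩
      have hk : τ k = i := by rw [h2 k le_rfl, Function.update_self]
      refine ⟨fun j hj => ?_, fun j hj => ?_⟩
      · rcases Nat.lt_succ_iff_lt_or_eq.1 hj with h | rfl
        · exact h1 j h
        · rwa [hk]
      · rw [h2 j (by omega), Function.update_of_ne (by omega)]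
    · rintro ⟨h1, h2⟩
      refine ⟨τ k, h1 k (by omega), fun j hj => h1 j (by omega), fun j hj => ?_⟩
      rcases Nat.eq_or_lt_of_le hj with rfl | h
      · rw [Function.update_self]
      · rw [h2 j h, Function.update_of_ne (by omega)]

theorem length_tupleList (N : ℕ → ℕ) (k : ℕ) (σ : ℕ → ℕ) :
    (tupleList N k σ).length = ∏ j ∈ range k, N j := by
  induction k generalizing σ with
  | zero => simp [tupleList]
  | succ k ih =>
    simp [tupleList, ih, Finset.prod_range_succ, List.length_flatMap, mul_comm]

/-- The invariant is indexed by the list of tuples already visited, so that at the end it speaks of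
the whole list in its order. -/
theorem WP.nest {b : ℕ → IExpr} {p : Cmd} {D f fb : ℕ} {s : State n d} (N : ℕ → ℕ)
    (I : List (ℕ → ℕ) → State n d → Prop) (hf : (∏ j ∈ range D, (N j + 1)) * fb ≤ f)
    (hfb : 1 ≤ fb) (hp : ∀ j < D, ¬ p.iw (100 + j)) (hN : ∀ j < D, N j ≤ E.M)
    (hb : ∀ j < D, ∀ s', Frame (.nest b p D) s s' → (b j).eval s' = N j)
    (hI : ∀ done s' j v, I done s' → I done (s'.setI (100 + j) 0 0 v))
    (h0 : I [] s)
    (hbody : ∀ done σ s', Frame (.nest b p D) s s' → (∀ j < D, s'.imem (100 + j) 0 0 = σ j) →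
      (∀ j < D, σ j < N j) → I done s' → WP E p fb (I (done ++ [σ])) s') :
    WP E (.nest b p D) f (I (tupleList N D 0)) s := by
  have mono : ∀ k ≤ D, ∀ s₁ s₂ : State n d, Frame (.nest b p k) s₁ s₂ →
      Frame (.nest b p D) s₁ s₂ := fun k hk s₁ s₂ h => h.mono
    (fun a ha => by
      rw [Cmd.nest_iw] at ha ⊢
      exact ha.imp_right fun ⟨j, hj, e⟩ => ⟨j, by omega, e⟩)
    (fun a ha => by simpa using ha) fun h => by simpa using h
  -- The counters from `k` on belong to the enclosing loops and are frozen at the values of `σ`.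
  have main : ∀ k ≤ D, ∀ σ done s', Frame (.nest b p D) s s' →
      (∀ j, k ≤ j → j < D → s'.imem (100 + j) 0 0 = σ j) →
      (∀ j, k ≤ j → j < D → σ j < N j) → I done s' →
      WP E (.nest b p k) ((∏ j ∈ range k, (N j + 1)) * fb) (I (done ++ tupleList N k σ)) s' := by
    intro k
    induction k with
    | zero =>
      intro _ σ done s' hF hc hσ hI'
      refine (hbody done σ s' hF (fun j hj => hc j (Nat.zero_le _) hj)
        (fun j hj => hσ j (Nat.zero_le _) hj) hI').mono ?_ fun _ h => h
      simp
    | succ k ih =>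
      intro hk σ done s' hF hc hσ hI'
      refine WP.for (N k) (fun i s'' => I (done ++ (List.range i).flatMap fun i =>
        tupleList N k (Function.update σ k i)) s'') (fb := (∏ j ∈ range k, (N j + 1)) * fb)
        ?_ ?_ ?_ (hN k hk) (fun s'' hF' => hb k hk s'' (hF.trans (mono (k + 1) hk _ _ hF')))
        (fun _ _ v h => hI _ _ k v h) (by simpa using hI') ?_ fun _ h => h
      · rw [Finset.prod_range_succ]
        exact le_of_eq (by ring)
      · exact Nat.mul_pos (Finset.prod_pos fun _ _ => Nat.succ_pos _) hfb
      · rw [Cmd.nest_iw]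
        rintro (h | ⟨j, hj, e⟩)
        · exact hp k hk h
        · omega
      · intro i hi s'' hF' hci hI''
        have hkeep : ∀ j, k < j → j < D → s''.imem (100 + j) 0 0 = s'.imem (100 + j) 0 0 := by
          intro j hj hjD
          rw [hF'.imem (100 + j)]
          rw [Cmd.for_iw, Cmd.nest_iw]
          rintro (h | h | ⟨l, hl, e⟩)
          · omega
          · exact hp j hjD h
          · omega
        refine (ih (by omega) (Function.update σ k i) _ s''
          (hF.trans (mono (k + 1) hk _ _ hF')) ?_ ?_ hI'').mono le_rfl ?_
        · intro j hj hjD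
          rcases Nat.eq_or_lt_of_le hj with rfl | h
          · rw [Function.update_self, hci]
          · rw [Function.update_of_ne (by omega), hkeep j h hjD, hc j h hjD]
        · intro j hj hjD
          rcases Nat.eq_or_lt_of_le hj with rfl | h
          · rwa [Function.update_self]
          · rw [Function.update_of_ne (by omega)]; exact hσ j h hjD
        · intro s₃ h
          simpa [List.range_succ, List.append_assoc] using h
  refine (main D le_rfl 0 [] s (Frame.refl _ _) (fun j h1 h2 => by omega)
    (fun j h1 h2 => by omega) h0).mono hf fun s' h => ?_
  simpa using h

end ConvexOpt

namespace ConvexOpt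

open Finset

variable {n d : ℕ} {E : Env n d}

/-- Exponents that bound the heights of the rational arrays of the program. -/
def bdFun (X K Y : ℕ) : ℕ → ℕ
  | 5 => K ^ 2 * X
  | 6 => K ^ 2 * X
  | 7 => K ^ 3 * X
  | 8 => K ^ 2 * X
  | 9 => K ^ 4 * X
  | 10 => K ^ 5 * X
  | 11 => K ^ 6 * X
  | 13 => Y
  | 14 => Y
  | 15 => K * X
  | _ => X

/-! ### Selection of one direction of each sign pattern -/

/-- The first nonzero entry of `x` before `j`; whether all entries are, up to sign, equal to it;
and the sign pattern as a number in base three. -/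
def signState (x : ℕ → ℚ) : ℕ → ℚ × ℕ × ℕ
  | 0 => (0, 1, 0)
  | j + 1 =>
    let f := if (signState x j).1 = 0 then x j else (signState x j).1
    if x j = 0 then (f, (signState x j).2.1, 3 * (signState x j).2.2)
    else if x j = f then (f, (signState x j).2.1, 3 * (signState x j).2.2 + 1)
    else if x j = -f then (f, (signState x j).2.1, 3 * (signState x j).2.2 + 2)
    else (f, 0, (signState x j).2.2)

theorem signState_lt (x : ℕ → ℚ) (j : ℕ) : (signState x j).2.2 < 3 ^ j := by
  induction j with
  | zero => simp [signState]
  | succ j ih =>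
    have : 3 ^ (j + 1) = 3 * 3 ^ j := by ring
    simp only [signState]
    split_ifs <;> simp <;> omega

theorem signState_ok_le (x : ℕ → ℚ) (j : ℕ) : (signState x j).2.1 ≤ 1 := by
  induction j with
  | zero => simp [signState]
  | succ j ih =>
    simp only [signState]
    split_ifs <;> simp [ih]

theorem signState_fst_eq_zero {x : ℕ → ℚ} {j : ℕ} (h : (signState x j).1 = 0) :
    ∀ l < j, x l = 0 := by
  induction j with
  | zero => simp
  | succ j ih =>
    have key : (signState x (j + 1)).1
        = if (signState x j).1 = 0 then x j else (signState x j).1 := by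
      simp only [signState]
      split_ifs <;> rfl
    rw [key] at h
    split_ifs at h with h0
    · intro l hl
      rcases Nat.lt_succ_iff_lt_or_eq.1 hl with h' | rfl
      · exact ih h0 l h'
      · exact h
    · exact absurd h h0

theorem signState_ok_pred {x : ℕ → ℚ} {j : ℕ} (h : (signState x (j + 1)).2.1 = 1) :
    (signState x j).2.1 = 1 := by
  simp only [signState] at h
  generalize signState x j = st at h ⊢
  split_ifs at h <;> exact h

/-- The first nonzero entry equals the reference entry and contributes the digit 1, after which the
code stays positive. -/
theorem signState_eq_zero_iff {x : ℕ → ℚ} {j : ℕ} (h : (signState x j).2.1 = 1) :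
    (signState x j).1 = 0 ↔ (signState x j).2.2 = 0 := by
  induction j with
  | zero => simp [signState]
  | succ j ih =>
    have ih := ih (signState_ok_pred h)
    simp only [signState] at h ⊢
    generalize signState x j = st at h ih ⊢
    by_cases h0 : st.1 = 0
    · have h1 := ih.1 h0
      simp only [h0, if_true, h1] at h ⊢
      split_ifs at h ⊢ with h2 <;> simp_all
    · have h1 := fun h => h0 (ih.2 h)
      simp only [h0, if_false] at h ⊢
      split_ifs at h ⊢ with h2 h3 h4 <;> simp [h0] <;> exact h1

/-- Vectors with the same sign pattern are parallel. -/
theorem signState_parallel {x y : ℕ → ℚ} {j : ℕ} (hx : (signState x j).2.1 = 1)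
    (hy : (signState y j).2.1 = 1) (h : (signState x j).2.2 = (signState y j).2.2) :
    ∀ l < j, x l * (signState y j).1 = y l * (signState x j).1 := by
  induction j with
  | zero => simp
  | succ j ih =>
    have hx' := signState_ok_pred hx
    have hy' := signState_ok_pred hy
    have zx := signState_eq_zero_iff hx'
    have zy := signState_eq_zero_iff hy'
    have fx := signState_fst_eq_zero (x := x) (j := j)
    have fy := signState_fst_eq_zero (x := y) (j := j)
    have ih := ih hx' hy'
    -- Equal codes have the same last digit in base three, so the codes of the prefixes agree.
    have hh : (signState x j).2.2 = (signState y j).2.2 := by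
      simp only [signState] at h hx hy
      split_ifs at h hx hy <;> simp at h hx hy <;> omega
    have ih := ih hh
    intro l hl
    simp only [signState] at h hx hy ⊢
    rcases Nat.lt_succ_iff_lt_or_eq.1 hl with hl' | rfl
    · have ihl := ih l hl'
      by_cases h0 : (signState x j).1 = 0
      · have h0' : (signState y j).1 = 0 := zy.2 (hh ▸ zx.1 h0)
        rw [fx h0 l hl', fy h0' l hl', zero_mul, zero_mul]
      · have h0' : ¬ (signState y j).1 = 0 := fun h1 => h0 (zx.2 (hh ▸ zy.1 h1))
        simp only [h0, h0', if_false]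
        split_ifs <;> exact ihl
    · by_cases h0 : (signState x l).1 = 0
      · have h0' : (signState y l).1 = 0 := zy.2 (hh ▸ zx.1 h0)
        simp only [h0, h0', if_true]
        split_ifs <;> simp [mul_comm]
      · have h0' : ¬ (signState y l).1 = 0 := fun h1 => h0 (zx.2 (hh ▸ zy.1 h1))
        simp only [h0, h0', if_false] at h hx hy ⊢
        split_ifs at h hx hy ⊢ <;> simp_all [mul_comm]

/-- Multiples of differences of indicator vectors have a sign pattern. -/
theorem signState_ok {x : ℕ → ℚ} {r : ℚ} (hr : r ≠ 0) {j : ℕ}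
    (h : ∀ l < j, x l = 0 ∨ x l = r ∨ x l = -r) :
    (signState x j).2.1 = 1 ∧
      ((signState x j).1 = 0 ∨ (signState x j).1 = r ∨ (signState x j).1 = -r) := by
  induction j with
  | zero => simp [signState]
  | succ j ih =>
    obtain ⟨h1, h2⟩ := ih fun l hl => h l (by omega)
    have h3 := h j (by omega)
    simp only [signState]
    rcases h2 with h2 | h2 | h2 <;> rcases h3 with h3 | h3 | h3 <;> simp [h1, h2, h3, hr]
    · split_ifs <;> simp [h1]
    · split_ifs <;> simp [h1]

/-- `sel 0, …, sel (M - 1)` are all of `0, …, m - 1`, or, if `m` exceeds the number of sign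
patterns, they include one vector of each pattern. -/
structure Selected (e : ℕ → ℕ → ℚ) (n m M : ℕ) (sel : ℕ → ℕ) : Prop where
  le : M ≤ m
  le_pow : M ≤ 3 ^ n
  lt : ∀ k < M, sel k < m
  eq : m ≤ 3 ^ n → M = m ∧ ∀ k < M, sel k = k
  cover : 3 ^ n < m → ∀ i < m, (signState (e i) n).2.1 = 1 →
    ∃ k < M, (signState (e (sel k)) n).2.1 = 1 ∧
      (signState (e (sel k)) n).2.2 = (signState (e i) n).2.2

/-- One step of the computation of the sign pattern of row `20` of the array `1`. -/
def signCmd : Cmd :=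
  .seq (.ite (.qlt (.const 0) (.mul (.var 3) (.var 3))) .skip
      (.qassign 3 (.get 1 (.var 20) (.var 21))))
    (.ite (.qlt (.const 0) (.mul (.get 1 (.var 20) (.var 21)) (.get 1 (.var 20) (.var 21))))
      (.ite (.qlt (.const 0) (.mul (.sub (.get 1 (.var 20) (.var 21)) (.var 3))
          (.sub (.get 1 (.var 20) (.var 21)) (.var 3))))
        (.ite (.qlt (.const 0) (.mul (.add (.get 1 (.var 20) (.var 21)) (.var 3))
            (.add (.get 1 (.var 20) (.var 21)) (.var 3))))
          (.iassign 8 (.const 0))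
          (.iassign 7 (.add (.mul (.const 3) (.var 7)) (.const 2))))
        (.iassign 7 (.add (.mul (.const 3) (.var 7)) (.const 1))))
      (.iassign 7 (.mul (.const 3) (.var 7))))

/-- Sign pattern of row `20`, and its entry in the table of patterns. -/
def selectRowCmd : Cmd :=
  .seq (.iassign 7 (.const 0)) (.seq (.iassign 8 (.const 1)) (.seq (.qassign 3 (.const 0))
    (.seq (.for 21 (.var 0) signCmd)
      (.ite (.ilt (.const 0) (.var 8))
        (.ite (.ilt (.get 5 (.const 0) (.var 7)) (.const 1))
          (.seq (.iset 5 (.const 0) (.var 7) (.const 1))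
            (.seq (.iset 3 (.const 0) (.var 4) (.var 20))
              (.iassign 4 (.add (.var 4) (.const 1)))))
          .skip)
        .skip))))

/-- Keeping at most 3^n vectors makes the logarithm of the number of rows O(n) for fixed d, which
pays for the sorting. The table of patterns is addressed by codes below 3^n, but only the cells
touched are charged. -/
def selectCmd : Cmd :=
  .seq (.iassign 6 (.const 1)) (.seq (.for 20 (.var 0) (.iassign 6 (.mul (.var 6) (.const 3))))
    (.ite (.ilt (.var 6) (.var 1))
      (.seq (.iassign 4 (.const 0)) (.for 20 (.var 1) selectRowCmd))
      (.seq (.iassign 4 (.var 1)) (.for 20 (.var 1) (.iset 3 (.const 0) (.var 20) (.var 20))))))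

/-- The machine has only strict comparisons; an equality test is made on a square. -/
theorem zero_lt_mul_self_iff (x : ℚ) : 0 < x * x ↔ x ≠ 0 := mul_self_pos

theorem signCmd_wp {s : State n d} {f i j : ℕ} (hf : 1 ≤ f) (hbd : E.bd 1 ≤ E.bd 3)
    (hM : 3 ^ (j + 1) ≤ E.M) (hi : s.imem 20 0 0 = i) (hj : s.imem 21 0 0 = j)
    (h : s.qmem 3 0 0 = (signState (s.qmem 1 i) j).1 ∧
      s.imem 8 0 0 = (signState (s.qmem 1 i) j).2.1 ∧
      s.imem 7 0 0 = (signState (s.qmem 1 i) j).2.2) :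
    WP E signCmd f (fun s' => s'.qmem 3 0 0 = (signState (s.qmem 1 i) (j + 1)).1 ∧
      s'.imem 8 0 0 = (signState (s.qmem 1 i) (j + 1)).2.1 ∧
      s'.imem 7 0 0 = (signState (s.qmem 1 i) (j + 1)).2.2) s := by
  have hlt := signState_lt (s.qmem 1 i) j
  have hok := signState_ok_le (s.qmem 1 i) j
  have hp : 3 ^ (j + 1) = 3 * 3 ^ j := by ring
  obtain ⟨h3, h8, h7⟩ := h
  refine WP.seq' (R := fun s' => s'.qmem 3 0 0 = if (signState (s.qmem 1 i) j).1 = 0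
    then s.qmem 1 i j else (signState (s.qmem 1 i) j).1) (WP.ite hf ?_ ?_) ?_
  · intro ht
    refine WP.skip ?_
    simp only [Test.holds, QExpr.eval, IExpr.eval, zero_lt_mul_self_iff, h3] at ht
    rw [if_neg ht, h3]
  · intro ht
    refine WP.qset hf (fun hs => ?_) ?_
    · exact (hs.qmem _ _ _).trans (Nat.pow_le_pow_right (by norm_num) hbd)
    · simp only [Test.holds, QExpr.eval, IExpr.eval, zero_lt_mul_self_iff, h3, not_not] at ht
      simp [ht, QExpr.eval, IExpr.eval, hi, hj]
  · intro s' hF hs'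
    have e1 : s'.imem = s.imem := by funext a; exact hF.imem a (by simp)
    have e2 : s'.qmem 1 = s.qmem 1 := hF.qmem 1 (by simp)
    set g := if (signState (s.qmem 1 i) j).1 = 0
      then s.qmem 1 i j else (signState (s.qmem 1 i) j).1 with hg
    refine WP.ite hf (fun t1 => WP.ite hf (fun t2 => WP.ite hf (fun t3 => ?_) fun t3 => ?_)
      fun t2 => ?_) fun t1 => ?_
    all_goals
      try simp only [Test.holds, QExpr.eval, IExpr.eval, zero_lt_mul_self_iff, not_not, e1, e2, hi,
        hj, hs', sub_ne_zero] at t1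
      try simp only [Test.holds, QExpr.eval, IExpr.eval, zero_lt_mul_self_iff, not_not, e1, e2, hi,
        hj, hs', ne_eq, sub_eq_zero] at t2
      try simp only [Test.holds, QExpr.eval, IExpr.eval, zero_lt_mul_self_iff, not_not, e1, e2, hi,
        hj, hs'] at t3
    all_goals
      simp only [signState]
      rw [← hg]
    · refine WP.iset hf (Nat.zero_le _) ?_
      have t3' : ¬ s.qmem 1 i j = -g := fun h => t3 (by rw [h]; ring)
      rw [if_neg t1, if_neg t2, if_neg t3']
      simp [IExpr.eval, e1, h7, hs']
    · refine WP.iset hf (by simp [IExpr.eval, e1, h7]; omega) ?_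
      rw [if_neg t1, if_neg t2, if_pos (eq_neg_of_add_eq_zero_left t3)]
      simp [IExpr.eval, e1, h7, h8, hs']
    · refine WP.iset hf (by simp [IExpr.eval, e1, h7]; omega) ?_
      rw [if_neg t1, if_pos t2]
      simp [IExpr.eval, e1, h7, h8, hs']
    · refine WP.iset hf (by simp [IExpr.eval, e1, h7]; omega) ?_
      rw [if_pos t1]
      simp [IExpr.eval, e1, h7, h8, hs']

/-- The state of the selection after `i` rows. -/
structure SelectInv (e : ℕ → ℕ → ℚ) (n i : ℕ) (s : State n d) : Prop where
  le : s.imem 4 0 0 ≤ i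
  lt : ∀ k < s.imem 4 0 0, s.imem 3 0 k < i
  ok : ∀ k < s.imem 4 0 0, (signState (e (s.imem 3 0 k)) n).2.1 = 1
  inj : ∀ k < s.imem 4 0 0, ∀ k' < s.imem 4 0 0, (signState (e (s.imem 3 0 k)) n).2.2
    = (signState (e (s.imem 3 0 k')) n).2.2 → k = k'
  table : ∀ h, s.imem 5 0 h ≠ 0 ↔
    ∃ k < s.imem 4 0 0, (signState (e (s.imem 3 0 k)) n).2.2 = h
  cover : ∀ l < i, (signState (e l) n).2.1 = 1 →
    s.imem 5 0 (signState (e l) n).2.2 ≠ 0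

theorem selectRowCmd_wp {s : State n d} {i m : ℕ} (hbd : E.bd 1 ≤ E.bd 3)
    (hM : 3 ^ n ≤ E.M) (hnM : n ≤ E.M) (hmM : m ≤ E.M) (him : i < m) (hi : s.imem 20 0 0 = i)
    (hn : s.imem 0 0 0 = n) (h : SelectInv (s.qmem 1) n i s) :
    WP E selectRowCmd (n + 1) (SelectInv (s.qmem 1) n (i + 1)) s := by
  have hf : 1 ≤ n + 1 := by omega
  have hM1 : 1 ≤ E.M := (Nat.pos_of_ne_zero (pow_ne_zero n (by norm_num))).trans_le hM
  refine WP.seq (WP.iset hf (Nat.zero_le _) (WP.seq (WP.iset hf hM1 (WP.seq (WP.qset hf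
    (fun _ => by simpa [QExpr.eval, height_zero] using Nat.one_le_two_pow) ?_)))))
  simp only [IExpr.eval, QExpr.eval]
  set s₁ := ((s.setI 7 0 0 0).setI 8 0 0 1).setQ 3 0 0 0 with hs₁
  refine WP.seq' (R := fun s' => s'.imem 8 0 0 = (signState (s.qmem 1 i) n).2.1 ∧
      s'.imem 7 0 0 = (signState (s.qmem 1 i) n).2.2) ?_ ?_
  · refine WP.for (fb := 1) n (fun j s' => s'.qmem 3 0 0 = (signState (s.qmem 1 i) j).1 ∧
      s'.imem 8 0 0 = (signState (s.qmem 1 i) j).2.1 ∧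
      s'.imem 7 0 0 = (signState (s.qmem 1 i) j).2.2) (by omega) le_rfl (by simp [signCmd]) hnM
      (fun s' hF => ?_) (fun k s' v h => by simpa using h) (by simp [hs₁, signState]) ?_
      (fun s' h => h.2)
    · rw [IExpr.eval, hF.imem 0 (by simp [signCmd])]
      simp [IExpr.eval, hs₁, hn]
    · intro j hj s' hF hjc hI
      have e2 : s'.qmem 1 = s.qmem 1 := by
        rw [hF.qmem 1 (by simp [signCmd])]
        funext a b; simp [hs₁]
      have e3 : s'.imem 20 0 0 = i := by
        rw [hF.imem 20 (by simp [signCmd])]; simp [hs₁, hi]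
      have := signCmd_wp (E := E) (s := s') (f := 1) le_rfl hbd
        ((Nat.pow_le_pow_right (by norm_num) hj).trans hM) e3 hjc (by rw [e2]; exact hI)
      rwa [e2] at this
  · rintro s' hF ⟨h8, h7⟩
    have e3 : s'.imem 3 = s.imem 3 := by
      rw [hF.imem 3 (by simp [signCmd])]; funext a b; simp [hs₁]
    have e4 : s'.imem 4 0 0 = s.imem 4 0 0 := by
      rw [hF.imem 4 (by simp [signCmd])]; simp [hs₁]
    have e5 : s'.imem 5 = s.imem 5 := by
      rw [hF.imem 5 (by simp [signCmd])]; funext a b; simp [hs₁]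
    have e20 : s'.imem 20 0 0 = i := by
      rw [hF.imem 20 (by simp [signCmd])]; simp [hs₁, hi]
    -- A row without a sign pattern, or with one already in the table, leaves the selection as it
    -- is.
    have keep : ∀ s'' : State n d, s''.imem 3 = s.imem 3 → s''.imem 4 0 0 = s.imem 4 0 0 →
        s''.imem 5 = s.imem 5 → ((signState (s.qmem 1 i) n).2.1 = 1 →
          s.imem 5 0 (signState (s.qmem 1 i) n).2.2 ≠ 0) → SelectInv (s.qmem 1) n (i + 1) s'' := by
      intro s'' h3 h4 h5 hc
      refine ⟨by rw [h4]; exact h.le.trans (Nat.le_succ _), ?_, ?_, ?_, ?_, ?_⟩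
      · rw [h4, h3]; exact fun k hk => (h.lt k hk).trans (Nat.lt_succ_self _)
      · rw [h4, h3]; exact h.ok
      · rw [h4, h3]; exact h.inj
      · rw [h4, h3, h5]; exact h.table
      · rw [h5]
        intro l hl hok
        rcases Nat.lt_succ_iff_lt_or_eq.1 hl with h' | rfl
        · exact h.cover l h' hok
        · exact hc hok
    refine WP.ite hf (fun t1 => WP.ite hf (fun t2 => ?_) fun t2 => ?_) fun t1 => ?_
    all_goals
      simp only [Test.holds, IExpr.eval, h8] at t1
    · simp only [Test.holds, IExpr.eval, h7, e5] at t2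
      refine WP.seq (WP.iset hf hM1 (WP.seq (WP.iset hf ?_ (WP.iset hf ?_ ?_))))
      · simp [IExpr.eval, e20]; omega
      · have := h.le
        simp [IExpr.eval, e4]; omega
      have hok : (signState (s.qmem 1 i) n).2.1 = 1 := by
        have := signState_ok_le (s.qmem 1 i) n; omega
      have hz : s.imem 5 0 (signState (s.qmem 1 i) n).2.2 = 0 := by omega
      have hnew : ∀ k < s.imem 4 0 0, (signState (s.qmem 1 (s.imem 3 0 k)) n).2.2
          ≠ (signState (s.qmem 1 i) n).2.2 := fun k hk he =>
        (h.table _).2 ⟨k, hk, he⟩ hz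
      simp only [IExpr.eval, e20, h7, State.setI_imem, e4]
      set s₃ := State.setI _ 4 _ _ _ with hs₃
      have f4 : s₃.imem 4 0 0 = s.imem 4 0 0 + 1 := by simp [hs₃]
      have f3 : ∀ k, s₃.imem 3 0 k = if k = s.imem 4 0 0 then i else s.imem 3 0 k := fun k => by
        simp [hs₃, e4, e3]
      have f5 : ∀ k, s₃.imem 5 0 k = if k = (signState (s.qmem 1 i) n).2.2 then 1
          else s.imem 5 0 k := fun k => by simp [hs₃, e5]
      have f3' : ∀ k < s.imem 4 0 0, s₃.imem 3 0 k = s.imem 3 0 k := fun k hk => by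
        rw [f3, if_neg hk.ne]
      have f3'' : s₃.imem 3 0 (s.imem 4 0 0) = i := by rw [f3, if_pos rfl]
      refine ⟨by rw [f4]; have := h.le; omega, ?_, ?_, ?_, ?_, ?_⟩
      · rw [f4]
        intro k hk
        rcases Nat.lt_succ_iff_lt_or_eq.1 hk with h' | rfl
        · rw [f3' k h']; exact (h.lt k h').trans (Nat.lt_succ_self _)
        · rw [f3'']; exact Nat.lt_succ_self _
      · rw [f4]
        intro k hk
        rcases Nat.lt_succ_iff_lt_or_eq.1 hk with h' | rfl
        · rw [f3' k h']; exact h.ok k h'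
        · rw [f3'']; exact hok
      · rw [f4]
        intro k hk k' hk'
        rcases Nat.lt_succ_iff_lt_or_eq.1 hk with h' | rfl <;>
          rcases Nat.lt_succ_iff_lt_or_eq.1 hk' with h'' | rfl
        · rw [f3' k h', f3' k' h'']; exact h.inj k h' k' h''
        · rw [f3' k h', f3'']; exact fun he => absurd he (hnew k h')
        · rw [f3' k' h'', f3'']; exact fun he => absurd he.symm (hnew k' h'')
        · exact fun _ => rfl
      · intro q
        rw [f4, f5]
        constructor
        · intro hq
          split_ifs at hq with hqi
          · exact ⟨_, Nat.lt_succ_self _, by rw [f3'', hqi]⟩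
          · obtain ⟨k, hk, he⟩ := (h.table q).1 hq
            exact ⟨k, hk.trans (Nat.lt_succ_self _), by rw [f3' k hk, he]⟩
        · rintro ⟨k, hk, he⟩
          split_ifs with hqi
          · exact one_ne_zero
          · rcases Nat.lt_succ_iff_lt_or_eq.1 hk with h' | rfl
            · rw [f3' k h'] at he
              exact (h.table q).2 ⟨k, h', he⟩
            · rw [f3''] at he
              exact absurd he.symm hqi
      · intro l hl hlok
        rw [f5]
        split_ifs with hqi
        · exact one_ne_zero
        · rcases Nat.lt_succ_iff_lt_or_eq.1 hl with h' | rfl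
          · exact h.cover l h' hlok
          · exact absurd rfl hqi
    · simp only [Test.holds, IExpr.eval, h7, e5] at t2
      exact WP.skip (keep s' e3 e4 e5 fun _ => by omega)
    · exact WP.skip (keep s' e3 e4 e5 fun hok => by omega)

theorem selectCmd_wp {s : State n d} {m : ℕ} (hbd : E.bd 1 ≤ E.bd 3)
    (hM : 3 ^ n ≤ E.M) (hnM : n ≤ E.M) (hmM : m ≤ E.M)
    (hn : s.imem 0 0 0 = n) (hm : s.imem 1 0 0 = m) (h5 : ∀ h, s.imem 5 0 h = 0) :
    WP E selectCmd ((m + 1) * (n + 1))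
      (fun s' => Selected (s.qmem 1) n m (s'.imem 4 0 0) (s'.imem 3 0)) s := by
  have hf : 1 ≤ (m + 1) * (n + 1) := Nat.mul_pos (by omega) (by omega)
  have hM1 : 1 ≤ E.M := (Nat.pos_of_ne_zero (pow_ne_zero n (by norm_num))).trans_le hM
  refine WP.seq (WP.iset hf hM1 ?_)
  simp only [IExpr.eval]
  set s₁ := s.setI 6 0 0 1 with hs₁
  refine WP.seq' (R := fun s' => s'.imem 6 0 0 = 3 ^ n) ?_ ?_
  · refine WP.for (fb := 1) n (fun j s' => s'.imem 6 0 0 = 3 ^ j) ?_ le_rfl (by simp) hnM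
      (fun s' hF => ?_) (fun k s' v h => by simpa using h) (by simp [hs₁]) ?_ (fun s' h => h)
    · nlinarith
    · rw [IExpr.eval, hF.imem 0 (by simp)]
      simp [IExpr.eval, hs₁, hn]
    · intro j hj s' hF hjc hI
      have : 3 ^ j * 3 ≤ 3 ^ n := by
        rw [← pow_succ]; exact Nat.pow_le_pow_right (by norm_num) hj
      refine WP.iset le_rfl ?_ ?_
      · simp only [IExpr.eval, hI]; omega
      · simp [IExpr.eval, hI, pow_succ]
  intro s₂ hF h6
  have e1 : s₂.imem 1 0 0 = m := by rw [hF.imem 1 (by simp)]; simp [hs₁, hm]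
  have e0 : s₂.imem 0 0 0 = n := by rw [hF.imem 0 (by simp)]; simp [hs₁, hn]
  have e5 : ∀ h, s₂.imem 5 0 h = 0 := fun h => by rw [hF.imem 5 (by simp)]; simp [hs₁, h5]
  have q1 : s₂.qmem 1 = s.qmem 1 := by rw [hF.qmem 1 (by simp)]; rfl
  refine WP.ite hf (fun ht => ?_) fun ht => ?_ <;>
    simp only [Test.holds, IExpr.eval, h6, e1] at ht
  · refine WP.seq (WP.iset hf (Nat.zero_le _) ?_)
    simp only [IExpr.eval]
    set s₃ := s₂.setI 4 0 0 0 with hs₃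
    refine WP.for (fb := n + 1) m (fun i s' => SelectInv (s.qmem 1) n i s') le_rfl (by omega)
      (by simp [selectRowCmd, signCmd]) hmM (fun s' hF => ?_) (fun k s' v h => ?_) ?_ ?_ ?_
    · rw [IExpr.eval, hF.imem 1 (by simp [selectRowCmd, signCmd])]
      simp [IExpr.eval, hs₃, e1]
    · obtain ⟨a1, a2, a3, a4, a5, a6⟩ := h
      exact ⟨by simpa using a1, by simpa using a2, by simpa using a3, by simpa using a4,
        by simpa using a5, by simpa using a6⟩
    · have z4 : s₃.imem 4 0 0 = 0 := by simp [hs₃]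
      refine ⟨by omega, by rw [z4]; simp, by rw [z4]; simp, by rw [z4]; simp, fun h => ?_,
        by simp⟩
      rw [z4]; simp [hs₃, e5]
    · intro i hi s' hF' hic hI
      have e2 : s'.qmem 1 = s.qmem 1 := by
        rw [hF'.qmem 1 (by simp [selectRowCmd, signCmd]), ← q1]; rfl
      have := selectRowCmd_wp (E := E) hbd hM hnM hmM hi hic (by
        rw [hF'.imem 0 (by simp [selectRowCmd, signCmd])]; simp [hs₃, e0]) (by rw [e2]; exact hI)
      rwa [e2] at this
    · intro s' h
      refine ⟨h.le, ?_, h.lt, fun h' => by omega, fun _ i hi hok => ?_⟩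
      · have := Finset.card_le_card_of_injOn (s := range (s'.imem 4 0 0)) (t := range (3 ^ n))
          (fun k => (signState (s.qmem 1 (s'.imem 3 0 k)) n).2.2)
          (fun k _ => mem_coe.2 (mem_range.2 (signState_lt _ _)))
          (fun k hk k' hk' he => h.inj k (mem_range.1 hk) k' (mem_range.1 hk') he)
        simpa using this
      · obtain ⟨k, hk, he⟩ := (h.table _).1 (h.cover i hi hok)
        exact ⟨k, hk, h.ok k hk, he⟩
  · refine WP.seq (WP.iset hf (by simpa [IExpr.eval, e1] using hmM) ?_)
    simp only [IExpr.eval, e1]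
    set s₃ := s₂.setI 4 0 0 m with hs₃
    refine WP.for (fb := 1) m (fun i s' => s'.imem 4 0 0 = m ∧ ∀ k < i, s'.imem 3 0 k = k) ?_
      le_rfl (by simp) hmM (fun s' hF => ?_) (fun k s' v h => by simpa using h)
      (by simp [hs₃]) ?_ ?_
    · nlinarith
    · rw [IExpr.eval, hF.imem 1 (by simp)]
      simp [IExpr.eval, hs₃, e1]
    · intro i hi s' hF' hic hI
      refine WP.iset le_rfl (by simp [IExpr.eval, hic]; omega) ?_
      refine ⟨by simp [hI.1], fun k hk => ?_⟩
      simp only [IExpr.eval, hic, State.setI_imem]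
      split_ifs with h
      · exact h.2.2.symm
      · exact hI.2 k (by
          have : k ≠ i := fun e => h ⟨trivial, trivial, e⟩
          omega)
    · rintro s' ⟨h4, h3⟩
      exact ⟨h4.le, by omega, fun k hk => by rw [h3 k (h4 ▸ hk)]; exact h4 ▸ hk,
        fun _ => ⟨h4, fun k hk => h3 k (h4 ▸ hk)⟩, fun h => by omega⟩

end ConvexOpt

namespace ConvexOpt

open Finset

variable {n d : ℕ} {E : Env n d}

/-! ### The vectors of the zonotope -/

def rowSign (i : ℕ) : ℚ := if i % 2 = 0 then 1 else -1

/-- The array `2` holds the unit vectors, the vectors `v i` for `i < k`, the first `l` entries of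
`v k`, and the negatives of all these. -/
def RowsInv (v : ℕ → ℕ → ℚ) (k l₀ : ℕ) (s : State n d) : Prop :=
  ∀ i l, s.qmem 2 i l = if i / 2 < d then (if l = i / 2 then rowSign i else 0)
    else if (i / 2 - d < k ∧ l < d) ∨ (i / 2 - d = k ∧ l < l₀) then rowSign i * v (i / 2 - d) l
    else 0

def unitsCmd (d : ℕ) : Cmd :=
  .for 20 (.const d) (.seq (.qset 2 (.mul (.const 2) (.var 20)) (.var 20) (.const 1))
    (.qset 2 (.add (.mul (.const 2) (.var 20)) (.const 1)) (.var 20) (.const (-1))))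

theorem unitsCmd_wp {s : State n d} (v : ℕ → ℕ → ℚ) (hbd : 1 ≤ E.bd 2) (hM : d ≤ E.M)
    (h : s.qmem 2 = 0) : WP E (unitsCmd d) (d + 1) (RowsInv v 0 0) s := by
  refine WP.for (fb := 1) d (fun k s' => ∀ i l, s'.qmem 2 i l =
    if i / 2 < k then (if l = i / 2 then rowSign i else 0) else 0) (by omega) le_rfl (by simp) hM
    (fun _ _ => rfl) (fun k s' a h => by simpa using h) (by simp [h]) ?_ ?_
  · intro k hk s' hF hkc hI
    have hb : 2 ≤ 2 ^ E.bd 2 := by simpa using Nat.pow_le_pow_right (show 0 < 2 by norm_num) hbd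
    refine WP.seq (WP.qset le_rfl (fun _ => hb) (WP.qset le_rfl (fun _ => hb) ?_))
    intro i l
    simp only [IExpr.eval, QExpr.eval, State.setQ_qmem, State.setQ_imem, hkc, hI, true_and]
    by_cases h1 : i = 2 * k + 1
    · have e1 : i / 2 = k := by omega
      have e2 : i % 2 ≠ 0 := by omega
      have e3 : i ≠ 2 * k := by omega
      rw [e1, rowSign, if_neg e2]
      simp [h1]
    by_cases h2 : i = 2 * k
    · simp [rowSign, h2]
    have e : i / 2 < k + 1 ↔ i / 2 < k := by omega
    simp [h1, h2, e]
  · intro s' h i l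
    rw [h]
    simp

/-- The rows `v i`, for the selected vectors. -/
def rowsCmd (d : ℕ) : Cmd :=
  .for 20 (.var 4) (.for 22 (.const d)
    (.seq (.qassign 3 (.const 0))
    (.seq (.for 21 (.var 0) (.qassign 3 (.add (.var 3)
      (.mul (.get 1 (.get 3 (.const 0) (.var 20)) (.var 21)) (.get 0 (.var 21) (.var 22))))))
    (.seq (.qset 2 (.mul (.const 2) (.add (.const d) (.var 20))) (.var 22) (.var 3))
      (.qset 2 (.add (.mul (.const 2) (.add (.const d) (.var 20))) (.const 1)) (.var 22)
        (.sub (.const 0) (.var 3)))))))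

/-- The accumulator passes through all partial sums of the product, so `hX` bounds the height of
each prefix and not only of the final entry. -/
theorem rowsCmd_wp {s : State n d} {M : ℕ} (hbd : E.bd 2 = E.bd 3) (hM : M ≤ E.M)
    (hnM : n ≤ E.M) (hdM : d ≤ E.M) (h0 : s.imem 0 0 0 = n) (h4 : s.imem 4 0 0 = M)
    {v : ℕ → ℕ → ℚ}
    (hv : v = fun i l => ∑ t ∈ range n, s.qmem 1 (s.imem 3 0 i) t * s.qmem 0 t l)
    (hX : ∀ i < M, ∀ l < d, ∀ j ≤ n, height (∑ t ∈ range j, s.qmem 1 (s.imem 3 0 i) t * s.qmem 0 t l)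
      ≤ 2 ^ E.bd 3)
    (h : RowsInv v 0 0 s) :
    WP E (rowsCmd d) ((M + 1) * ((d + 1) * (n + 1))) (RowsInv v M 0) s := by
  have hf : 1 ≤ n + 1 := by omega
  refine WP.for (fb := (d + 1) * (n + 1)) M (fun k s' => RowsInv v k 0 s') le_rfl
    (Nat.mul_pos (by omega) hf) (by simp) hM (fun s' hF => ?_) (fun k s' a h => by
      intro i l; simpa using h i l) h ?_ (fun _ h => h)
  · rw [IExpr.eval, hF.imem 4 (by simp)]; simp [IExpr.eval, h4]
  intro k hk s₁ hF₁ hk₁ hI₁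
  refine WP.for (fb := n + 1) d (fun l s' => RowsInv v k l s') le_rfl hf (by simp) hdM
    (fun _ _ => rfl) (fun l s' a h => by intro i l; simpa using h i l) hI₁ ?_ ?_
  · intro l hl s₂ hF₂ hl₂ hI₂
    have i0 : s₂.imem 0 = s.imem 0 := by rw [hF₂.imem 0 (by simp), hF₁.imem 0 (by simp)]
    have i3 : s₂.imem 3 = s.imem 3 := by rw [hF₂.imem 3 (by simp), hF₁.imem 3 (by simp)]
    have i20 : s₂.imem 20 0 0 = k := by rw [hF₂.imem 20 (by simp), hk₁]
    have q0 : s₂.qmem 0 = s.qmem 0 := by rw [hF₂.qmem 0 (by simp), hF₁.qmem 0 (by simp)]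
    have q1 : s₂.qmem 1 = s.qmem 1 := by rw [hF₂.qmem 1 (by simp), hF₁.qmem 1 (by simp)]
    refine WP.seq (WP.qset hf (fun _ => Nat.one_le_two_pow) ?_)
    simp only [IExpr.eval, QExpr.eval]
    refine WP.seq' (R := fun s' => s'.qmem 3 0 0 = v k l) ?_ ?_
    · refine WP.for (fb := 1) n (fun j s' => s'.qmem 3 0 0
        = ∑ t ∈ range j, s.qmem 1 (s.imem 3 0 k) t * s.qmem 0 t l) (by omega) le_rfl (by simp) hnM
        (fun s' hF => ?_) (fun j s' a h => by simpa using h) (by simp) ?_ ?_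
      · rw [IExpr.eval, hF.imem 0 (by simp)]; simp [IExpr.eval, i0, h0]
      · intro j hj s₃ hF₃ hj₃ hI₃
        have j3 : s₃.imem 3 = s.imem 3 := by rw [hF₃.imem 3 (by simp), ← i3]; rfl
        have j20 : s₃.imem 20 0 0 = k := by rw [hF₃.imem 20 (by simp)]; simpa using i20
        have j22 : s₃.imem 22 0 0 = l := by rw [hF₃.imem 22 (by simp)]; simpa using hl₂
        have r0 : s₃.qmem 0 = s.qmem 0 := by
          rw [hF₃.qmem 0 (by simp), ← q0]; funext a b; simp
        have r1 : s₃.qmem 1 = s.qmem 1 := by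
          rw [hF₃.qmem 1 (by simp), ← q1]; funext a b; simp
        have e : QExpr.eval s₃ (.add (.var 3) (.mul (.get 1 (.get 3 (.const 0) (.var 20)) (.var 21))
            (.get 0 (.var 21) (.var 22))))
            = ∑ t ∈ range (j + 1), s.qmem 1 (s.imem 3 0 k) t * s.qmem 0 t l := by
          simp only [QExpr.eval, IExpr.eval, hI₃, j3, j20, j22, hj₃, r0, r1]
          rw [Finset.sum_range_succ]
        refine WP.qset le_rfl (fun _ => ?_) ?_
        · rw [e]; exact hX k hk l hl (j + 1) hj
        · rw [e]; simp [IExpr.eval]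
      · intro s' h
        rw [h, hv]
    · intro s₃ hF₃ h3
      have j20 : s₃.imem 20 0 0 = k := by rw [hF₃.imem 20 (by simp)]; simpa using i20
      have j22 : s₃.imem 22 0 0 = l := by rw [hF₃.imem 22 (by simp)]; simpa using hl₂
      have r2 : s₃.qmem 2 = s₂.qmem 2 := by
        rw [hF₃.qmem 2 (by simp)]; funext a b; simp
      refine WP.seq (WP.qset hf (fun hs => hbd ▸ hs.qmem _ _ _) (WP.qset hf (fun hs => ?_) ?_))
      · have := hs.qmem 3 0 0
        simp only [QExpr.eval, IExpr.eval, zero_sub, height_neg]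
        rwa [hbd]
      intro i l'
      simp only [IExpr.eval, QExpr.eval, State.setQ_qmem, State.setQ_imem, j20, j22, h3, true_and,
        r2]
      rw [hI₂ i l']
      by_cases h1 : i = 2 * (d + k) + 1
      · have e1 : i / 2 = d + k := by omega
        have e2 : i % 2 ≠ 0 := by omega
        have e3 : i ≠ 2 * (d + k) := by omega
        rcases lt_trichotomy l' l with h | h | h
        · simp [h.ne, h, e1, show l' < l + 1 by omega]
        · simp [h1, h, rowSign, show (2 * (d + k) + 1) / 2 = d + k by omega]
        · simp [h.ne', e1, show ¬ l' < l + 1 by omega, show ¬ l' < l by omega]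
      by_cases h2 : i = 2 * (d + k)
      · have e1 : i / 2 = d + k := by omega
        have e2 : i % 2 = 0 := by omega
        rcases lt_trichotomy l' l with h | h | h
        · simp [h.ne, h, e1, show l' < l + 1 by omega]
        · simp [h2, h, rowSign]
        · simp [h.ne', e1, show ¬ l' < l + 1 by omega, show ¬ l' < l by omega]
      by_cases hd : i / 2 < d
      · simp [h1, h2, hd]
      have e : i / 2 - d ≠ k := by omega
      simp [h1, h2, e]
  · intro s' h i l
    rw [h i l]
    congr 2
    rw [eq_iff_iff]
    simp only [Nat.not_lt_zero, and_false, or_false]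
    constructor
    · rintro (h | h)
      · exact ⟨by omega, h.2⟩
      · exact ⟨by omega, h.2⟩
    · rintro ⟨h, h'⟩
      rcases Nat.lt_succ_iff_lt_or_eq.1 h with h | h
      · exact Or.inl ⟨h, h'⟩
      · exact Or.inr ⟨h, h'⟩

theorem RowsInv.row_eq {v : ℕ → ℕ → ℚ} {M : ℕ} {s : State n d} (h : RowsInv v M 0 s) {i : ℕ}
    (hi : i < 2 * (d + M)) : s.row d 2 i = symRows d (fun k l => v k l) i := by
  funext l
  rw [State.row, h i l, symRows, Pi.smul_apply, smul_eq_mul, ← rowSign]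
  by_cases hd : i / 2 < d
  · rw [if_pos hd, dif_pos hd, Pi.single_apply]
    by_cases hl : (l : ℕ) = i / 2
    · rw [if_pos hl, if_pos (Fin.ext hl), mul_one]
    · rw [if_neg hl, if_neg fun e => hl (congrArg Fin.val e), mul_zero]
  · rw [if_neg hd, dif_neg hd, if_pos (Or.inl ⟨by omega, l.2⟩)]

/-- The number of rows, and the largest entry, or `1`. -/
def maxCmd (d : ℕ) : Cmd :=
  .seq (.iassign 9 (.mul (.const 2) (.add (.const d) (.var 4))))
  (.seq (.qassign 4 (.const 1))
  (.for 20 (.var 9) (.for 22 (.const d) (.ite (.qlt (.var 4) (.get 2 (.var 20) (.var 22)))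
    (.qassign 4 (.get 2 (.var 20) (.var 22))) .skip))))

/-- No absolute values are needed: the rows are symmetric, so the largest entry bounds all entries
in absolute value. -/
theorem maxCmd_wp {s : State n d} {M : ℕ} (hbd : E.bd 2 ≤ E.bd 4) (hbd4 : 1 ≤ E.bd 4)
    (hM : 2 * (d + M) ≤ E.M) (h4 : s.imem 4 0 0 = M) :
    WP E (maxCmd d) ((2 * (d + M) + 1) * (d + 1)) (fun s' => s'.imem 9 0 0 = 2 * (d + M) ∧
      1 ≤ s'.qmem 4 0 0 ∧ ∀ i < 2 * (d + M), ∀ l < d, s.qmem 2 i l ≤ s'.qmem 4 0 0) s := by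
  have hf : 1 ≤ (2 * (d + M) + 1) * (d + 1) := Nat.mul_pos (by omega) (by omega)
  refine WP.seq (WP.iset hf (by simpa [IExpr.eval, h4] using hM) (WP.seq (WP.qset hf (fun _ =>
    (show 2 ≤ 2 ^ E.bd 4 by simpa using Nat.pow_le_pow_right (show 0 < 2 by norm_num) hbd4)) ?_)))
  simp only [IExpr.eval, QExpr.eval, h4]
  refine WP.for (fb := d + 1) (2 * (d + M)) (fun k s' => s'.imem 9 0 0 = 2 * (d + M) ∧
      1 ≤ s'.qmem 4 0 0 ∧ ∀ i < k, ∀ l < d, s.qmem 2 i l ≤ s'.qmem 4 0 0) le_rfl (by omega)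
      (by simp) hM (fun s' hF => ?_) (fun k s' a h => by simpa using h) (by simp) ?_ (fun _ h => h)
  · rw [IExpr.eval, hF.imem 9 (by simp)]; simp [IExpr.eval]
  rintro k hk s₁ hF₁ hk₁ ⟨h9, h1, hI⟩
  refine WP.for (fb := 1) d (fun l₀ s' => s'.imem 9 0 0 = 2 * (d + M) ∧ 1 ≤ s'.qmem 4 0 0 ∧
    (∀ i < k, ∀ l < d, s.qmem 2 i l ≤ s'.qmem 4 0 0) ∧
      ∀ l < l₀, s.qmem 2 k l ≤ s'.qmem 4 0 0) (by omega) le_rfl (by simp) (by omega)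
    (fun _ _ => rfl) (fun l s' a h => by simpa using h) ⟨h9, h1, hI, by simp⟩ ?_ ?_
  · rintro l hl s₂ hF₂ hl₂ ⟨h9, h1, hI, hI'⟩
    have i20 : s₂.imem 20 0 0 = k := by rw [hF₂.imem 20 (by simp), hk₁]
    have q2 : s₂.qmem 2 = s.qmem 2 := by
      rw [hF₂.qmem 2 (by simp), hF₁.qmem 2 (by simp)]; funext a b; simp
    refine WP.ite le_rfl (fun ht => WP.qset le_rfl (fun hs => ?_) ?_) fun ht => WP.skip ?_ <;>
      simp only [Test.holds, QExpr.eval, IExpr.eval, i20, hl₂, q2] at ht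
    · exact (hs.qmem _ _ _).trans (Nat.pow_le_pow_right (by norm_num) hbd)
    · simp only [QExpr.eval, IExpr.eval, i20, hl₂, q2, State.setQ_qmem, State.setQ_imem, and_self,
        if_true]
      refine ⟨h9, h1.trans ht.le, fun i hi l' hl' => (hI i hi l' hl').trans ht.le,
        fun l' hl' => ?_⟩
      rcases Nat.lt_succ_iff_lt_or_eq.1 hl' with h | rfl
      · exact (hI' l' h).trans ht.le
      · exact le_rfl
    · refine ⟨h9, h1, hI, fun l' hl' => ?_⟩
      rcases Nat.lt_succ_iff_lt_or_eq.1 hl' with h | rfl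
      · exact hI' l' h
      · exact not_lt.1 ht
  · rintro s' ⟨h9, h1, hI, hI'⟩
    refine ⟨h9, h1, fun i hi l hl => ?_⟩
    rcases Nat.lt_succ_iff_lt_or_eq.1 hi with h | rfl
    · exact hI i h l hl
    · exact hI' l hl

end ConvexOpt

namespace ConvexOpt

open Finset

variable {n d : ℕ} {E : Env n d}

/-! ### Powers of two -/

/-- The powers of two up to the first that is at least the number of rows. -/
def powersCmd : Cmd :=
  .seq (.iassign 11 (.const 0)) (.seq (.iset 12 (.const 0) (.const 0) (.const 1))
  (.seq (.for 20 (.var 9) (.ite (.ilt (.get 12 (.const 0) (.var 11)) (.var 9))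
    (.seq (.iset 12 (.const 0) (.add (.var 11) (.const 1))
        (.mul (.const 2) (.get 12 (.const 0) (.var 11))))
      (.iassign 11 (.add (.var 11) (.const 1)))) .skip))
  (.iassign 10 (.get 12 (.const 0) (.var 11)))))

/-- `2 ^ k` is the first power of two that is at least `N`. -/
structure Powers (N k : ℕ) (s : State n d) : Prop where
  exponent : s.imem 11 0 0 = k
  power : s.imem 10 0 0 = 2 ^ k
  table : ∀ j ≤ k, s.imem 12 0 j = 2 ^ j
  le : N ≤ 2 ^ k
  ge : 2 ^ k ≤ 2 * N

/-- The powers serve as run lengths and numbers of runs for merging from the bottom up; a table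
replaces the index division that the machine does not offer. -/
theorem powersCmd_wp {s : State n d} {N : ℕ} (hN : 1 ≤ N) (hM : 2 * N ≤ E.M)
    (h9 : s.imem 9 0 0 = N) : WP E powersCmd (N + 1) (fun s' => ∃ k, Powers N k s') s := by
  have hf : 1 ≤ N + 1 := by omega
  refine WP.seq (WP.iset hf (Nat.zero_le _) (WP.seq (WP.iset hf (show 1 ≤ E.M by omega) ?_)))
  simp only [IExpr.eval]
  refine WP.seq' (R := fun s' => ∃ k, s'.imem 11 0 0 = k ∧ (∀ j ≤ k, s'.imem 12 0 j = 2 ^ j) ∧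
    N ≤ 2 ^ k ∧ 2 ^ k ≤ 2 * N) ?_ ?_
  · refine WP.for (fb := 1) N (fun t s' => ∃ k, s'.imem 11 0 0 = k ∧
      (∀ j ≤ k, s'.imem 12 0 j = 2 ^ j) ∧ (N ≤ 2 ^ k ∨ k = t) ∧ 2 ^ k ≤ 2 * N) (by omega) le_rfl
      (by simp) (by omega) (fun s' hF => ?_) (fun k s' a h => by simpa using h) ?_ ?_ ?_
    · rw [IExpr.eval, hF.imem 9 (by simp)]; simp [IExpr.eval, h9]
    · exact ⟨0, by simp, by simp, Or.inr rfl, by omega⟩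
    · rintro t ht s' hF - ⟨k, h1, h2, h3, h4⟩
      have h9' : s'.imem 9 0 0 = N := by rw [hF.imem 9 (by simp)]; simp [h9]
      refine WP.ite le_rfl (fun hlt => ?_) fun hlt => WP.skip ?_ <;>
        simp only [Test.holds, IExpr.eval, h1, h9', h2 k le_rfl] at hlt
      · have hpow : 2 ^ (k + 1) = 2 * 2 ^ k := by ring
        have hk : k < 2 ^ k := Nat.lt_two_pow_self
        refine WP.seq (WP.iset le_rfl ?_ (WP.iset le_rfl ?_ ?_))
        · simp only [IExpr.eval, h1, h2 k le_rfl]; omega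
        · simp [IExpr.eval, h1]; omega
        · simp only [IExpr.eval, h1, h2 k le_rfl]
          refine ⟨k + 1, by simp [h1], fun j hj => ?_, ?_, by omega⟩
          · rcases Nat.lt_or_eq_of_le hj with h | rfl
            · have := h2 j (by omega)
              simpa [show j ≠ k + 1 by omega] using this
            · simp [hpow]
          · rcases h3 with h3 | h3
            · omega
            · exact Or.inr (by omega)
      · exact ⟨k, h1, h2, Or.inl (not_lt.1 hlt), h4⟩
    · rintro s' ⟨k, h1, h2, h3, h4⟩
      -- If the target was never met, the exponent grew in each of the `N` passes, and `N < 2 ^ N`.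
      refine ⟨k, h1, h2, h3.elim id fun h => ?_, h4⟩
      rw [h]; exact Nat.lt_two_pow_self.le
  · rintro s' - ⟨k, h1, h2, h3, h4⟩
    refine WP.iset hf ?_ ?_
    · simp only [IExpr.eval, h1, h2 k le_rfl]; omega
    · exact ⟨k, by simp [h1], by simp [IExpr.eval, h1, h2 k le_rfl],
        fun j hj => by simp [h2 j hj], h3, h4⟩

/-! ### Slopes -/

/-- The determinant of the rows given by `t`. -/
def tupleE (d : ℕ) (t : Fin d → IExpr) : QExpr := detE d fun k l => .get 2 (t k) (.const l)

theorem tupleE_eval (s : State n d) (t : Fin d → IExpr) :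
    (tupleE d t).eval s = tupleDet (s.row d 2) fun k => (t k).eval s := by
  rw [tupleE, detE_eval]
  rfl

theorem tupleE_reads {t : Fin d → IExpr} {a : ℕ} (h : (tupleE d t).Reads a) : a = 2 := by
  obtain ⟨_, _, h⟩ := detE_reads h
  exact h

/-- The tuple in the counters of the nested loops. -/
def counters (d : ℕ) (k : Fin d) : IExpr := .var (100 + k)

theorem update_counters_eval {s : State n d} {t : Fin d → ℕ}
    (ht : ∀ k : Fin d, s.imem (100 + k) 0 0 = t k) (a : Fin d) (c : ℕ) :
    (fun k => (Function.update (counters d) a (.var c) k).eval s)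
      = Function.update t a (s.imem c 0 0) := by
  funext k
  by_cases hk : k = a
  · subst hk; simp [IExpr.eval]
  · simp [hk, counters, IExpr.eval, ht]

/-- The slope for the row `21`, and the resulting bound for the minors. -/
def slopeCmd (d : ℕ) (a b : Fin d) : Cmd :=
  .seq (.qassign 15 (tupleE d (Function.update (counters d) a (.var 21))))
  (.seq (.qset 5 (.const 0) (.var 21)
    (.div (tupleE d (Function.update (counters d) b (.var 21))) (.var 15)))
  (.seq (.ite (.qlt (.var 15) (.const 0)) (.qassign 15 (.sub (.const 0) (.var 15))) .skip)
    (.ite (.qlt (.const 0) (.var 15))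
      (.ite (.qlt (.var 15) (.var 8)) (.qassign 8 (.var 15)) .skip) .skip)))

/-- The second loop pads the list of slopes to a power of two with copies of the first one, so that
no foreign values enter the gaps. -/
def slopesCmd (d : ℕ) (a b : Fin d) : Cmd :=
  .seq (.for 21 (.var 9) (slopeCmd d a b))
    (.for 21 (.var 10) (.ite (.ilt (.var 21) (.var 9)) .skip
      (.qset 5 (.const 0) (.var 21) (.get 5 (.const 0) (.const 0)))))

/-- The slope of the row `j`. -/
def slope (r : ℕ → Fin d → ℚ) (a b : Fin d) (t : Fin d → ℕ) (j : ℕ) : ℚ :=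
  tupleDet r (Function.update t b j) / tupleDet r (Function.update t a j)

/-- `μ` is a positive lower bound for the nonzero minors with the rows `j < N`. -/
def MinorBound (r : ℕ → Fin d → ℚ) (a : Fin d) (t : Fin d → ℕ) (N : ℕ) (μ : ℚ) : Prop :=
  ∀ j < N, tupleDet r (Function.update t a j) ≠ 0 → μ ≤ |tupleDet r (Function.update t a j)|

/-- Exponents for the arrays of the search for the bounds. -/
structure SlopeBounds (E : Env n d) (a b : Fin d) (X K : ℕ) : Prop where
  one_le : 1 ≤ X
  two_le : 2 ≤ K
  det_le : (tupleE d (Function.update (counters d) a (.var 21))).cst ≤ K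
  slope_le : (QExpr.div (tupleE d (Function.update (counters d) b (.var 21))) (.var 15)).cst ≤ K
  bd2 : E.bd 2 ≤ X
  bd5 : E.bd 5 = K ^ 2 * X
  bd6 : E.bd 6 = K ^ 2 * X
  bd7 : E.bd 7 = K ^ 3 * X
  bd8 : E.bd 8 = K ^ 2 * X
  bd15 : E.bd 15 = K * X

theorem slopeCmd_wp {s : State n d} {a b : Fin d} {X K j : ℕ} {t : Fin d → ℕ}
    (hE : SlopeBounds E a b X K)
    (ht : ∀ k : Fin d, s.imem (100 + k) 0 0 = t k) (hj : s.imem 21 0 0 = j)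
    (hμ : 0 < s.qmem 8 0 0) (h : MinorBound (s.row d 2) a t j (s.qmem 8 0 0)) :
    WP E (slopeCmd d a b) 1 (fun s' => (∀ i, s'.qmem 5 0 i = if i = j then
        slope (s.row d 2) a b t j else s.qmem 5 0 i) ∧
      0 < s'.qmem 8 0 0 ∧ s'.qmem 8 0 0 ≤ s.qmem 8 0 0 ∧
      MinorBound (s.row d 2) a t (j + 1) (s'.qmem 8 0 0)) s := by
  set D := tupleDet (s.row d 2) (Function.update t a j) with hD
  have hK : 0 < K := by have := hE.two_le; omega
  have hKX : K * X ≤ K ^ 2 * X := by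
    rw [sq]; exact Nat.mul_le_mul_right _ (Nat.le_mul_of_pos_left _ hK)
  have e1 : (tupleE d (Function.update (counters d) a (.var 21))).eval s = D := by
    rw [tupleE_eval, update_counters_eval ht, hj]
  refine WP.seq (WP.qset le_rfl (fun hs => ?_) ?_)
  · refine QExpr.height_eval_le' hs hE.one_le _ (fun x hx => ?_) ?_
    · rw [tupleE_reads hx]; exact hE.bd2
    · rw [hE.bd15]; exact Nat.mul_le_mul_right _ hE.det_le
  rw [e1]
  simp only [IExpr.eval]
  set s₁ := s.setQ 15 0 0 D with hs₁
  have r1 : s₁.row d 2 = s.row d 2 := by funext i l; simp [State.row, hs₁]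
  have e2 : (QExpr.div (tupleE d (Function.update (counters d) b (.var 21))) (.var 15)).eval s₁
      = slope (s.row d 2) a b t j := by
    rw [QExpr.eval, tupleE_eval, update_counters_eval (t := t) (by simpa [hs₁] using ht), r1]
    simp [hs₁, hj, QExpr.eval, IExpr.eval, slope, hD]
  refine WP.seq (WP.qset le_rfl (fun hs => ?_) ?_)
  · have h1 : 1 ≤ K * X := Nat.mul_pos hK hE.one_le
    refine QExpr.height_eval_le' hs h1 _ (fun x hx => ?_) ?_
    · rcases hx with hx | hx
      · rw [tupleE_reads hx]; exact hE.bd2.trans (Nat.le_mul_of_pos_left _ hK)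
      · rw [show x = 15 from hx, hE.bd15]
    · rw [hE.bd5, sq, mul_assoc]; exact Nat.mul_le_mul_right _ hE.slope_le
  rw [e2]
  simp only [IExpr.eval]
  set s₂ := s₁.setQ 5 0 (s₁.imem 21 0 0) (slope (s.row d 2) a b t j) with hs₂
  have q15 : s₂.qmem 15 0 0 = D := by simp [hs₂, hs₁]
  have q8 : s₂.qmem 8 = s.qmem 8 := by funext x y; simp [hs₂, hs₁]
  have q5 : ∀ i, s₂.qmem 5 0 i = if i = j then slope (s.row d 2) a b t j else s.qmem 5 0 i := by
    intro i; simp [hs₂, hs₁, hj]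
  refine WP.seq' (R := fun s' => s'.qmem 15 0 0 = |D|) (WP.ite le_rfl (fun h0 => ?_)
    fun h0 => WP.skip ?_) ?_
  · simp only [Test.holds, QExpr.eval, IExpr.eval, q15] at h0
    refine WP.qset le_rfl (fun hs => ?_) ?_
    · simp only [QExpr.eval, zero_sub, height_neg]
      exact hs.qmem _ _ _
    · simp [QExpr.eval, IExpr.eval, q15, abs_of_neg h0]
  · simp only [Test.holds, QExpr.eval, IExpr.eval, q15] at h0
    rw [q15, abs_of_nonneg (not_lt.1 h0)]
  intro s₃ hF h3
  have q8' : s₃.qmem 8 = s.qmem 8 := by rw [hF.qmem 8 (by simp), q8]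
  have q5' : s₃.qmem 5 = s₂.qmem 5 := hF.qmem 5 (by simp)
  refine WP.ite le_rfl (fun h0 => WP.ite le_rfl (fun h1 => ?_) fun h1 => WP.skip ?_)
    fun h0 => WP.skip ?_
  all_goals simp only [Test.holds, QExpr.eval, IExpr.eval, h3] at h0
  · simp only [Test.holds, QExpr.eval, IExpr.eval, h3, q8'] at h1
    refine WP.qset le_rfl (fun hs => ?_) ?_
    · simp only [QExpr.eval, IExpr.eval]
      refine (hs.qmem _ _ _).trans (Nat.pow_le_pow_right (by norm_num) ?_)
      rw [hE.bd15, hE.bd8]; exact hKX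
    · simp only [QExpr.eval, IExpr.eval, h3]
      refine ⟨fun i => by simp [q5', q5], by simpa using h0, by simpa using h1.le, ?_⟩
      intro i hi hi0
      simp only [State.setQ_qmem, and_self, if_true]
      rcases Nat.lt_succ_iff_lt_or_eq.1 hi with h' | rfl
      · exact h1.le.trans (h i h' hi0)
      · exact le_rfl
  · simp only [Test.holds, QExpr.eval, IExpr.eval, h3, q8'] at h1
    rw [q8', q5']
    refine ⟨q5, hμ, le_rfl, fun i hi hi0 => ?_⟩
    rcases Nat.lt_succ_iff_lt_or_eq.1 hi with h' | rfl
    · exact h i h' hi0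
    · exact not_lt.1 h1
  · rw [q8', q5']
    refine ⟨q5, hμ, le_rfl, fun i hi hi0 => ?_⟩
    rcases Nat.lt_succ_iff_lt_or_eq.1 hi with h' | rfl
    · exact h i h' hi0
    · exact absurd (abs_pos.2 hi0) h0

theorem slopesCmd_wp {s : State n d} {a b : Fin d} {X K N k : ℕ} {t : Fin d → ℕ}
    (hE : SlopeBounds E a b X K) (hN : 1 ≤ N) (hM : 2 * N ≤ E.M) (h9 : s.imem 9 0 0 = N)
    (hP : Powers N k s) (ht : ∀ k : Fin d, s.imem (100 + k) 0 0 = t k)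
    (hμ : 0 < s.qmem 8 0 0) :
    WP E (slopesCmd d a b) (2 ^ k + 1) (fun s' =>
      (∀ i < N, s'.qmem 5 0 i = slope (s.row d 2) a b t i) ∧
      0 < s'.qmem 8 0 0 ∧ s'.qmem 8 0 0 ≤ s.qmem 8 0 0 ∧
      MinorBound (s.row d 2) a t N (s'.qmem 8 0 0)) s := by
  have hle := hP.le
  have hge := hP.ge
  have hsl : ∀ x, (slopeCmd d a b).iw x ↔ False := fun x => by simp [slopeCmd]
  have hslq : ∀ x, (slopeCmd d a b).qw x → x = 15 ∨ x = 5 ∨ x = 8 := fun x => by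
    simp [slopeCmd]; tauto
  refine WP.seq' (R := fun s' => (∀ i < N, s'.qmem 5 0 i = slope (s.row d 2) a b t i) ∧
      0 < s'.qmem 8 0 0 ∧ s'.qmem 8 0 0 ≤ s.qmem 8 0 0 ∧
      MinorBound (s.row d 2) a t N (s'.qmem 8 0 0)) ?_ ?_
  · refine WP.for (fb := 1) N (fun j s' => (∀ i < j, s'.qmem 5 0 i = slope (s.row d 2) a b t i) ∧
      0 < s'.qmem 8 0 0 ∧ s'.qmem 8 0 0 ≤ s.qmem 8 0 0 ∧
      MinorBound (s.row d 2) a t j (s'.qmem 8 0 0)) (by omega) le_rfl (by simp [hsl]) (by omega)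
      (fun s' hF => ?_) (fun k s' a h => by simpa using h) ?_ ?_ (fun _ h => h)
    · rw [IExpr.eval, hF.imem 9 (by simp [hsl])]; exact h9
    · exact ⟨by simp, hμ, le_rfl, fun j hj => absurd hj (Nat.not_lt_zero _)⟩
    · rintro j hj s' hF hjc ⟨h1, h2, h3, h4⟩
      have hr : s'.row d 2 = s.row d 2 := by
        funext i l
        rw [State.row, State.row, hF.qmem 2]
        rw [Cmd.for_qw]
        intro h
        have := hslq 2 h
        omega
      have ht' : ∀ k : Fin d, s'.imem (100 + k) 0 0 = t k := fun k => by
        rw [hF.imem (100 + k) (by rw [Cmd.for_iw, hsl]; rintro (h | h) <;> omega), ht]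
      refine (slopeCmd_wp hE ht' hjc h2 (hr ▸ h4)).mono le_rfl fun s₂ => ?_
      rw [hr]
      rintro ⟨g1, g2, g3, g4⟩
      refine ⟨fun i hi => ?_, g2, g3.trans h3, g4⟩
      rw [g1]
      split_ifs with hij
      · rw [hij]
      · exact h1 i (by omega)
  · rintro s₁ hF₁ ⟨h1, h2, h3, h4⟩
    refine WP.for (fb := 1) (2 ^ k) (fun j s' => (∀ i < N, s'.qmem 5 0 i = slope (s.row d 2) a b t i))
      (by omega) le_rfl (by simp) (by omega)
      (fun s' hF => ?_) (fun k s' a h => by simpa using h) h1 ?_ (fun _ h => h) |>.frame.mono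
        le_rfl ?_
    · rw [IExpr.eval, hF.imem 10 (by simp), hF₁.imem 10 (by simp [hsl])]; exact hP.power
    · intro j hj s' hF hjc h5
      have h9' : s'.imem 9 0 0 = N := by
        rw [hF.imem 9 (by simp), hF₁.imem 9 (by simp [hsl]), h9]
      refine WP.ite le_rfl (fun hlt => WP.skip h5) fun hlt => ?_
      simp only [Test.holds, IExpr.eval, hjc, h9'] at hlt
      refine WP.qset le_rfl (fun hs => hs.qmem _ _ _) fun i hi => ?_
      simp only [IExpr.eval, hjc, State.setQ_qmem, true_and]
      rw [if_neg (by rintro rfl; exact hlt hi), h5 i hi]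
    · rintro s' ⟨g1, hF⟩
      rw [hF.qmem 8 (by simp)]
      exact ⟨g1, h2, h3, h4⟩

end ConvexOpt

namespace ConvexOpt

open Finset

variable {n d : ℕ} {E : Env n d}

/-! ### Sorting -/

/-- The first `B` blocks of length `W` are sorted. -/
def SortedBlocks (Y : ℕ → ℚ) (W B : ℕ) : Prop :=
  ∀ b < B, ∀ p q, p ≤ q → q < W → Y (b * W + p) ≤ Y (b * W + q)

/-- All values of `X` below `T` are values of `Y`. -/
def Covers (X Y : ℕ → ℚ) (T : ℕ) : Prop := ∀ p < T, ∃ q < T, Y q = X p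

/-- `Y` holds, from `base` on, the result of merging the first `i` and the first `j` entries of
two consecutive runs of length `L` of `X`. -/
structure MergeInv (X Y : ℕ → ℚ) (base L i j : ℕ) : Prop where
  le_left : i ≤ L
  le_right : j ≤ L
  sorted : ∀ p q, p ≤ q → q < i + j → Y (base + p) ≤ Y (base + q)
  left : ∀ p < i + j, ∀ u, i ≤ u → u < L → Y (base + p) ≤ X (base + u)
  right : ∀ p < i + j, ∀ u, j ≤ u → u < L → Y (base + p) ≤ X (base + L + u)
  hit_left : ∀ u < i, ∃ p < i + j, Y (base + p) = X (base + u)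
  hit_right : ∀ u < j, ∃ p < i + j, Y (base + p) = X (base + L + u)

/-- The appended entry is at least everything already written, by `left`, and at most everything
remaining, by the order of its own run and by `hc` for the other. -/
theorem MergeInv.step_left {X Y Y' : ℕ → ℚ} {base L i j : ℕ} (h : MergeInv X Y base L i j)
    (hl : ∀ p q, p ≤ q → q < L → X (base + p) ≤ X (base + q))
    (hr : ∀ p q, p ≤ q → q < L → X (base + L + p) ≤ X (base + L + q)) (hi : i < L)
    (hc : j < L → X (base + i) ≤ X (base + L + j))
    (hY : ∀ q, Y' q = if q = base + (i + j) then X (base + i) else Y q) :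
    MergeInv X Y' base L (i + 1) j := by
  have old : ∀ p < i + j, Y' (base + p) = Y (base + p) := fun p hp => by
    rw [hY, if_neg (by omega)]
  have new : Y' (base + (i + j)) = X (base + i) := by rw [hY, if_pos rfl]
  have cases : ∀ {p}, p < i + 1 + j → p < i + j ∨ p = i + j := fun h => by omega
  refine ⟨hi, h.le_right, fun p q hpq hq => ?_, fun p hp u hu huL => ?_, fun p hp u hu huL => ?_,
    fun u hu => ?_, fun u hu => ?_⟩
  · rcases cases hq with hq | rfl
    · rw [old q hq, old p (by omega)]; exact h.sorted p q hpq hq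
    · rcases Nat.lt_or_eq_of_le hpq with hp | rfl
      · rw [old p hp, new]; exact h.left p hp i le_rfl hi
      · exact le_rfl
  · rcases cases hp with hp | rfl
    · rw [old p hp]; exact h.left p hp u (by omega) huL
    · rw [new]; exact hl i u (by omega) huL
  · rcases cases hp with hp | rfl
    · rw [old p hp]; exact h.right p hp u hu huL
    · rw [new]; exact (hc (by omega)).trans (hr j u hu huL)
  · rcases Nat.lt_succ_iff_lt_or_eq.1 hu with hu | rfl
    · obtain ⟨p, hp, e⟩ := h.hit_left u hu
      exact ⟨p, by omega, by rw [old p hp, e]⟩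
    · exact ⟨u + j, by omega, new⟩
  · obtain ⟨p, hp, e⟩ := h.hit_right u hu
    exact ⟨p, by omega, by rw [old p hp, e]⟩

theorem MergeInv.step_right {X Y Y' : ℕ → ℚ} {base L i j : ℕ} (h : MergeInv X Y base L i j)
    (hl : ∀ p q, p ≤ q → q < L → X (base + p) ≤ X (base + q))
    (hr : ∀ p q, p ≤ q → q < L → X (base + L + p) ≤ X (base + L + q)) (hj : j < L)
    (hc : i < L → X (base + L + j) ≤ X (base + i))
    (hY : ∀ q, Y' q = if q = base + (i + j) then X (base + L + j) else Y q) :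
    MergeInv X Y' base L i (j + 1) := by
  have old : ∀ p < i + j, Y' (base + p) = Y (base + p) := fun p hp => by
    rw [hY, if_neg (by omega)]
  have new : Y' (base + (i + j)) = X (base + L + j) := by rw [hY, if_pos rfl]
  have cases : ∀ {p}, p < i + (j + 1) → p < i + j ∨ p = i + j := fun h => by omega
  refine ⟨h.le_left, hj, fun p q hpq hq => ?_, fun p hp u hu huL => ?_, fun p hp u hu huL => ?_,
    fun u hu => ?_, fun u hu => ?_⟩
  · rcases cases hq with hq | rfl
    · rw [old q hq, old p (by omega)]; exact h.sorted p q hpq hq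
    · rcases Nat.lt_or_eq_of_le hpq with hp | rfl
      · rw [old p hp, new]; exact h.right p hp j le_rfl hj
      · exact le_rfl
  · rcases cases hp with hp | rfl
    · rw [old p hp]; exact h.left p hp u hu huL
    · rw [new]; exact (hc (by omega)).trans (hl i u hu huL)
  · rcases cases hp with hp | rfl
    · rw [old p hp]; exact h.right p hp u (by omega) huL
    · rw [new]; exact hr j u (by omega) huL
  · obtain ⟨p, hp, e⟩ := h.hit_left u hu
    exact ⟨p, by omega, by rw [old p hp, e]⟩
  · rcases Nat.lt_succ_iff_lt_or_eq.1 hu with hu | rfl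
    · obtain ⟨p, hp, e⟩ := h.hit_right u hu
      exact ⟨p, by omega, by rw [old p hp, e]⟩
    · exact ⟨i + u, by omega, new⟩

def takeLeft : Cmd :=
  .seq (.qset 6 (.const 0) (.add (.var 17) (.var 22)) (.get 5 (.const 0) (.add (.var 17) (.var 13))))
    (.iassign 13 (.add (.var 13) (.const 1)))

def takeRight : Cmd :=
  .seq (.qset 6 (.const 0) (.add (.var 17) (.var 22))
      (.get 5 (.const 0) (.add (.add (.var 17) (.get 12 (.const 0) (.var 20))) (.var 14))))
    (.iassign 14 (.add (.var 14) (.const 1)))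

/-- One step of merging: the runs have the length stored in entry `20` of the array `12`. -/
def mergeStep : Cmd :=
  .ite (.ilt (.var 13) (.get 12 (.const 0) (.var 20)))
    (.ite (.ilt (.var 14) (.get 12 (.const 0) (.var 20)))
      (.ite (.qlt (.get 5 (.const 0) (.add (.add (.var 17) (.get 12 (.const 0) (.var 20))) (.var 14)))
          (.get 5 (.const 0) (.add (.var 17) (.var 13)))) takeRight takeLeft)
      takeLeft) takeRight

/-- Merging the two halves of the block `21`. -/
def mergeCmd : Cmd :=
  .seq (.iassign 17 (.mul (.var 21) (.get 12 (.const 0) (.add (.var 20) (.const 1)))))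
  (.seq (.iassign 13 (.const 0)) (.seq (.iassign 14 (.const 0))
  (.for 22 (.get 12 (.const 0) (.add (.var 20) (.const 1))) mergeStep)))

theorem mergeStep_wp {s : State n d} {X Y : ℕ → ℚ} {base L i j : ℕ} (hbd : E.bd 5 = E.bd 6)
    (hM : L ≤ E.M) (hX : s.qmem 5 0 = X) (h17 : s.imem 17 0 0 = base)
    (hL : s.imem 12 0 (s.imem 20 0 0) = L) (h13 : s.imem 13 0 0 = i) (h14 : s.imem 14 0 0 = j)
    (h22 : s.imem 22 0 0 = i + j) (hlt : i + j < 2 * L)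
    (hl : ∀ p q, p ≤ q → q < L → X (base + p) ≤ X (base + q))
    (hr : ∀ p q, p ≤ q → q < L → X (base + L + p) ≤ X (base + L + q))
    (h : MergeInv X (s.qmem 6 0) base L i j) (hY : ∀ p < base, s.qmem 6 0 p = Y p) :
    WP E mergeStep 1 (fun s' => ∃ i' j', i' + j' = i + j + 1 ∧ s'.imem 13 0 0 = i' ∧
      s'.imem 14 0 0 = j' ∧ MergeInv X (s'.qmem 6 0) base L i' j' ∧
      ∀ p < base, s'.qmem 6 0 p = Y p) s := by
  have left : i < L → (j < L → X (base + i) ≤ X (base + L + j)) →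
      WP E takeLeft 1 (fun s' => ∃ i' j', i' + j' = i + j + 1 ∧ s'.imem 13 0 0 = i' ∧
      s'.imem 14 0 0 = j' ∧ MergeInv X (s'.qmem 6 0) base L i' j' ∧
      ∀ p < base, s'.qmem 6 0 p = Y p) s := by
    intro hi hc
    refine WP.seq (WP.qset le_rfl (fun hs => hbd ▸ hs.qmem _ _ _) (WP.iset le_rfl ?_ ?_))
    · simp only [IExpr.eval, State.setQ_imem, h13]; omega
    · simp only [IExpr.eval, QExpr.eval, State.setQ_imem, h17, h22, h13, hX]
      refine ⟨i + 1, j, by omega, by simp, by simp [h14],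
        h.step_left hl hr hi hc fun q => by simp, fun p hp => ?_⟩
      simp only [State.setI_qmem, State.setQ_qmem, true_and]
      rw [if_neg (by omega), hY p hp]
  have right : j < L → (i < L → X (base + L + j) ≤ X (base + i)) →
      WP E takeRight 1 (fun s' => ∃ i' j', i' + j' = i + j + 1 ∧ s'.imem 13 0 0 = i' ∧
      s'.imem 14 0 0 = j' ∧ MergeInv X (s'.qmem 6 0) base L i' j' ∧
      ∀ p < base, s'.qmem 6 0 p = Y p) s := by
    intro hj hc
    refine WP.seq (WP.qset le_rfl (fun hs => hbd ▸ hs.qmem _ _ _) (WP.iset le_rfl ?_ ?_))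
    · simp only [IExpr.eval, State.setQ_imem, h14]; omega
    · simp only [IExpr.eval, QExpr.eval, State.setQ_imem, h17, h22, h14, hX, hL]
      refine ⟨i, j + 1, by omega, by simp [h13], by simp,
        h.step_right hl hr hj hc fun q => by simp, fun p hp => ?_⟩
      simp only [State.setI_qmem, State.setQ_qmem, true_and]
      rw [if_neg (by omega), hY p hp]
  have := h.le_left
  have := h.le_right
  refine WP.ite le_rfl (fun t1 => WP.ite le_rfl (fun t2 => WP.ite le_rfl (fun t3 => ?_)
    fun t3 => ?_) fun t2 => ?_) fun t1 => ?_
  all_goals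
    simp only [Test.holds, IExpr.eval, h13, hL] at t1
  · simp only [Test.holds, IExpr.eval, h14, hL] at t2
    simp only [Test.holds, QExpr.eval, IExpr.eval, h13, h14, h17, hL, hX] at t3
    exact right t2 fun _ => t3.le
  · simp only [Test.holds, QExpr.eval, IExpr.eval, h13, h14, h17, hL, hX] at t3
    exact left t1 fun _ => not_lt.1 t3
  · simp only [Test.holds, IExpr.eval, h14, hL] at t2
    exact left t1 fun h => absurd h t2
  · exact right (by omega) fun h => absurd h t1

theorem mergeCmd_wp {s : State n d} {X : ℕ → ℚ} {r b B L : ℕ} (hbd : E.bd 5 = E.bd 6)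
    (hM : B * (2 * L) ≤ E.M) (hL0 : 0 < L) (hX : s.qmem 5 0 = X) (h20 : s.imem 20 0 0 = r)
    (h21 : s.imem 21 0 0 = b)
    (hb : b < B) (hL : s.imem 12 0 r = L) (hW : s.imem 12 0 (r + 1) = 2 * L)
    (hs : SortedBlocks X L (2 * B)) (hY : SortedBlocks (s.qmem 6 0) (2 * L) b)
    (hc : Covers X (s.qmem 6 0) (b * (2 * L))) :
    WP E mergeCmd (2 * L + 1) (fun s' => SortedBlocks (s'.qmem 6 0) (2 * L) (b + 1) ∧
      Covers X (s'.qmem 6 0) ((b + 1) * (2 * L))) s := by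
  have hf : 1 ≤ 2 * L + 1 := by omega
  have hbM : b * (2 * L) + 2 * L ≤ B * (2 * L) := by
    rw [← Nat.succ_mul]; exact Nat.mul_le_mul_right _ hb
  set base := b * (2 * L) with hbase
  have hl : ∀ p q, p ≤ q → q < L → X (base + p) ≤ X (base + q) := by
    have := hs (2 * b) (by omega)
    rwa [show 2 * b * L = base by rw [hbase]; ring] at this
  have hr : ∀ p q, p ≤ q → q < L → X (base + L + p) ≤ X (base + L + q) := by
    have := hs (2 * b + 1) (by omega)
    rwa [show (2 * b + 1) * L = base + L by rw [hbase]; ring] at this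
  refine WP.seq (WP.iset hf ?_ (WP.seq (WP.iset hf (Nat.zero_le _) (WP.seq (WP.iset hf
    (Nat.zero_le _) ?_)))))
  · simp only [IExpr.eval, h20, h21, hW]; omega
  simp only [IExpr.eval, h20, h21, hW]
  have hw : ∀ x, mergeStep.iw x → x = 13 ∨ x = 14 := fun x => by
    simp [mergeStep, takeLeft, takeRight]; tauto
  have hq : ∀ x, mergeStep.qw x → x = 6 := fun x => by
    simp [mergeStep, takeLeft, takeRight]
  have hnw : ∀ x b, x ≠ 13 → x ≠ 14 → x ≠ 22 → ¬ (Cmd.for 22 b mergeStep).iw x := by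
    intro x b h1 h2 h3 h
    rw [Cmd.for_iw] at h
    rcases h with h | h
    · exact h3 h
    · rcases hw x h with h | h
      exacts [h1 h, h2 h]
  refine WP.for (fb := 1) (2 * L) (fun t s' => ∃ i j, i + j = t ∧ s'.imem 13 0 0 = i ∧
      s'.imem 14 0 0 = j ∧ MergeInv X (s'.qmem 6 0) base L i j ∧
      ∀ p < base, s'.qmem 6 0 p = s.qmem 6 0 p) (by omega) le_rfl
    (fun h => by have := hw _ h; omega) (by omega) (fun s' hF => ?_) (fun t s' v h => ?_) ?_ ?_ ?_
  · simp only [IExpr.eval]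
    rw [hF.imem 12 (hnw _ _ (by omega) (by omega) (by omega)),
      hF.imem 20 (hnw _ _ (by omega) (by omega) (by omega))]
    simp [h20, hW]
  · simpa using h
  · exact ⟨0, 0, rfl, by simp, by simp, ⟨by omega, by omega, fun p q _ h => by omega,
      fun p h => by omega, fun p h => by omega, fun u h => by omega, fun u h => by omega⟩,
      fun _ _ => rfl⟩
  · rintro t ht s' hF htc ⟨i, j, rfl, h13, h14, hI, hpre⟩
    have j20 : s'.imem 20 0 0 = r := by
      rw [hF.imem 20 (hnw _ _ (by omega) (by omega) (by omega))]; simp [h20]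
    refine mergeStep_wp hbd (by omega) ?_ ?_ ?_ h13 h14 htc ht hl hr hI hpre
    · rw [hF.qmem 5 (by rw [Cmd.for_qw]; intro h; have := hq _ h; omega), ← hX]; rfl
    · rw [hF.imem 17 (hnw _ _ (by omega) (by omega) (by omega))]; simp [hbase]
    · rw [j20, hF.imem 12 (hnw _ _ (by omega) (by omega) (by omega))]; simp [hL]
  · rintro s' ⟨i, j, hij, -, -, hI, hpre⟩
    have hi : i = L := by have := hI.le_left; have := hI.le_right; omega
    have hj : j = L := by omega
    subst hi hj
    constructor
    · intro b' hb' p q hpq hq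
      rcases Nat.lt_succ_iff_lt_or_eq.1 hb' with h | rfl
      · have hle : b' * (2 * j) + 2 * j ≤ base := by
          rw [← Nat.succ_mul]; exact Nat.mul_le_mul_right _ h
        rw [hpre _ (by omega), hpre _ (by omega)]
        exact hY b' h p q hpq hq
      · exact hI.sorted p q hpq (by omega)
    · intro p hp
      rw [Nat.succ_mul, ← hbase] at hp ⊢
      by_cases h1 : p < base
      · obtain ⟨q, hq, e⟩ := hc p h1
        exact ⟨q, by omega, by rw [hpre q hq, e]⟩
      by_cases h2 : p < base + j
      · obtain ⟨q, hq, e⟩ := hI.hit_left (p - base) (by omega)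
        exact ⟨base + q, by omega, by rw [e]; congr 1; omega⟩
      · obtain ⟨q, hq, e⟩ := hI.hit_right (p - (base + j)) (by omega)
        exact ⟨base + q, by omega, by rw [e]; congr 1; omega⟩

/-- Merging all pairs of consecutive runs. -/
def roundCmd : Cmd :=
  .seq (.for 21 (.get 12 (.const 0) (.sub (.sub (.var 11) (.const 1)) (.var 20))) mergeCmd)
    (.for 21 (.var 10) (.qset 5 (.const 0) (.var 21) (.get 6 (.const 0) (.var 21))))

def sortCmd : Cmd := .for 20 (.var 11) roundCmd

theorem roundCmd_iw {x : ℕ} (h : roundCmd.iw x) :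
    x = 13 ∨ x = 14 ∨ x = 17 ∨ x = 21 ∨ x = 22 := by
  simp [roundCmd, mergeCmd, mergeStep, takeLeft, takeRight] at h
  omega

theorem roundCmd_qw {x : ℕ} (h : roundCmd.qw x) : x = 5 ∨ x = 6 := by
  simp [roundCmd, mergeCmd, mergeStep, takeLeft, takeRight] at h
  omega

theorem Powers.congr {N k : ℕ} {s s' : State n d} (h : Powers N k s)
    (h11 : s'.imem 11 = s.imem 11) (h10 : s'.imem 10 = s.imem 10) (h12 : s'.imem 12 = s.imem 12) :
    Powers N k s' :=
  ⟨by rw [h11]; exact h.exponent, by rw [h10]; exact h.power, by rw [h12]; exact h.table,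
    h.le, h.ge⟩

/-- Round `r` merges `2 ^ (k - r - 1)` pairs of runs of length `2 ^ r`, so every round is linear in
the total length `2 ^ k`. -/
theorem roundCmd_wp {s : State n d} {N k r : ℕ} (hbd : E.bd 5 = E.bd 6) (hM : 2 * N ≤ E.M)
    (hP : Powers N k s) (hr : r < k) (h20 : s.imem 20 0 0 = r)
    (hs : SortedBlocks (s.qmem 5 0) (2 ^ r) (2 ^ (k - r))) :
    WP E roundCmd (4 * 2 ^ k) (fun s' => SortedBlocks (s'.qmem 5 0) (2 ^ (r + 1)) (2 ^ (k - (r + 1)))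
      ∧ Covers (s.qmem 5 0) (s'.qmem 5 0) (2 ^ k)) s := by
  have hge := hP.ge
  have hL0 : 0 < 2 ^ r := Nat.two_pow_pos r
  have hB0 : 0 < 2 ^ (k - (r + 1)) := Nat.two_pow_pos _
  have eB : 2 ^ (k - r) = 2 * 2 ^ (k - (r + 1)) := by
    rw [← pow_succ']; congr 1; omega
  have eW : 2 ^ (r + 1) = 2 * 2 ^ r := pow_succ' 2 r
  have eT : 2 ^ (k - (r + 1)) * (2 * 2 ^ r) = 2 ^ k := by
    rw [← eW, ← pow_add]; congr 1; omega
  set B := 2 ^ (k - (r + 1)) with hB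
  set L := 2 ^ r with hL
  rw [eW]
  have hBT : B ≤ 2 ^ k := by rw [← eT]; exact Nat.le_mul_of_pos_right _ (by omega)
  refine WP.seq' (R := fun s' => SortedBlocks (s'.qmem 6 0) (2 * L) B ∧
    Covers (s.qmem 5 0) (s'.qmem 6 0) (B * (2 * L))) ?_ ?_
  · have hw : ∀ x e, (Cmd.for 21 e mergeCmd).iw x → x = 13 ∨ x = 14 ∨ x = 17 ∨ x = 21 ∨ x = 22 :=
      fun x e h => roundCmd_iw (by
        simp only [roundCmd, Cmd.iw, Cmd.for_iw] at h ⊢; exact Or.inl h)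
    refine WP.for (fb := 2 * L + 1) B (fun b s' => SortedBlocks (s'.qmem 6 0) (2 * L) b ∧
      Covers (s.qmem 5 0) (s'.qmem 6 0) (b * (2 * L))) ?_ (by omega)
      (by simp [mergeCmd, mergeStep, takeLeft, takeRight]) (by omega) (fun s' hF => ?_)
      (fun b s' v h => by simpa using h) ⟨fun b hb => by omega, fun p hp => by omega⟩ ?_
      (fun _ h => h)
    · rw [← eT]
      nlinarith
    · simp only [IExpr.eval]
      rw [hF.imem 12 (fun h => by have := hw _ _ h; omega),
        hF.imem 11 (fun h => by have := hw _ _ h; omega),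
        hF.imem 20 (fun h => by have := hw _ _ h; omega), hP.exponent, h20, hP.table _ (by omega),
        hB]
      congr 1; omega
    · rintro b hb s' hF hbc ⟨h1, h2⟩
      have q5 : s'.qmem 5 = s.qmem 5 := hF.qmem 5 (by
        simp [mergeCmd, mergeStep, takeLeft, takeRight])
      have i12 : s'.imem 12 = s.imem 12 := hF.imem 12 (fun h => by have := hw _ _ h; omega)
      refine mergeCmd_wp (r := r) (B := B) hbd (by omega) hL0 (by rw [q5]) ?_ hbc hb ?_ ?_
        (eB ▸ hs) h1 h2
      · rw [hF.imem 20 (fun h => by have := hw _ _ h; omega), h20]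
      · rw [i12, hP.table r hr.le]
      · rw [i12, hP.table (r + 1) hr, eW]
  · rintro s₁ hF₁ ⟨h1, h2⟩
    refine (WP.for (fb := 1) (2 ^ k) (fun t s' => ∀ p < t, s'.qmem 5 0 p = s₁.qmem 6 0 p)
      (by omega) le_rfl (by simp) (by omega) (fun s' hF => ?_) (fun t s' v h => by simpa using h)
      (by simp) ?_ (fun _ h => h)).mono le_rfl ?_
    · rw [IExpr.eval, hF.imem 10 (by simp), hF₁.imem 10
        (by simp [mergeCmd, mergeStep, takeLeft, takeRight])]
      exact hP.power
    · intro t ht s' hF htc h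
      have q6 : s'.qmem 6 = s₁.qmem 6 := hF.qmem 6 (by simp)
      refine WP.qset le_rfl (fun hs => hbd ▸ hs.qmem _ _ _) fun p hp => ?_
      simp only [IExpr.eval, QExpr.eval, htc, State.setQ_qmem, true_and, q6]
      split_ifs with hpt
      · rw [hpt]
      · exact h p (by omega)
    · intro s' h
      rw [eT] at h2
      constructor
      · intro b hb p q hpq hq
        have : b * (2 * L) + 2 * L ≤ 2 ^ k := by
          rw [← Nat.succ_mul, ← eT]; exact Nat.mul_le_mul_right _ hb
        rw [h _ (by omega), h _ (by omega)]
        exact h1 b hb p q hpq hq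
      · intro p hp
        obtain ⟨q, hq, e⟩ := h2 p hp
        exact ⟨q, hq, by rw [h q hq, e]⟩

/-- Of the permutation property only the covering of the old values is kept: additional values could
only make the measured gaps smaller, which is harmless for a lower bound. -/
theorem sortCmd_wp {s : State n d} {N k : ℕ} (hbd : E.bd 5 = E.bd 6) (hM : 2 * N ≤ E.M)
    (hP : Powers N k s) :
    WP E sortCmd ((k + 1) * (4 * 2 ^ k)) (fun s' =>
      (∀ p q, p ≤ q → q < 2 ^ k → s'.qmem 5 0 p ≤ s'.qmem 5 0 q)
      ∧ Covers (s.qmem 5 0) (s'.qmem 5 0) (2 ^ k)) s := by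
  have hge := hP.ge
  have hk : k < 2 ^ k := Nat.lt_two_pow_self
  refine WP.for (fb := 4 * 2 ^ k) k (fun r s' =>
    SortedBlocks (s'.qmem 5 0) (2 ^ r) (2 ^ (k - r)) ∧ Covers (s.qmem 5 0) (s'.qmem 5 0) (2 ^ k))
    le_rfl (by omega) (fun h => by have := roundCmd_iw h; omega) (by omega) (fun s' hF => ?_)
    (fun t s' v h => by simpa using h) ?_ ?_ ?_
  · rw [IExpr.eval, hF.imem 11 (by rw [Cmd.for_iw]; rintro (h | h); omega; have := roundCmd_iw h; omega)]
    exact hP.exponent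
  · refine ⟨fun b _ p q hpq hq => ?_, fun p hp => ⟨p, hp, rfl⟩⟩
    have : p = q := by simp at hq; omega
    rw [this]
  · rintro r hr s' hF hrc ⟨h1, h2⟩
    have hw : ∀ x, x = 10 ∨ x = 11 ∨ x = 12 → s'.imem x = s.imem x := fun x hx => hF.imem x (by
      rw [Cmd.for_iw]
      rintro (h | h)
      · omega
      · have := roundCmd_iw h; omega)
    refine (roundCmd_wp hbd hM (hP.congr (hw 11 (by omega)) (hw 10 (by omega)) (hw 12 (by omega)))
      hr hrc h1).mono le_rfl fun s'' => ?_
    rintro ⟨g1, g2⟩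
    refine ⟨g1, fun p hp => ?_⟩
    obtain ⟨q, hq, e⟩ := h2 p hp
    obtain ⟨q', hq', e'⟩ := g2 q hq
    exact ⟨q', hq', by rw [e', e]⟩
  · rintro s' ⟨h1, h2⟩
    refine ⟨fun p q hpq hq => ?_, h2⟩
    simpa using h1 0 (by simp) p q hpq hq

/-! ### Gaps -/

/-- The least positive difference of neighbours, if it is smaller than the entry `7`. -/
def gapCmd : Cmd :=
  .for 21 (.sub (.var 10) (.const 1))
    (.ite (.qlt (.get 5 (.const 0) (.var 21)) (.get 5 (.const 0) (.add (.var 21) (.const 1))))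
      (.ite (.qlt (.sub (.get 5 (.const 0) (.add (.var 21) (.const 1)))
          (.get 5 (.const 0) (.var 21))) (.var 7))
        (.qassign 7 (.sub (.get 5 (.const 0) (.add (.var 21) (.const 1)))
          (.get 5 (.const 0) (.var 21)))) .skip) .skip)

theorem gapCmd_wp {s : State n d} {T : ℕ} (hbd : 2 * E.bd 5 ≤ E.bd 7) (hM : T ≤ E.M)
    (h10 : s.imem 10 0 0 = T) (hγ : 0 < s.qmem 7 0 0) :
    WP E gapCmd (T + 1) (fun s' => 0 < s'.qmem 7 0 0 ∧ s'.qmem 7 0 0 ≤ s.qmem 7 0 0 ∧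
      ∀ p, p + 1 < T → s.qmem 5 0 p < s.qmem 5 0 (p + 1) →
        s'.qmem 7 0 0 ≤ s.qmem 5 0 (p + 1) - s.qmem 5 0 p) s := by
  refine WP.for (fb := 1) (T - 1) (fun t s' => 0 < s'.qmem 7 0 0 ∧ s'.qmem 7 0 0 ≤ s.qmem 7 0 0 ∧
      ∀ p < t, s.qmem 5 0 p < s.qmem 5 0 (p + 1) →
        s'.qmem 7 0 0 ≤ s.qmem 5 0 (p + 1) - s.qmem 5 0 p) (by omega) le_rfl (by simp) (by omega)
    (fun s' hF => ?_) (fun t s' v h => by simpa using h) ⟨hγ, le_rfl, by simp⟩ ?_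
    fun s' h => ⟨h.1, h.2.1, fun p hp => h.2.2 p (by omega)⟩
  · simp only [IExpr.eval]
    rw [hF.imem 10 (by simp), h10]
  rintro t ht s' hF htc ⟨h1, h2, h3⟩
  have q5 : s'.qmem 5 = s.qmem 5 := hF.qmem 5 (by simp)
  refine WP.ite le_rfl (fun t1 => WP.ite le_rfl (fun t2 => ?_) fun t2 => WP.skip ?_)
    fun t1 => WP.skip ?_
  all_goals simp only [Test.holds, QExpr.eval, IExpr.eval, htc, q5] at t1
  · simp only [Test.holds, QExpr.eval, IExpr.eval, htc, q5] at t2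
    refine WP.qset le_rfl (fun hs => ?_) ?_
    · simp only [QExpr.eval, IExpr.eval]
      refine (height_sub _ _).trans ((Nat.mul_le_mul (hs.qmem _ _ _) (hs.qmem _ _ _)).trans ?_)
      rw [← pow_add, ← two_mul]
      exact Nat.pow_le_pow_right (by norm_num) hbd
    · simp only [QExpr.eval, IExpr.eval, htc, q5, State.setQ_qmem, and_self, if_true]
      refine ⟨sub_pos.2 t1, t2.le.trans h2, fun p hp hlt => ?_⟩
      rcases Nat.lt_succ_iff_lt_or_eq.1 hp with h | rfl
      · exact t2.le.trans (h3 p h hlt)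
      · exact le_rfl
  · simp only [Test.holds, QExpr.eval, IExpr.eval, htc, q5] at t2
    refine ⟨h1, h2, fun p hp hlt => ?_⟩
    rcases Nat.lt_succ_iff_lt_or_eq.1 hp with h | rfl
    · exact h3 p h hlt
    · exact not_lt.1 t2
  · refine ⟨h1, h2, fun p hp hlt => ?_⟩
    rcases Nat.lt_succ_iff_lt_or_eq.1 hp with h | rfl
    · exact h3 p h hlt
    · exact absurd hlt t1

end ConvexOpt

namespace ConvexOpt

open Finset

variable {n d : ℕ} {E : Env n d}

/-! ### The search for the bounds -/

/-- The work for one choice of fixed rows. The arrays 7 and 8 carry the running minima of gaps and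
of minors from one choice to the next. -/
def gapBody (d : ℕ) (a b : Fin d) : Cmd := .seq (slopesCmd d a b) (.seq sortCmd gapCmd)

theorem gapBody_iw {a b : Fin d} {x : ℕ} (h : (gapBody d a b).iw x) :
    x = 13 ∨ x = 14 ∨ x = 17 ∨ x = 20 ∨ x = 21 ∨ x = 22 := by
  simp [gapBody, slopesCmd, slopeCmd, sortCmd, gapCmd] at h
  rcases h with h | h | h
  · omega
  · rcases h with h | h
    · omega
    · have := roundCmd_iw h; omega
  · omega

theorem gapBody_qw {a b : Fin d} {x : ℕ} (h : (gapBody d a b).qw x) :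
    x = 5 ∨ x = 6 ∨ x = 7 ∨ x = 8 ∨ x = 15 := by
  simp [gapBody, slopesCmd, slopeCmd, sortCmd, gapCmd] at h
  rcases h with h | h | h
  · omega
  · have := roundCmd_qw h; omega
  · omega

/-- `γ` and `μ` obey the conditions for the tuple `t`. -/
structure TupleBounds (r : ℕ → Fin d → ℚ) (a b : Fin d) (t : Fin d → ℕ) (N : ℕ) (γ μ : ℚ) :
    Prop where
  minor : MinorBound r a t N μ
  gap : ∀ i < N, ∀ j < N, slope r a b t i < slope r a b t j →
    γ ≤ slope r a b t j - slope r a b t i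

theorem TupleBounds.mono {r : ℕ → Fin d → ℚ} {a b : Fin d} {t : Fin d → ℕ} {N : ℕ} {γ μ γ' μ' : ℚ}
    (h : TupleBounds r a b t N γ μ) (hγ : γ' ≤ γ) (hμ : μ' ≤ μ) : TupleBounds r a b t N γ' μ' :=
  ⟨fun j hj h0 => hμ.trans (h.minor j hj h0), fun i hi j hj hlt => hγ.trans (h.gap i hi j hj hlt)⟩

theorem gapBody_wp {s : State n d} {a b : Fin d} {X K N k : ℕ} {t : Fin d → ℕ}
    (hE : SlopeBounds E a b X K) (hN : 1 ≤ N) (hM : 2 * N ≤ E.M) (h9 : s.imem 9 0 0 = N)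
    (hP : Powers N k s) (ht : ∀ k : Fin d, s.imem (100 + k) 0 0 = t k)
    (hμ : 0 < s.qmem 8 0 0) (hγ : 0 < s.qmem 7 0 0) :
    WP E (gapBody d a b) ((k + 1) * (4 * 2 ^ k)) (fun s' =>
      0 < s'.qmem 7 0 0 ∧ s'.qmem 7 0 0 ≤ s.qmem 7 0 0 ∧
      0 < s'.qmem 8 0 0 ∧ s'.qmem 8 0 0 ≤ s.qmem 8 0 0 ∧
      TupleBounds (s.row d 2) a b t N (s'.qmem 7 0 0) (s'.qmem 8 0 0)) s := by
  have h56 : E.bd 5 = E.bd 6 := by rw [hE.bd5, hE.bd6]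
  have h57 : 2 * E.bd 5 ≤ E.bd 7 := by
    rw [hE.bd5, hE.bd7, ← mul_assoc, pow_succ' K 2]
    exact Nat.mul_le_mul_right _ (Nat.mul_le_mul_right _ hE.two_le)
  have hge := hP.ge
  have hle := hP.le
  have hk0 : 1 ≤ 2 ^ k := Nat.one_le_two_pow
  have hf : 2 ^ k + 1 ≤ (k + 1) * (4 * 2 ^ k) := by nlinarith
  refine WP.seq' ((slopesCmd_wp hE hN hM h9 hP ht hμ).mono hf fun _ h => h) ?_
  rintro s₁ hF₁ ⟨h1, h2, h3, h4⟩
  have hw : ∀ x, (slopesCmd d a b).iw x → x = 21 := fun x h => by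
    simp [slopesCmd, slopeCmd] at h; exact h
  have P₁ : Powers N k s₁ := hP.congr (hF₁.imem _ fun h => by have := hw _ h; omega)
    (hF₁.imem _ fun h => by have := hw _ h; omega) (hF₁.imem _ fun h => by have := hw _ h; omega)
  refine WP.seq' (sortCmd_wp h56 hM P₁) ?_
  rintro s₂ hF₂ ⟨h5, h6⟩
  have hw₂ : ∀ x, x = 10 → ¬ sortCmd.iw x := by
    rintro x rfl h
    rw [sortCmd, Cmd.for_iw] at h
    rcases h with h | h
    · omega
    · have := roundCmd_iw h; omega
  have hq₂ : ∀ x, x = 7 ∨ x = 8 → ¬ sortCmd.qw x := by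
    intro x hx h
    rw [sortCmd, Cmd.for_qw] at h
    have := roundCmd_qw h; omega
  have e7 : s₂.qmem 7 = s.qmem 7 := by
    rw [hF₂.qmem 7 (hq₂ _ (by omega)), hF₁.qmem 7 (by simp [slopesCmd, slopeCmd])]
  have e8 : s₂.qmem 8 = s₁.qmem 8 := hF₂.qmem 8 (hq₂ _ (by omega))
  refine (gapCmd_wp (T := 2 ^ k) h57 (by omega) ?_ (by rw [e7]; exact hγ)).frame.mono hf ?_
  · rw [hF₂.imem 10 (hw₂ _ rfl)]; exact P₁.power
  rintro s₃ ⟨⟨h7, h8, h9'⟩, hF₃⟩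
  have e8' : s₃.qmem 8 = s₁.qmem 8 := by rw [hF₃.qmem 8 (by simp [gapCmd]), e8]
  rw [e8']
  rw [e7] at h8
  refine ⟨h7, h8, h2, h3, h4, fun i hi j hj hlt => ?_⟩
  -- Both slopes occur in the sorted list, where gaps between neighbours bound all gaps.
  obtain ⟨p, hp, ep⟩ := h6 i (by omega)
  obtain ⟨q, hq, eq⟩ := h6 j (by omega)
  rw [h1 i hi] at ep
  rw [h1 j hj] at eq
  rw [← ep, ← eq] at hlt ⊢
  exact gap_le_of_sorted h5 h9' p q hp hq hlt

/-- The quotient of minors that determines how close to generic the functionals are. -/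
def epsE (d : ℕ) : QExpr :=
  .div (.div (.mul (.var 7) (.mul (.var 8) (.var 8)))
    (.mul (.mul (.const d.factorial) (powE (.var 4) d))
      (.mul (.const d.factorial) (powE (.var 4) d)))) (.const (2 * d))

/-- The first two positions range over signed unit vectors only, so there are O(m^(d-2)) tuples,
which leaves room for sorting O(m) slopes for each. -/
def boundsCmd (d : ℕ) (a b : Fin d) : Cmd :=
  .seq powersCmd (.seq (.qassign 7 (.const 1)) (.seq (.qassign 8 (.const 1))
    (.seq (.nest (fun j => if j < 2 then .const (2 * d) else .var 9) (gapBody d a b) d)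
      (.qassign 9 (epsE d)))))

theorem boundsCmd_iw {a b : Fin d} {x : ℕ} (h : (boundsCmd d a b).iw x) :
    10 ≤ x ∧ x ≠ 16 := by
  simp [boundsCmd, powersCmd, Cmd.nest_iw] at h
  rcases h with h | h | ⟨_, _, h⟩
  · omega
  · have := gapBody_iw h; omega
  · omega

theorem boundsCmd_qw {a b : Fin d} {x : ℕ} (h : (boundsCmd d a b).qw x) :
    5 ≤ x := by
  simp [boundsCmd, powersCmd] at h
  rcases h with h | h | h | h
  · omega
  · omega
  · have := gapBody_qw h; omega
  · omega

/-- The exponent `k` is known only after `powersCmd`, so `hf` asks for the cost bound for every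
admissible `k`. -/
theorem boundsCmd_wp {s : State n d} {a b : Fin d} {X K N f : ℕ} (ha : (a : ℕ) = 0)
    (hb : (b : ℕ) = 1)
    (hE : SlopeBounds E a b X K) (hN : 2 * d ≤ N) (hM : 2 * N ≤ E.M) (h9 : s.imem 9 0 0 = N)
    (hbd4 : E.bd 4 ≤ X) (hbd9 : E.bd 9 = K ^ 4 * X) (hK : (epsE d).cst ≤ K)
    (hA1 : 1 ≤ s.qmem 4 0 0) (hA : ∀ i < N, ∀ l, s.row d 2 i l ≤ s.qmem 4 0 0)
    (hfN : N + 1 ≤ f)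
    (hf : ∀ k, 2 ^ k ≤ 2 * N →
      (∏ j ∈ range d, ((if j < 2 then 2 * d else N) + 1)) * ((k + 1) * (4 * 2 ^ k)) ≤ f) :
    WP E (boundsCmd d a b) f (fun s' => ∃ γ μ,
      GapBounds (s.row d 2) N a b γ μ (s.qmem 4 0 0) ∧
      s'.qmem 9 0 0 = γ * μ ^ 2 / (d.factorial * s.qmem 4 0 0 ^ d) ^ 2 / (2 * d)) s := by
  have hd : 2 ≤ d := by have := b.2; omega
  have hf1 : 1 ≤ f := by omega
  have hX := hE.one_le
  have hKp := hE.two_le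
  have hpos : ∀ i, 1 ≤ K ^ i * X := fun i => Nat.mul_pos (pow_pos (by omega) _) hX
  have hone : ∀ {x}, 1 ≤ x → height 1 ≤ 2 ^ x := fun {x} h =>
    show 2 ≤ 2 ^ x by simpa using Nat.pow_le_pow_right (show 0 < 2 by norm_num) h
  refine WP.seq' ((powersCmd_wp (by omega) hM h9).mono hfN fun _ h => h) ?_
  rintro s₁ hF₁ ⟨k, hP⟩
  refine WP.seq (WP.qset hf1 (fun _ => hone (hE.bd7 ▸ hpos 3)) (WP.seq (WP.qset hf1
    (fun _ => hone (hE.bd8 ▸ hpos 2)) ?_)))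
  simp only [IExpr.eval, QExpr.eval]
  set s₂ := (s₁.setQ 7 0 0 1).setQ 8 0 0 1 with hs₂
  have i9 : s₂.imem 9 0 0 = N := by
    change s₁.imem 9 0 0 = N
    rw [hF₁.imem 9 (by simp [powersCmd]), h9]
  have P₂ : Powers N k s₂ := hP.congr rfl rfl rfl
  have q2 : s₂.qmem 2 = s.qmem 2 := by
    rw [← hF₁.qmem 2 (by simp [powersCmd])]; funext x y; simp [hs₂]
  have q4 : s₂.qmem 4 = s.qmem 4 := by
    rw [← hF₁.qmem 4 (by simp [powersCmd])]; funext x y; simp [hs₂]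
  have hNf : ∀ j, (if j < 2 then 2 * d else N) ≤ E.M := fun j => by split_ifs <;> omega
  have iw : ∀ {x e}, (Cmd.nest e (gapBody d a b) d).iw x → 13 ≤ x := by
    intro x e h
    rw [Cmd.nest_iw] at h
    rcases h with h | ⟨_, _, h⟩
    · have := gapBody_iw h; omega
    · omega
  have qw : ∀ {x e}, (Cmd.nest e (gapBody d a b) d).qw x → 5 ≤ x := by
    intro x e h
    rw [Cmd.nest_qw] at h
    have := gapBody_qw h; omega
  refine WP.seq' (WP.nest (fb := (k + 1) * (4 * 2 ^ k)) (fun j => if j < 2 then 2 * d else N)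
    (fun done s' => 0 < s'.qmem 7 0 0 ∧ s'.qmem 7 0 0 ≤ 1 ∧ 0 < s'.qmem 8 0 0 ∧
      ∀ σ ∈ done, TupleBounds (s.row d 2) a b (fun l => σ l) N (s'.qmem 7 0 0) (s'.qmem 8 0 0))
    (hf k hP.ge) (Nat.mul_pos (by omega) (by positivity)) (fun j _ h => by
      have := gapBody_iw h; omega) (fun j _ => hNf j) (fun j hj s' hF => ?_)
    (fun done s' j v h => by simpa using h) (by simp [hs₂]) ?_) ?_
  · split_ifs
    · rfl
    · rw [IExpr.eval, hF.imem 9 (fun h => by have := iw h; omega)]; exact i9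
  · rintro done σ s' hF hc hσ ⟨h1, h2, h3, h4⟩
    have hr : s'.row d 2 = s.row d 2 := by
      funext i l
      rw [State.row, State.row, hF.qmem 2 (fun h => by have := qw h; omega), q2]
    have hx : ∀ x < 13, s'.imem x = s₂.imem x := fun x hx =>
      hF.imem x fun h => by have := iw h; omega
    refine (gapBody_wp (t := fun l => σ l) hE (by omega) hM ?_
      (P₂.congr (hx 11 (by omega)) (hx 10 (by omega)) (hx 12 (by omega)))
      (fun l => hc l l.2) h3 h1).mono le_rfl ?_
    · rw [hx 9 (by omega), i9]
    · rintro s₃ ⟨g1, g2, g3, g4, g5⟩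
      rw [hr] at g5
      refine ⟨g1, g2.trans h2, g3, fun τ hτ => ?_⟩
      rcases List.mem_append.1 hτ with h | h
      · exact (h4 τ h).mono g2 g4
      · rw [List.mem_singleton.1 h]; exact g5
  · rintro s₃ hF₃ ⟨h1, h2, h3, h4⟩
    have r4 : s₃.qmem 4 = s.qmem 4 := by
      rw [hF₃.qmem 4 (fun h => by have := qw h; omega), q4]
    refine WP.qset hf1 (fun hs => ?_) ?_
    · refine QExpr.height_eval_le' hs (hpos 3) _ (fun x hx => ?_) (?_ : (epsE d).cst * _ ≤ _)
      · have hX3 : X ≤ K ^ 3 * X := Nat.le_mul_of_pos_left _ (pow_pos (by omega) _)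
        have h23 : K ^ 2 * X ≤ K ^ 3 * X :=
          Nat.mul_le_mul_right _ (Nat.pow_le_pow_right (by omega) (by omega))
        have hp : (powE (.var 4) d).Reads x → x = 4 := fun h => powE_reads h
        simp only [epsE, QExpr.Reads, false_or, or_false, or_self] at hx
        rcases hx with (hx | hx) | hx
        · rw [hx, hE.bd7]
        · rw [hx, hE.bd8]; exact h23
        · rw [hp hx]; exact hbd4.trans hX3
      · rw [hbd9, pow_succ' K 3, mul_assoc]
        exact Nat.mul_le_mul_right _ hK
    · refine ⟨s₃.qmem 7 0 0, s₃.qmem 8 0 0, ⟨h1, h2, h3, hA1, hA, fun t ht j hj h0 => ?_,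
        fun t ht i hi j hj hlt => ?_⟩, ?_⟩
      -- The nested loops visit functions on all of `ℕ` that vanish from `d` on, so `t` is extended
      -- by zero.
      · exact (h4 (fun l => if h : l < d then t ⟨l, h⟩ else 0) (mem_tupleList.2
          ⟨fun l hl => by simpa [hl] using ht ⟨l, hl⟩, fun l hl => by simp [not_lt.2 hl]⟩)).minor j hj
          (by simpa using h0) |>.trans_eq (by simp)
      · have := (h4 (fun l => if h : l < d then t ⟨l, h⟩ else 0) (mem_tupleList.2
          ⟨fun l hl => by simpa [hl] using ht ⟨l, hl⟩, fun l hl => by simp [not_lt.2 hl]⟩)).gap i hi j hj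
        simp only [slope, Fin.is_lt, dite_true] at this
        exact this hlt
      · simp only [epsE, QExpr.eval, IExpr.eval, powE_eval, r4, State.setQ_qmem, and_self, if_true]
        rw [sq, sq]

end ConvexOpt

namespace ConvexOpt

open Finset

variable {n d : ℕ} {E : Env n d}

/-! ### The enumeration of the functionals -/

/-- The entry `l` of the functional of the tuple in the counters. -/
def funcE (d : ℕ) (l : Fin d) : QExpr :=
  .mul (tupleE d (counters d)) (detE d fun k c =>
    if c = l then powE (.var 9) k else .get 2 (counters d k) (.const c))

theorem counters_eval {s : State n d} {t : Fin d → ℕ}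
    (ht : ∀ k : Fin d, s.imem (100 + k) 0 0 = t k) : (fun k => (counters d k).eval s) = t :=
  funext ht

theorem funcE_eval {s : State n d} {t : Fin d → ℕ} (ht : ∀ k : Fin d, s.imem (100 + k) 0 0 = t k)
    (l : Fin d) :
    (funcE d l).eval s = tupleFunctional (s.row d 2) (s.qmem 9 0 0) t l := by
  rw [funcE, QExpr.eval, tupleE_eval, counters_eval ht, detE_eval, tupleFunctional, Pi.smul_apply,
    smul_eq_mul, Matrix.cramer_apply]
  congr 2
  ext k c
  rw [Matrix.of_apply, Matrix.updateCol_apply]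
  split_ifs with h
  · rw [powE_eval]; rfl
  · rw [QExpr.eval, congrFun (counters_eval ht) k]; rfl

theorem funcE_reads {l : Fin d} {x : ℕ} (h : (funcE d l).Reads x) : x = 2 ∨ x = 9 := by
  rcases h with h | h
  · exact Or.inl (tupleE_reads h)
  · obtain ⟨k, c, h⟩ := detE_reads h
    split_ifs at h
    · exact Or.inr (powE_reads h)
    · exact Or.inl h

def funcCmd (d : ℕ) : Cmd :=
  .each (fun l => .qset 10 (.const 0) (.const l)
    (if h : l < d then funcE d ⟨l, h⟩ else .const 0)) d

def queryE (d : ℕ) : QExpr :=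
  sumE d fun l => .mul (.get 10 (.const 0) (.const l)) (.get 0 (.var 20) (.const l))

def queryCmd (d : ℕ) : Cmd := .for 20 (.var 0) (.qset 11 (.const 0) (.var 20) (queryE d))

def weightCmd (l : ℕ) : Cmd :=
  .seq (.qset 12 (.const 0) (.const l) (.const 0))
    (.for 20 (.var 0) (.ite (.ilt (.const 0) (.get 15 (.const 0) (.var 20)))
      (.qset 12 (.const 0) (.const l)
        (.add (.get 12 (.const 0) (.const l)) (.get 0 (.var 20) (.const l)))) .skip))

def weightsCmd (d : ℕ) : Cmd := .each weightCmd d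

def copyCmd : Cmd :=
  .seq (.qassign 14 (.var 13)) (.seq (.iassign 16 (.const 1))
    (.for 20 (.var 0) (.iset 2 (.const 0) (.var 20) (.get 15 (.const 0) (.var 20)))))

/-- Cell 16 tells whether an answer has been stored at all: values of `c` may be arbitrarily
negative, so no initial value could stand for minus infinity. -/
def updateCmd : Cmd :=
  .ite (.ilt (.const 0) (.var 16)) (.ite (.qlt (.var 14) (.var 13)) copyCmd .skip) copyCmd

/-- Singular tuples are discarded before any query, so each query comes from a functional in some
normal cone; a vertex may be met repeatedly. -/
def enumBody (d : ℕ) : Cmd :=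
  .ite (.qlt (.const 0) (.mul (tupleE d (counters d)) (tupleE d (counters d))))
    (.seq (funcCmd d) (.seq (queryCmd d) (.seq (.linOpt 11 (.const 0) 15 (.const 0))
      (.seq (weightsCmd d) (.seq (.evalC 12 (.const 0) 13 (.const 0) (.const 0)) updateCmd)))))
    .skip

/-- Exponents for the arrays of the enumeration. -/
structure EnumBounds (E : Env n d) (X K : ℕ) : Prop where
  one_le : 1 ≤ X
  one_le' : 1 ≤ K
  func_le : ∀ l, (funcE d l).cst ≤ K
  query_le : (queryE d).cst ≤ K
  bd0 : E.bd 0 ≤ X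
  bd2 : E.bd 2 ≤ X
  bd9 : E.bd 9 ≤ K ^ 4 * X
  bd10 : E.bd 10 = K ^ 5 * X
  bd11 : E.bd 11 = K ^ 6 * X
  bd14 : E.bd 14 = E.bd 13

theorem funcCmd_iw {x : ℕ} : ¬ (funcCmd d).iw x := by
  rw [funcCmd, Cmd.each_iw]; simp

theorem funcCmd_qw {x : ℕ} (h : (funcCmd d).qw x) : x = 10 := by
  rw [funcCmd, Cmd.each_qw] at h
  obtain ⟨_, _, h⟩ := h
  simpa using h

theorem funcCmd_wp {s : State n d} {X K f : ℕ} {t : Fin d → ℕ} (hE : EnumBounds E X K)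
    (hf : 1 ≤ f) (ht : ∀ k : Fin d, s.imem (100 + k) 0 0 = t k) :
    WP E (funcCmd d) f (fun s' =>
      s'.row d 10 0 = tupleFunctional (s.row d 2) (s.qmem 9 0 0) t) s := by
  refine (WP.each (fun i s' => ∀ l : Fin d, (l : ℕ) < i →
    s'.qmem 10 0 l = tupleFunctional (s.row d 2) (s.qmem 9 0 0) t l) (by simp) ?_).mono le_rfl
    fun s' h => funext fun l => h l l.2
  intro i hi s' hF h
  have hr : s'.row d 2 = s.row d 2 := by
    funext a b; rw [State.row, State.row, hF.qmem 2 (fun h => by have := funcCmd_qw h; omega)]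
  have h9 : s'.qmem 9 = s.qmem 9 := hF.qmem 9 (fun h => by have := funcCmd_qw h; omega)
  have ht' : ∀ k : Fin d, s'.imem (100 + k) 0 0 = t k := fun k => by
    rw [hF.imem _ funcCmd_iw, ht]
  rw [dif_pos hi]
  refine WP.qset hf (fun hs => ?_) fun l hl => ?_
  · have hX : 1 ≤ K ^ 4 * X := Nat.mul_pos (pow_pos hE.one_le' _) hE.one_le
    refine QExpr.height_eval_le' hs hX _ (fun x hx => ?_) ?_
    · rcases funcE_reads hx with rfl | rfl
      · exact hE.bd2.trans (Nat.le_mul_of_pos_left _ (pow_pos hE.one_le' _))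
      · exact hE.bd9
    · rw [hE.bd10, pow_succ' K 4, mul_assoc]
      exact Nat.mul_le_mul_right _ (hE.func_le _)
  · rw [funcE_eval ht', hr, h9]
    simp only [IExpr.eval, State.setQ_qmem, true_and]
    split_ifs with hli
    · congr 1; exact Fin.ext hli.symm
    · exact h l (by omega)

theorem queryCmd_wp {s : State n d} {X K : ℕ} {w : Fin n → Fin d → ℚ} {a : Fin d → ℚ}
    (hE : EnumBounds E X K) (hnM : n ≤ E.M) (h0 : s.imem 0 0 0 = n)
    (hw : ∀ (j : Fin n) (l : Fin d), s.qmem 0 j l = w j l) (ha : s.row d 10 0 = a) :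
    WP E (queryCmd d) (n + 1) (fun s' => s'.row n 11 0 = pullback w a) s := by
  refine WP.for (fb := 1) n (fun j s' => ∀ i : Fin n, (i : ℕ) < j → s'.qmem 11 0 i = pullback w a i)
    (by omega) le_rfl (by simp) hnM (fun s' hF => ?_) (fun _ _ _ h => h) (by simp) ?_
    fun s' h => funext fun l => h l l.2
  · rw [IExpr.eval, hF.imem 0 (by simp)]; exact h0
  intro j hj s' hF hjc h
  have q0 : s'.qmem 0 = s.qmem 0 := hF.qmem 0 (by simp)
  have q10 : s'.qmem 10 = s.qmem 10 := hF.qmem 10 (by simp)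
  refine WP.qset le_rfl (fun hs => ?_) fun i hi => ?_
  · have hX : 1 ≤ K ^ 5 * X := Nat.mul_pos (pow_pos hE.one_le' _) hE.one_le
    refine QExpr.height_eval_le' hs hX _ (fun x hx => ?_) (?_ : (queryE d).cst * _ ≤ _)
    · obtain ⟨l, hx | hx⟩ := sumE_reads hx
      · rw [show x = 10 from hx, hE.bd10]
      · rw [show x = 0 from hx]
        exact hE.bd0.trans (Nat.le_mul_of_pos_left _ (pow_pos hE.one_le' _))
    · rw [hE.bd11, pow_succ' K 5, mul_assoc]
      exact Nat.mul_le_mul_right _ hE.query_le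
  · simp only [queryE, sumE_eval, QExpr.eval, IExpr.eval, State.setQ_qmem, true_and, hjc, q0, q10]
    split_ifs with hij
    · subst hij
      rw [← ha]
      exact Finset.sum_congr rfl fun l _ => by rw [hw]; rfl
    · exact h i (by omega)

theorem weightCmd_iw {l x : ℕ} (h : (weightCmd l).iw x) : x = 20 := by
  simpa [weightCmd] using h

theorem weightCmd_qw {l x : ℕ} (h : (weightCmd l).qw x) : x = 12 := by
  simpa [weightCmd] using h

theorem weight_apply (w : Fin n → Fin d → ℚ) (F : Finset (Fin n)) (l : Fin d) {g : ℕ → ℚ}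
    {ind : ℕ → ℕ} (hg : ∀ j : Fin n, g j = w j l)
    (hi : ∀ j : Fin n, ind j = if j ∈ F then 1 else 0) :
    weight w F l = ∑ t ∈ (range n).filter (fun t => 0 < ind t), g t := by
  classical
  rw [weight, Finset.sum_apply, Finset.sum_filter, Finset.sum_range, ← Finset.sum_filter]
  refine Finset.sum_congr ?_ fun j _ => (hg j).symm
  ext j
  simp only [Finset.mem_filter, Finset.mem_univ, true_and, hi]
  split_ifs with h <;> simp [h]

/-- Whatever set the oracle returns, the accumulator holds sums of `w` over subsets, whose heights
`hW` bounds in advance. -/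
theorem weightsCmd_wp {s : State n d} {w : Fin n → Fin d → ℚ} {F : Finset (Fin n)}
    (hnM : n ≤ E.M) (h0 : s.imem 0 0 0 = n)
    (hw : ∀ (j : Fin n) (l : Fin d), s.qmem 0 j l = w j l)
    (hi : ∀ j : Fin n, s.imem 15 0 j = if j ∈ F then 1 else 0)
    (hW : ∀ S ⊆ range n, ∀ l < d, height (∑ t ∈ S, s.qmem 0 t l) ≤ 2 ^ E.bd 12) :
    WP E (weightsCmd d) (n + 1) (fun s' => s'.row d 12 0 = weight w F) s := by
  have hf : 1 ≤ n + 1 := by omega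
  refine (WP.each (fun i s' => ∀ l : Fin d, (l : ℕ) < i → s'.qmem 12 0 l = weight w F l) (by simp)
    ?_).mono le_rfl fun s' h => funext fun l => h l l.2
  intro i hid s₁ hF₁ h
  have iw : ∀ x, x ≠ 20 → ¬ (Cmd.each weightCmd d).iw x := fun x hx hw => by
    obtain ⟨_, _, h⟩ := Cmd.each_iw.1 hw
    exact hx (weightCmd_iw h)
  have qw : ∀ x, x ≠ 12 → ¬ (Cmd.each weightCmd d).qw x := fun x hx hw => by
    obtain ⟨_, _, h⟩ := Cmd.each_qw.1 hw
    exact hx (weightCmd_qw h)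
  have i0 := hF₁.imem 0 (iw 0 (by omega))
  have i15 := hF₁.imem 15 (iw 15 (by omega))
  have q0 := hF₁.qmem 0 (qw 0 (by omega))
  refine WP.seq (WP.qset hf (fun _ => Nat.one_le_two_pow) ?_)
  simp only [IExpr.eval, QExpr.eval]
  refine WP.for (fb := 1) n (fun j s' => (∀ l : Fin d, (l : ℕ) < i → s'.qmem 12 0 l = weight w F l) ∧
      s'.qmem 12 0 i = ∑ t ∈ (range j).filter (fun t => 0 < s.imem 15 0 t), s.qmem 0 t i)
    (by omega) le_rfl (by simp) hnM (fun s' hF => ?_) (fun _ _ _ h => h) ?_ ?_ ?_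
  · rw [IExpr.eval, hF.imem 0 (by simp)]
    simp [IExpr.eval, i0, h0]
  · refine ⟨fun l hl => ?_, by simp⟩
    simp only [State.setQ_qmem, true_and]
    rw [if_neg hl.ne, h l hl]
  · rintro j hj s₂ hF₂ hjc ⟨h1, h2⟩
    have j15 : s₂.imem 15 = s.imem 15 := by rw [hF₂.imem 15 (by simp), ← i15]; rfl
    have r0 : s₂.qmem 0 = s.qmem 0 := by
      rw [hF₂.qmem 0 (by simp), ← q0]; funext x y; simp
    have hstep : ∑ t ∈ (range (j + 1)).filter (fun t => 0 < s.imem 15 0 t), s.qmem 0 t i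
        = (∑ t ∈ (range j).filter (fun t => 0 < s.imem 15 0 t), s.qmem 0 t i)
          + if 0 < s.imem 15 0 j then s.qmem 0 j i else 0 := by
      rw [Finset.sum_filter, Finset.sum_range_succ, ← Finset.sum_filter]
    refine WP.ite le_rfl (fun ht => WP.qset le_rfl (fun hs => ?_) ?_) fun ht => WP.skip ?_
    all_goals simp only [Test.holds, IExpr.eval, hjc, j15] at ht
    · simp only [IExpr.eval, QExpr.eval, hjc, r0, h2]
      rw [if_pos ht] at hstep
      rw [← hstep]
      refine hW _ (fun x hx => ?_) i hid
      have := Finset.mem_range.1 (Finset.mem_filter.1 hx).1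
      exact Finset.mem_range.2 (by omega)
    · simp only [IExpr.eval, QExpr.eval, hjc, r0, h2, State.setQ_qmem, true_and, if_true]
      refine ⟨fun l hl => ?_, by rw [hstep, if_pos ht]⟩
      rw [if_neg hl.ne, h1 l hl]
    · exact ⟨h1, by rw [h2, hstep, if_neg ht, add_zero]⟩
  · rintro s' ⟨h1, h2⟩ l hl
    rcases Nat.lt_succ_iff_lt_or_eq.1 hl with hl | rfl
    · exact h1 l hl
    · rw [h2, weight_apply w F l (g := fun t => s.qmem 0 t l) (fun j => hw j l) hi]

/-! ### Invariant of the enumeration. -/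

/-- The queries made are those for the functionals `fnl`, and the output is an answer of largest
value. -/
structure EnumInv (w : Fin n → Fin d → ℚ) (O : (Fin n → ℚ) → Finset (Fin n))
    (c : (Fin d → ℚ) → ℚ) (fnl : List (Fin d → ℚ)) (s : State n d) : Prop where
  lin : s.linLog = fnl.map (pullback w)
  ev : s.evalLog = s.linLog.map fun b => weight w (O b)
  none : s.imem 16 0 0 = 0 → fnl = []
  mem : s.imem 16 0 0 ≠ 0 → s.output ∈ s.linLog.map O
  val : s.imem 16 0 0 ≠ 0 → s.qmem 14 0 0 = c (weight w s.output)
  max : s.imem 16 0 0 ≠ 0 → ∀ F ∈ s.linLog.map O, c (weight w F) ≤ s.qmem 14 0 0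

theorem copyCmd_wp {s : State n d} {F : Finset (Fin n)} {f : ℕ} (hf : n + 1 ≤ f)
    (hnM : n ≤ E.M) (hM : 1 ≤ E.M) (h14 : E.bd 14 = E.bd 13) (h0 : s.imem 0 0 0 = n)
    (hi : ∀ j : Fin n, s.imem 15 0 j = if j ∈ F then 1 else 0) :
    WP E copyCmd f (fun s' => s'.output = F ∧ s'.qmem 14 0 0 = s.qmem 13 0 0 ∧
      s'.imem 16 0 0 = 1) s := by
  have hf1 : 1 ≤ f := by omega
  refine WP.seq (WP.qset hf1 (fun hs => h14 ▸ hs.qmem _ _ _) (WP.seq (WP.iset hf1 hM ?_)))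
  simp only [IExpr.eval, QExpr.eval]
  set s₁ := (s.setQ 14 0 0 (s.qmem 13 0 0)).setI 16 0 0 1 with hs₁
  refine (WP.for (fb := 1) n (fun j s' => ∀ i < j, s'.imem 2 0 i = s.imem 15 0 i) (by omega)
    le_rfl (by simp) hnM (fun s' hF => ?_) (fun k s' v h => by simpa using h) (by simp) ?_
    fun _ h => h).frame.mono le_rfl ?_
  · rw [IExpr.eval, hF.imem 0 (by simp)]
    simp [IExpr.eval, hs₁, h0]
  · intro j hj s' hF hjc h
    have i15 : s'.imem 15 = s.imem 15 := by
      rw [hF.imem 15 (by simp)]; funext x y; simp [hs₁]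
    refine WP.of_sized fun hs => WP.iset le_rfl (hs.imem _ _ _) fun i hi => ?_
    simp only [IExpr.eval, hjc, State.setI_imem, i15, true_and]
    split_ifs with hij
    · rw [hij]
    · exact h i (by omega)
  · rintro s' ⟨h, hF⟩
    refine ⟨?_, ?_, ?_⟩
    · ext j
      rw [State.output, Finset.mem_filter, h j j.2, hi]
      split_ifs with hj <;> simp [hj]
    · rw [hF.qmem 14 (by simp)]; simp [hs₁]
    · rw [hF.imem 16 (by simp)]; simp [hs₁]

/-- The height bound `hc` is asked for nonsingular tuples only, because only answers to queries
actually made count as input. -/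
theorem enumBody_wp {s : State n d} {X K : ℕ} {w : Fin n → Fin d → ℚ} {t : Fin d → ℕ}
    {r : ℕ → Fin d → ℚ} {ε : ℚ} {fnl : List (Fin d → ℚ)}
    (hE : EnumBounds E X K) (hnM : n ≤ E.M) (hM : 1 ≤ E.M) (h0 : s.imem 0 0 0 = n)
    (hw : ∀ (j : Fin n) (l : Fin d), s.qmem 0 j l = w j l)
    (hW : ∀ S ⊆ range n, ∀ l < d, height (∑ t ∈ S, s.qmem 0 t l) ≤ 2 ^ E.bd 12)
    (hr : s.row d 2 = r) (hε : s.qmem 9 0 0 = ε)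
    (ht : ∀ k : Fin d, s.imem (100 + k) 0 0 = t k)
    (hc : tupleDet r t ≠ 0 →
      height (E.c (weight w (E.O (pullback w (tupleFunctional r ε t))))) ≤ 2 ^ E.bd 13)
    (h : EnumInv w E.O E.c fnl s) :
    WP E (enumBody d) ((d + 1) * (n + 1))
      (EnumInv w E.O E.c (fnl ++ if tupleDet r t = 0 then [] else [tupleFunctional r ε t])) s := by
  have hf1 : 1 ≤ (d + 1) * (n + 1) := Nat.mul_pos (by omega) (by omega)
  have hfn : n + 1 ≤ (d + 1) * (n + 1) := Nat.le_mul_of_pos_left _ (by omega)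
  have hfd : d + 1 ≤ (d + 1) * (n + 1) := Nat.le_mul_of_pos_right _ (by omega)
  refine WP.ite hf1 (fun hdet => ?_) fun hdet => ?_
  all_goals
    simp only [Test.holds, QExpr.eval, tupleE_eval, counters_eval ht, hr, zero_lt_mul_self_iff,
      not_not] at hdet
  swap
  · rw [if_pos hdet, List.append_nil]
    exact WP.skip h
  rw [if_neg hdet]
  have hc := hc hdet
  set a := tupleFunctional r ε t with ha
  set F := E.O (pullback w a) with hF
  refine WP.seq' (funcCmd_wp hE hf1 ht) fun s₁ F₁ ha₁ => ?_
  rw [hr, hε, ← ha] at ha₁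
  have i₁ : s₁.imem = s.imem := funext fun x => F₁.imem x funcCmd_iw
  have q₁ : ∀ x, x ≠ 10 → s₁.qmem x = s.qmem x := fun x hx => F₁.qmem x fun h => hx (funcCmd_qw h)
  have l₁ : s₁.linLog = s.linLog := F₁.lin (Cmd.each_quiet fun _ _ => trivial)
  have e₁ : s₁.evalLog = s.evalLog := F₁.ev (Cmd.each_quiet fun _ _ => trivial)
  refine WP.seq' ((queryCmd_wp (w := w) hE hnM (by rw [i₁, h0])
    (by rw [q₁ 0 (by omega)]; exact hw) ha₁).mono hfn fun _ h => h) fun s₂ F₂ hb => ?_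
  have i₂ : ∀ x, x ≠ 20 → s₂.imem x = s.imem x := fun x hx => by
    rw [F₂.imem x (by simp [queryCmd, hx]), i₁]
  have q₂ : ∀ x, x ≠ 10 → x ≠ 11 → s₂.qmem x = s.qmem x := fun x h1 h2 => by
    rw [F₂.qmem x (by simp [queryCmd, h2]), q₁ x h1]
  have l₂ : s₂.linLog = s.linLog := by rw [F₂.lin (by simp [queryCmd]), l₁]
  have e₂ : s₂.evalLog = s.evalLog := by rw [F₂.ev (by simp [queryCmd]), e₁]
  refine WP.seq (WP.linOpt hfn hM ?_)
  simp only [IExpr.eval, hb, ← hF]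
  set s₃ := (s₂.setSet 15 0 F).record [pullback w a] [] with hs₃
  have i₃ : ∀ x, x ≠ 20 → x ≠ 15 → s₃.imem x = s.imem x := fun x h1 h2 => by
    rw [← i₂ x h1]
    funext k l
    simp [hs₃, State.record, State.setSet, h2]
  have ind₃ : ∀ j : Fin n, s₃.imem 15 0 j = if j ∈ F then 1 else 0 := fun j => by
    simp [hs₃, State.record, State.setSet]
  have q₃ : ∀ x, x ≠ 10 → x ≠ 11 → s₃.qmem x = s.qmem x := q₂
  have l₃ : s₃.linLog = s.linLog ++ [pullback w a] := by
    simp [hs₃, State.record, State.setSet, l₂]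
  have e₃ : s₃.evalLog = s.evalLog := by simp [hs₃, State.record, State.setSet, e₂]
  refine WP.seq' ((weightsCmd_wp (w := w) (F := F) hnM (by rw [i₃ 0 (by omega) (by omega), h0])
    (by rw [q₃ 0 (by omega) (by omega)]; exact hw) ind₃
    (by rw [q₃ 0 (by omega) (by omega)]; exact hW)).mono hfn fun _ h => h) fun s₄ F₄ hy => ?_
  have i₄ : ∀ x, x ≠ 20 → s₄.imem x = s₃.imem x := fun x hx => F₄.imem x fun h => by
    obtain ⟨_, _, h⟩ := Cmd.each_iw.1 h
    exact hx (weightCmd_iw h)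
  have q₄ : ∀ x, x ≠ 12 → s₄.qmem x = s₃.qmem x := fun x hx => F₄.qmem x fun h => by
    obtain ⟨_, _, h⟩ := Cmd.each_qw.1 h
    exact hx (weightCmd_qw h)
  have l₄ : s₄.linLog = s.linLog ++ [pullback w a] := by
    rw [F₄.lin (Cmd.each_quiet fun _ _ => by simp [weightCmd]), l₃]
  have e₄ : s₄.evalLog = s.evalLog := by
    rw [F₄.ev (Cmd.each_quiet fun _ _ => by simp [weightCmd]), e₃]
  refine WP.seq (WP.evalC hfd (by simpa [IExpr.eval, hy] using hc) ?_)
  simp only [IExpr.eval, hy]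
  set s₅ := (s₄.setQ 13 0 0 (E.c (weight w F))).record [] [weight w F] with hs₅
  have l₅ : s₅.linLog = s.linLog ++ [pullback w a] := by simp [hs₅, State.record, l₄]
  have e₅ : s₅.evalLog = s.evalLog ++ [weight w F] := by simp [hs₅, State.record, e₄]
  have q13 : s₅.qmem 13 0 0 = E.c (weight w F) := by simp [hs₅, State.record]
  have q14 : s₅.qmem 14 0 0 = s.qmem 14 0 0 := by
    rw [← q₃ 14 (by omega) (by omega), ← q₄ 14 (by omega)]
    simp [hs₅, State.record]
  have i16 : s₅.imem 16 0 0 = s.imem 16 0 0 := by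
    rw [← i₃ 16 (by omega) (by omega), ← i₄ 16 (by omega)]; rfl
  have i2 : s₅.imem 2 = s.imem 2 := by
    rw [← i₃ 2 (by omega) (by omega), ← i₄ 2 (by omega)]; rfl
  have i0 : s₅.imem 0 0 0 = n := by
    refine Eq.trans ?_ h0
    rw [← i₃ 0 (by omega) (by omega), ← i₄ 0 (by omega)]; rfl
  have ind₅ : ∀ j : Fin n, s₅.imem 15 0 j = if j ∈ F then 1 else 0 := fun j => by
    rw [← ind₃ j, ← i₄ 15 (by omega)]; rfl
  have hlin : s.linLog ++ [pullback w a] = (fnl ++ [a]).map (pullback w) := by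
    rw [List.map_append, h.lin]; rfl
  have hev : s.evalLog ++ [weight w F]
      = (s.linLog ++ [pullback w a]).map fun b => weight w (E.O b) := by
    rw [List.map_append, h.ev]; rfl
  have hmem : ∀ {G}, G ∈ (s.linLog ++ [pullback w a]).map E.O ↔ G ∈ s.linLog.map E.O ∨ G = F := by
    intro G
    rw [List.map_append, List.mem_append]
    simp [hF]
  -- Common to the two branches that store the new answer: either none was stored before, or the
  -- stored one is worse.
  have copy : (s.imem 16 0 0 ≠ 0 → s.qmem 14 0 0 < E.c (weight w F)) →
      WP E copyCmd ((d + 1) * (n + 1)) (EnumInv w E.O E.c (fnl ++ [a])) s₅ := by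
    intro hlt
    refine (copyCmd_wp hfn hnM hM hE.bd14 i0 ind₅).frame.mono le_rfl ?_
    rintro s₆ ⟨⟨g1, g2, g3⟩, F₆⟩
    have l₆ : s₆.linLog = s.linLog ++ [pullback w a] := by rw [F₆.lin (by simp [copyCmd]), l₅]
    have e₆ : s₆.evalLog = s.evalLog ++ [weight w F] := by rw [F₆.ev (by simp [copyCmd]), e₅]
    rw [q13] at g2
    refine ⟨by rw [l₆, hlin], by rw [l₆, e₆, hev], fun h => by omega, fun _ => ?_, fun _ => ?_,
      fun _ G hG => ?_⟩
    · rw [l₆, g1, hmem]; exact Or.inr rfl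
    · rw [g2, g1]
    · rw [l₆, hmem] at hG
      rw [g2]
      rcases hG with hG | rfl
      · by_cases h16 : s.imem 16 0 0 = 0
        · rw [h.lin, h.none h16] at hG
          simp at hG
        · exact (h.max h16 G hG).trans (hlt h16).le
      · exact le_rfl
  refine WP.ite hf1 (fun t1 => WP.ite hf1 (fun t2 => ?_) fun t2 => WP.skip ?_) fun t1 => ?_
  all_goals simp only [Test.holds, IExpr.eval, i16] at t1
  · simp only [Test.holds, QExpr.eval, IExpr.eval, q13, q14] at t2
    exact copy fun _ => t2
  · simp only [Test.holds, QExpr.eval, IExpr.eval, q13, q14, not_lt] at t2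
    have hout : s₅.output = s.output := by rw [State.output, State.output, i2]
    have h16 : s.imem 16 0 0 ≠ 0 := by omega
    refine ⟨by rw [l₅, hlin], by rw [l₅, e₅, hev], fun h => absurd (i16 ▸ h) h16, fun _ => ?_,
      fun _ => ?_, fun _ G hG => ?_⟩
    · rw [l₅, hout, hmem]; exact Or.inl (h.mem h16)
    · rw [q14, hout]; exact h.val h16
    · rw [l₅, hmem] at hG
      rw [q14]
      rcases hG with hG | rfl
      · exact h.max h16 G hG
      · exact t2
  · exact copy fun h => absurd (Nat.pos_of_ne_zero h) t1

theorem enumBody_iw {x : ℕ} (h : (enumBody d).iw x) :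
    x = 2 ∨ x = 15 ∨ x = 16 ∨ x = 20 := by
  have hw : ¬ (weightsCmd d).iw x ∨ x = 20 := by
    by_cases h : (weightsCmd d).iw x
    · obtain ⟨_, _, h⟩ := Cmd.each_iw.1 h
      exact Or.inr (weightCmd_iw h)
    · exact Or.inl h
  have hf := funcCmd_iw (d := d) (x := x)
  simp [enumBody, queryCmd, updateCmd, copyCmd, hf] at h
  rcases hw with hw | hw
  · simp [hw] at h
    omega
  · omega

theorem enumBody_qw {x : ℕ} (h : (enumBody d).qw x) : 10 ≤ x := by
  have hw : ¬ (weightsCmd d).qw x ∨ x = 12 := by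
    by_cases h : (weightsCmd d).qw x
    · obtain ⟨_, _, h⟩ := Cmd.each_qw.1 h
      exact Or.inr (weightCmd_qw h)
    · exact Or.inl h
  by_cases hf : (funcCmd d).qw x
  · exact (funcCmd_qw hf).ge
  simp [enumBody, queryCmd, updateCmd, copyCmd, hf] at h
  rcases hw with hw | hw
  · simp [hw] at h
    omega
  · omega

/-- The enumeration of all tuples. -/
def enumCmd (d : ℕ) : Cmd :=
  .nest (fun j => if j < 1 then .const (2 * d) else .var 9) (enumBody d) d

/-- The tuples that the program enumerates, in order. -/
def enumTuples (d N : ℕ) : List (Fin d → ℕ) :=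
  (tupleList (fun j => if j < 1 then 2 * d else N) d 0).map fun σ k => σ k

theorem mem_enumTuples {N : ℕ} {t : Fin d → ℕ} : t ∈ enumTuples d N ↔ ValidTuple d N t := by
  rw [enumTuples, List.mem_map]
  constructor
  · rintro ⟨σ, hσ, rfl⟩ k
    have := (mem_tupleList.1 hσ).1 k k.2
    simpa [Nat.lt_one_iff] using this
  · intro h
    refine ⟨fun l => if h : l < d then t ⟨l, h⟩ else 0, mem_tupleList.2
      ⟨fun l hl => by simpa [hl, Nat.lt_one_iff] using h ⟨l, hl⟩, fun l hl => by
        simp [not_lt.2 hl]⟩, ?_⟩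
    funext k
    simp

/-- The functionals of the tuples with nonzero determinant. -/
def functionals (r : ℕ → Fin d → ℚ) (ε : ℚ) (L : List (Fin d → ℕ)) : List (Fin d → ℚ) :=
  (L.filter fun t => tupleDet r t ≠ 0).map (tupleFunctional r ε)

theorem enumCmd_wp {s : State n d} {X K N : ℕ} {w : Fin n → Fin d → ℚ}
    {r : ℕ → Fin d → ℚ} {ε : ℚ}
    (hE : EnumBounds E X K) (hnM : n ≤ E.M) (hM : 1 ≤ E.M) (hNM : N ≤ E.M) (hdM : 2 * d ≤ E.M)
    (h0 : s.imem 0 0 0 = n)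
    (hw : ∀ (j : Fin n) (l : Fin d), s.qmem 0 j l = w j l)
    (hW : ∀ S ⊆ range n, ∀ l < d, height (∑ t ∈ S, s.qmem 0 t l) ≤ 2 ^ E.bd 12)
    (hr : s.row d 2 = r) (hε : s.qmem 9 0 0 = ε) (h9 : 2 ≤ d → s.imem 9 0 0 = N)
    (hc : ∀ a ∈ functionals r ε (enumTuples d N),
      height (E.c (weight w (E.O (pullback w a)))) ≤ 2 ^ E.bd 13)
    (h16 : s.imem 16 0 0 = 0) (hl : s.linLog = []) (he : s.evalLog = []) :
    WP E (enumCmd d)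
      ((∏ j ∈ range d, ((if j < 1 then 2 * d else N) + 1)) * ((d + 1) * (n + 1)))
      (EnumInv w E.O E.c (functionals r ε (enumTuples d N))) s := by
  have iw : ∀ {x e}, x ≠ 2 → x < 15 → ¬ (Cmd.nest e (enumBody d) d).iw x := by
    intro x e hx1 hx2 h
    rw [Cmd.nest_iw] at h
    rcases h with h | ⟨_, _, h⟩
    · have := enumBody_iw h; omega
    · omega
  have qw : ∀ {x e}, x < 10 → ¬ (Cmd.nest e (enumBody d) d).qw x := by
    intro x e hx h
    rw [Cmd.nest_qw] at h
    have := enumBody_qw h; omega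
  have key := WP.nest (E := E) (p := enumBody d) (s := s) (D := d)
    (b := fun j => if j < 1 then .const (2 * d) else .var 9)
    (fun j => if j < 1 then 2 * d else N)
    (fun done s' => EnumInv w E.O E.c (functionals r ε (done.map fun σ (k : Fin d) => σ k)) s')
    (f := (∏ j ∈ range d, ((if j < 1 then 2 * d else N) + 1)) * ((d + 1) * (n + 1))) le_rfl
    (Nat.mul_pos (by omega) (by omega)) (fun j _ h => by
      have := enumBody_iw h; omega) (fun j _ => by split_ifs <;> assumption)
    (fun j hj s' hF => ?_) ?_ ?_ ?_
  · exact key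
  · split_ifs with h
    · rfl
    · rw [IExpr.eval, hF.imem 9 (iw (by omega) (by omega))]; exact h9 (by omega)
  · rintro done s' j v ⟨g1, g2, g3, g4, g5, g6⟩
    have hn : ¬ (16 = 100 + j) := by omega
    have hn2 : ¬ (2 = 100 + j) := by omega
    have e16 : (s'.setI (100 + j) 0 0 v).imem 16 0 0 = s'.imem 16 0 0 := by simp [hn]
    have eo : (s'.setI (100 + j) 0 0 v).output = s'.output := by
      simp [State.output, hn2]
    exact ⟨g1, g2, by rwa [e16], by rw [e16, eo]; exact g4, by rw [e16, eo]; exact g5,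
      by rw [e16]; exact g6⟩
  · exact ⟨by rw [hl]; rfl, by rw [hl, he]; rfl, fun _ => rfl, fun h => absurd h16 h,
      fun h => absurd h16 h, fun h => absurd h16 h⟩
  · intro done σ s' hF hcnt hσ hI
    have hr' : s'.row d 2 = r := by
      rw [← hr]; funext i l; rw [State.row, State.row, hF.qmem 2 (qw (by omega))]
    refine (enumBody_wp (w := w) (t := fun k => σ k) (r := r) (ε := ε) hE hnM hM ?_ ?_ ?_ hr' ?_
      (fun k => hcnt k k.2) (fun hdet => hc _ ?_) hI).mono le_rfl fun s'' h => ?_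
    · rw [hF.imem 0 (iw (by omega) (by omega)), h0]
    · rw [hF.qmem 0 (qw (by omega))]; exact hw
    · rw [hF.qmem 0 (qw (by omega))]; exact hW
    · rw [hF.qmem 9 (qw (by omega)), hε]
    · refine List.mem_map_of_mem (List.mem_filter.2 ⟨mem_enumTuples.2 fun k => ?_, by simpa⟩)
      have := hσ k k.2
      simpa [Nat.lt_one_iff] using this
    · have e : functionals r ε ((done ++ [σ]).map fun σ (k : Fin d) => σ k)
          = functionals r ε (done.map fun σ (k : Fin d) => σ k) ++
            if tupleDet r (fun k : Fin d => σ k) = 0 then []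
            else [tupleFunctional r ε fun k : Fin d => σ k] := by
        rw [List.map_append, functionals, List.filter_append, List.map_append, ← functionals]
        congr 1
        by_cases hdet : tupleDet r (fun k : Fin d => σ k) = 0 <;> simp [hdet]
      rw [e]
      exact h

end ConvexOpt

namespace ConvexOpt

open Finset

variable {n d : ℕ} {E : Env n d}

/-! ### Edges join indicator vectors -/

/-- An endpoint of an edge is an extreme point: if it is a proper convex combination, both points
are maximizers, so both lie on the edge, displaced from the endpoint towards the other end;
displacements in one direction cancel only if they vanish. Extreme points of a convex hull are among
the generating points. -/
theorem IsEdge.left_mem {𝓕 : Set (Finset (Fin n))} {u v : Fin n → ℚ}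
    (h : IsEdge (familyPolytope 𝓕) u v) : u ∈ indicatorVec '' 𝓕 := by
  obtain ⟨hne, a, ha⟩ := h
  have ha : {x | x ∈ familyPolytope 𝓕 ∧ ∀ y ∈ familyPolytope 𝓕, a ⬝ᵥ y ≤ a ⬝ᵥ x}
    = segment ℚ u v := ha
  have hu := ha.symm ▸ left_mem_segment ℚ u v
  refine extremePoints_convexHull_subset (𝕜 := ℚ) ?_
  refine mem_extremePoints.2 ⟨hu.1, fun x hx y hy hxy => ?_⟩
  obtain ⟨p, q, hp, hq, hpq, rfl⟩ := hxy
  have hmax : a ⬝ᵥ x = a ⬝ᵥ (p • x + q • y) ∧ a ⬝ᵥ y = a ⬝ᵥ (p • x + q • y) := by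
    have h1 := hu.2 x hx
    have h2 := hu.2 y hy
    simp only [dotProduct_add, dotProduct_smul, smul_eq_mul] at h1 h2 ⊢
    have h3 : q = 1 - p := by linarith
    subst h3
    constructor <;> nlinarith
  have key : ∀ z ∈ familyPolytope 𝓕, a ⬝ᵥ z = a ⬝ᵥ (p • x + q • y) →
      ∃ t : ℚ, 0 ≤ t ∧ z = (p • x + q • y) + t • (v - (p • x + q • y)) := by
    intro z hz hze
    have : z ∈ segment ℚ (p • x + q • y) v := by
      rw [← ha]
      exact ⟨hz, fun y' hy' => (hu.2 y' hy').trans hze.ge⟩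
    rw [segment_eq_image'] at this
    obtain ⟨t, ht, rfl⟩ := this
    exact ⟨t, ht.1, rfl⟩
  obtain ⟨t₁, ht₁, e₁⟩ := key x hx hmax.1
  obtain ⟨t₂, ht₂, e₂⟩ := key y hy hmax.2
  set u := p • x + q • y with hu'
  have h0 : (p * t₁ + q * t₂) • (v - u) = 0 := by
    have e : u = p • (u + t₁ • (v - u)) + q • (u + t₂ • (v - u)) := by
      rw [← e₁, ← e₂]
    have e' : p • (u + t₁ • (v - u)) + q • (u + t₂ • (v - u))
        = (p + q) • u + (p * t₁ + q * t₂) • (v - u) := by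
      module
    rw [e', hpq, one_smul] at e
    exact left_eq_add.1 e
  rcases smul_eq_zero.1 h0 with h | h
  · have h1 := mul_nonneg hp.le ht₁
    have h2 := mul_nonneg hq.le ht₂
    have h3 : p * t₁ = 0 := by linarith
    have h4 : q * t₂ = 0 := by linarith
    rw [(mul_eq_zero.1 h3).resolve_left hp.ne', zero_smul, add_zero] at e₁
    rw [(mul_eq_zero.1 h4).resolve_left hq.ne', zero_smul, add_zero] at e₂
    exact ⟨e₁, e₂⟩
  · exact absurd (sub_eq_zero.1 h).symm hne

theorem IsEdge.symm {P : Set (Fin n → ℚ)} {u v : Fin n → ℚ} (h : IsEdge P u v) : IsEdge P v u :=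
  ⟨h.1.symm, by rw [segment_symm]; exact h.2⟩

/-! ### The selected directions suffice -/

/-- An edge joins indicator vectors, so the entries of its direction are 0 and one number up to
sign. It therefore has a sign pattern, and the selected vector of that pattern is parallel to it. -/
theorem edgeGuaranteed_of_selected {m M : ℕ} {𝓕 : Set (Finset (Fin n))} {e : Fin m → Fin n → ℚ}
    {x : ℕ → ℕ → ℚ} {sel : ℕ → ℕ} {I : Finset (Fin m)} (hx : ∀ (i : Fin m) (j : Fin n), x i j = e i j)
    (hsel : Selected x n m M sel) (hI : ∀ i, i ∈ I ↔ ∃ k < M, sel k = i)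
    (h : EdgeGuaranteed 𝓕 e) : EdgeGuaranteed 𝓕 fun i : I => e i := by
  refine ⟨h.1, fun u v huv => ?_⟩
  obtain ⟨i, r, hr, hi⟩ := h.2 u v huv
  by_cases hm : m ≤ 3 ^ n
  · obtain ⟨h1, h2⟩ := hsel.eq hm
    exact ⟨⟨i, (hI i).2 ⟨i, by omega, h2 i (by omega)⟩⟩, r, hr, hi⟩
  have hentry : ∀ l < n, x i l = 0 ∨ x i l = r ∨ x i l = -r := by
    intro l hl
    obtain ⟨F, -, hF⟩ := huv.left_mem
    obtain ⟨G, -, hG⟩ := huv.symm.left_mem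
    rw [hx i ⟨l, hl⟩, hi, ← hF, ← hG]
    simp only [Pi.smul_apply, Pi.sub_apply, indicatorVec, smul_eq_mul]
    split_ifs <;> simp
  obtain ⟨hok, -⟩ := signState_ok hr hentry
  obtain ⟨k, hk, hok', hpat⟩ := hsel.cover (by omega) i i.2 hok
  have hpar := signState_parallel hok' hok hpat
  set f := (signState (x i) n).1 with hf
  set g := (signState (x (sel k)) n).1 with hg
  have hf0 : f ≠ 0 := by
    intro h0
    refine huv.1 (sub_eq_zero.1 ?_).symm
    have : e i = 0 := by
      funext l
      rw [← hx]
      exact signState_fst_eq_zero h0 l l.2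
    rw [hi] at this
    exact (smul_eq_zero.1 this).resolve_left hr
  have hg0 : g ≠ 0 := by
    intro h0
    exact hf0 ((signState_eq_zero_iff hok).2 (hpat ▸ (signState_eq_zero_iff hok').1 h0))
  -- The quotient of the first nonzero entries is the factor between the two parallel vectors.
  refine ⟨⟨⟨sel k, hsel.lt k hk⟩, (hI _).2 ⟨k, hk, rfl⟩⟩, g / f * r,
    mul_ne_zero (div_ne_zero hg0 hf0) hr, ?_⟩
  rw [mul_smul, ← hi]
  funext l
  have := hpar l l.2
  rw [hx i l, hx ⟨sel k, hsel.lt k hk⟩ l] at this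
  rw [Pi.smul_apply, smul_eq_mul]
  field_simp
  linarith

/-! ### Heights of sums -/

theorem height_sum_le {ι : Type} (S : Finset ι) (g : ι → ℚ) (h : ι → ℕ)
    (hg : ∀ i ∈ S, height (g i) ≤ 2 ^ h i) : height (∑ i ∈ S, g i) ≤ 2 ^ ∑ i ∈ S, h i := by
  classical
  induction S using Finset.induction_on with
  | empty => simp [height_zero]
  | insert a S ha ih =>
    rw [Finset.sum_insert ha, Finset.sum_insert ha, pow_add]
    exact (height_add _ _).trans (Nat.mul_le_mul (hg a (Finset.mem_insert_self _ _))
      (ih fun i hi => hg i (Finset.mem_insert_of_mem hi)))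

section input

variable {m : ℕ} (w : Fin n → Fin d → ℚ) (e : Fin m → Fin n → ℚ)

theorem initState_w (j : Fin n) (l : Fin d) : (initState w e).qmem 0 j l = w j l := by
  simp [initState]

theorem initState_e (i : Fin m) (j : Fin n) : (initState w e).qmem 1 i j = e i j := by
  simp [initState]

theorem sum_ratSize_le {S : Finset ℕ} (hS : S ⊆ range n) {g : ℕ → ℕ} {T : ℕ}
    (h : ∑ j : Fin n, g j ≤ T) : ∑ t ∈ S, g t ≤ T :=
  (Finset.sum_le_sum_of_subset hS).trans ((Finset.sum_range g).trans_le h)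

/-- The exponent of a sum is at most the total bit length of its summands, which are distinct parts
of the input; a chain of binary bounds would not be needed. -/
theorem height_sum_weights_le {S : Finset ℕ} (hS : S ⊆ range n) {l : ℕ} (hl : l < d) :
    height (∑ t ∈ S, (initState w e).qmem 0 t l) ≤ 2 ^ inputSize w e := by
  refine (height_sum_le S _ (fun t => ratSize ((initState w e).qmem 0 t l)) fun t _ =>
    height_le_two_pow _).trans (Nat.pow_le_pow_right (by norm_num) (sum_ratSize_le hS ?_))
  have h1 : ∑ j : Fin n, ratSize ((initState w e).qmem 0 j l)
      ≤ ∑ j, ∑ t, ratSize (w j t) := Finset.sum_le_sum fun j _ => by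
    rw [initState_w w e j ⟨l, hl⟩]
    exact Finset.single_le_sum (f := fun t => ratSize (w j t)) (fun _ _ => Nat.zero_le _)
      (Finset.mem_univ _)
  unfold inputSize
  omega

theorem height_sum_row_le {i l j : ℕ} (hi : i < m) (hl : l < d) (hj : j ≤ n) :
    height (∑ t ∈ range j, (initState w e).qmem 1 i t * (initState w e).qmem 0 t l)
      ≤ 2 ^ inputSize w e := by
  refine (height_sum_le _ _ (fun t => ratSize ((initState w e).qmem 1 i t)
    + ratSize ((initState w e).qmem 0 t l)) fun t _ => ?_).trans
    (Nat.pow_le_pow_right (by norm_num) (sum_ratSize_le (Finset.range_subset_range.2 hj) ?_))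
  · rw [pow_add]
    exact (height_mul _ _).trans (Nat.mul_le_mul (height_le_two_pow _) (height_le_two_pow _))
  rw [Finset.sum_add_distrib]
  have h1 : ∑ j : Fin n, ratSize ((initState w e).qmem 0 j l)
      ≤ ∑ j, ∑ t, ratSize (w j t) := Finset.sum_le_sum fun j _ => by
    rw [initState_w w e j ⟨l, hl⟩]
    exact Finset.single_le_sum (f := fun t => ratSize (w j t)) (fun _ _ => Nat.zero_le _)
      (Finset.mem_univ _)
  have h2 : ∑ j : Fin n, ratSize ((initState w e).qmem 1 i j)
      ≤ ∑ i, ∑ j, ratSize (e i j) := by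
    have : ∑ j : Fin n, ratSize ((initState w e).qmem 1 i j) = ∑ j, ratSize (e ⟨i, hi⟩ j) :=
      Finset.sum_congr rfl fun j _ => by rw [← initState_e w e ⟨i, hi⟩ j]
    rw [this]
    exact Finset.single_le_sum (f := fun i => ∑ j, ratSize (e i j)) (fun _ _ => Nat.zero_le _)
      (Finset.mem_univ _)
  unfold inputSize
  omega

theorem height_initState_le (a i j : ℕ) :
    height ((initState w e).qmem a i j) ≤ 2 ^ inputSize w e := by
  have hz : height 0 ≤ 2 ^ inputSize w e := Nat.one_le_two_pow
  simp only [initState]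
  split_ifs with h1 h2 h2 h3
  · have := height_sum_weights_le w e (S := {i}) (by simpa using h2.1) h2.2
    rwa [Finset.sum_singleton, initState_w w e ⟨i, h2.1⟩ ⟨j, h2.2⟩] at this
  · exact hz
  · refine (height_le_two_pow _).trans (Nat.pow_le_pow_right (by norm_num) ?_)
    have k1 : ratSize (e ⟨i, h3.1⟩ ⟨j, h3.2⟩) ≤ ∑ j, ratSize (e ⟨i, h3.1⟩ j) :=
      Finset.single_le_sum (f := fun j => ratSize (e ⟨i, h3.1⟩ j)) (fun _ _ => Nat.zero_le _)
        (Finset.mem_univ _)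
    have k2 : ∑ j, ratSize (e ⟨i, h3.1⟩ j) ≤ ∑ i, ∑ j, ratSize (e i j) :=
      Finset.single_le_sum (f := fun i => ∑ j, ratSize (e i j)) (fun _ _ => Nat.zero_le _)
        (Finset.mem_univ _)
    unfold inputSize
    omega
  · exact hz
  · exact hz

end input

/-! ### The state before the enumeration -/

/-- The functionals to be enumerated are those of a run of the algorithm on the directions in
`I`. -/
structure Prepared {m : ℕ} (w : Fin n → Fin d → ℚ) (e : Fin m → Fin n → ℚ) (I : Finset (Fin m))
    (N : ℕ) (s : State n d) : Prop where
  imem0 : s.imem 0 0 0 = n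
  qmem0 : s.qmem 0 = (initState w e).qmem 0
  flag : s.imem 16 0 0 = 0
  lin : s.linLog = []
  ev : s.evalLog = []
  rows : 2 ≤ d → s.imem 9 0 0 = N
  le : N ≤ 2 * (d + m)
  normal : ∀ a ∈ functionals (s.row d 2) (s.qmem 9 0 0) (enumTuples d N),
    ∃ u, a ∈ normalCone (zone fun i : I => omega w (e i)) {u}
  all_vertices : ∀ u, IsVertex (zone fun i : I => omega w (e i)) u →
    ∃ a ∈ functionals (s.row d 2) (s.qmem 9 0 0) (enumTuples d N),
      a ∈ normalCone (zone fun i : I => omega w (e i)) {u}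
  ne_nil : functionals (s.row d 2) (s.qmem 9 0 0) (enumTuples d N) ≠ []

/-- The rows are compared on valid tuples only, and `ε` only for `2 ≤ d`. This covers dimension one,
where the program computes neither `ε` nor any row beyond the signed unit vectors. -/
theorem functionals_spec {ι : Type} [Fintype ι] {z : ι → Fin d → ℚ}
    {v : ℕ → Fin d → ℚ} {M : ℕ} {η ε : ℚ} {r : ℕ → Fin d → ℚ} (hz : ∀ i, ∃ j < M, v j = z i)
    (hη : Separated (symRows d v) (2 * (d + M)) η)
    (hr : ∀ t, ValidTuple d (2 * (d + M)) t → ∀ k, r (t k) = symRows d v (t k))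
    (hε : 2 ≤ d → ε = η / (2 * d)) :
    (∀ a ∈ functionals r ε (enumTuples d (2 * (d + M))), ∃ u, a ∈ normalCone (zone z) {u}) ∧
    (∀ u, IsVertex (zone z) u → ∃ a ∈ functionals r ε (enumTuples d (2 * (d + M))),
      a ∈ normalCone (zone z) {u}) ∧
    functionals r ε (enumTuples d (2 * (d + M))) ≠ [] := by
  have hmat : ∀ t ∈ enumTuples d (2 * (d + M)), tupleMat r t = tupleMat (symRows d v) t := by
    intro t ht
    funext k
    exact hr t (mem_enumTuples.1 ht) k
  have hpow : ∀ k : Fin d, ε ^ (k : ℕ) = (η / (2 * d)) ^ (k : ℕ) := by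
    intro k
    by_cases hd : 2 ≤ d
    · rw [hε hd]
    · have : (k : ℕ) = 0 := by omega
      rw [this, pow_zero, pow_zero]
  have hdet : ∀ t ∈ enumTuples d (2 * (d + M)), tupleDet r t = tupleDet (symRows d v) t :=
    fun t ht => by rw [tupleDet, hmat t ht, tupleDet]
  have heq : functionals r ε (enumTuples d (2 * (d + M)))
      = ((enumTuples d (2 * (d + M))).filter fun t => tupleDet (symRows d v) t ≠ 0).map
        (tupleFunctional (symRows d v) (η / (2 * d))) := by
    rw [functionals, List.filter_congr (q := fun t => decide (tupleDet (symRows d v) t ≠ 0))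
      fun t ht => by rw [hdet t ht]]
    refine List.map_congr_left fun t ht => ?_
    have ht' := (List.mem_filter.1 ht).1
    rw [tupleFunctional, tupleFunctional, hdet t ht', hmat t ht', funext hpow]
  rw [heq]
  obtain ⟨h1, h2⟩ := normal_and_all_vertices (L := (enumTuples d (2 * (d + M))).filter
    fun t => tupleDet (symRows d v) t ≠ 0) hz hη fun t => by
      rw [List.mem_filter, mem_enumTuples]; simp
  refine ⟨h1, h2, fun h => ?_⟩
  -- The tuple of the unit vectors has determinant 1, so at least one query is made and an output
  -- exists.
  have hunit : (fun k : Fin d => 2 * (k : ℕ)) ∈ (enumTuples d (2 * (d + M))).filter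
      fun t => tupleDet (symRows d v) t ≠ 0 := by
    refine List.mem_filter.2 ⟨mem_enumTuples.2 fun k => ?_, ?_⟩
    · split_ifs <;> omega
    · have : tupleMat (symRows d v) (fun k : Fin d => 2 * (k : ℕ)) = 1 := by
        ext k l
        rw [tupleMat, Matrix.of_apply, (symRows_symmetric v M).unit, Matrix.one_eq_pi_single]
      simp [tupleDet, this]
  rw [List.map_eq_nil_iff.1 h] at hunit
  exact absurd hunit List.not_mem_nil

end ConvexOpt

namespace ConvexOpt

open Finset

variable {n d : ℕ} {E : Env n d}

/-! ### The program -/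

/-- Everything before the enumeration of the functionals. In dimension one the functionals `1` and
`-1` always suffice. -/
def prepCmd (d : ℕ) : Cmd :=
  .seq (unitsCmd d) (if h : 2 ≤ d then .seq selectCmd (.seq (rowsCmd d) (.seq (maxCmd d)
    (boundsCmd d ⟨0, by omega⟩ ⟨1, h⟩))) else .skip)

/-- A bound for the growth of heights in the evaluation of an expression of the program. -/
def heightFactor (d : ℕ) : ℕ :=
  2 + ∑ a : Fin d, (tupleE d (Function.update (counters d) a (.var 21))).cst
    + ∑ b : Fin d, (QExpr.div (tupleE d (Function.update (counters d) b (.var 21))) (.var 15)).cst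
    + (epsE d).cst + ∑ l : Fin d, (funcE d l).cst + (queryE d).cst

/-- The codes of sign patterns and the threshold need 3^n; twice the number of rows, which bounds
the powers of two, needs 4(d + m). -/
def indexBound (n m d : ℕ) : ℕ := 3 ^ n + (4 * (d + m) + n)

/-- The bounds for an input, and for answers of the evaluation oracle of size at most `Y`. -/
def inputEnv {m : ℕ} (w : Fin n → Fin d → ℚ) (e : Fin m → Fin n → ℚ)
    (O : (Fin n → ℚ) → Finset (Fin n)) (c : (Fin d → ℚ) → ℚ) (Y : ℕ) : Env n d where
  O := O
  c := c
  bd := bdFun (inputSize w e + 1) (heightFactor d) Y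
  M := indexBound n m d
  B := 2 * (heightFactor d ^ 6 * (inputSize w e + 1) + Y) + 3 + natSize (indexBound n m d)
  natSize_le := by omega
  bd_le a := by
    have hK : 1 ≤ heightFactor d := by unfold heightFactor; omega
    set X := inputSize w e + 1
    have h : ∀ i ≤ 6, heightFactor d ^ i * X ≤ heightFactor d ^ 6 * X := fun i hi =>
      Nat.mul_le_mul_right _ (Nat.pow_le_pow_right hK hi)
    have h0 := h 0 (by omega)
    have h1 := h 1 (by omega)
    have h2 := h 2 (by omega)
    have h3 := h 3 (by omega)
    have h4 := h 4 (by omega)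
    have h5 := h 5 (by omega)
    rw [pow_zero, one_mul] at h0
    rw [pow_one] at h1
    unfold bdFun
    split <;> omega

/-! ### Correctness of the preparations. -/

section prep

variable {m : ℕ} (w : Fin n → Fin d → ℚ) (e : Fin m → Fin n → ℚ)
  (O : (Fin n → ℚ) → Finset (Fin n)) (c : (Fin d → ℚ) → ℚ) (Y : ℕ)

theorem slopeBounds_inputEnv (a b : Fin d) :
    SlopeBounds (inputEnv w e O c Y) a b (inputSize w e + 1) (heightFactor d) := by
  have h1 := Finset.single_le_sum
    (f := fun a : Fin d => (tupleE d (Function.update (counters d) a (.var 21))).cst)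
    (fun _ _ => Nat.zero_le _) (Finset.mem_univ a)
  have h2 := Finset.single_le_sum
    (f := fun b : Fin d =>
      (QExpr.div (tupleE d (Function.update (counters d) b (.var 21))) (.var 15)).cst)
    (fun _ _ => Nat.zero_le _) (Finset.mem_univ b)
  refine ⟨by omega, ?_, ?_, ?_, le_rfl, rfl, rfl, rfl, rfl, rfl⟩ <;> unfold heightFactor <;> omega

theorem enumBounds_inputEnv :
    EnumBounds (inputEnv w e O c Y) (inputSize w e + 1) (heightFactor d) := by
  refine ⟨by omega, ?_, fun l => ?_, ?_, le_rfl, le_rfl, le_rfl, rfl, rfl, rfl⟩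
  · unfold heightFactor; omega
  · have h1 := Finset.single_le_sum (f := fun l : Fin d => (funcE d l).cst)
      (fun _ _ => Nat.zero_le _) (Finset.mem_univ l)
    unfold heightFactor; omega
  · unfold heightFactor; omega

theorem omega_eq_sum {i : ℕ} (hi : i < m) :
    omega w (e ⟨i, hi⟩) = fun l : Fin d =>
      ∑ t ∈ range n, (initState w e).qmem 1 i t * (initState w e).qmem 0 t l := by
  funext l
  rw [omega, Finset.sum_apply, Finset.sum_range]
  refine Finset.sum_congr rfl fun j _ => ?_
  rw [initState_w, Pi.smul_apply, smul_eq_mul, ← initState_e w e ⟨i, hi⟩ j]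

theorem RowsInv.zero {v v' : ℕ → ℕ → ℚ} {s : State n d} (h : RowsInv v 0 0 s) :
    RowsInv v' 0 0 s := by
  intro i l
  rw [h i l]
  simp

theorem selectCmd_iw {x : ℕ} (h : selectCmd.iw x) :
    (3 ≤ x ∧ x ≤ 8) ∨ x = 20 ∨ x = 21 := by
  simp [selectCmd, selectRowCmd, signCmd] at h
  omega

theorem selectCmd_qw {x : ℕ} (h : selectCmd.qw x) : x = 3 := by
  simp [selectCmd, selectRowCmd, signCmd] at h
  omega

theorem cmd_quiet_of_parts : selectCmd.Quiet ∧ (unitsCmd d).Quiet ∧ (rowsCmd d).Quiet ∧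
    (maxCmd d).Quiet ∧ ∀ a b : Fin d, (boundsCmd d a b).Quiet := by
  refine ⟨?_, ?_, ?_, ?_, fun a b => ?_⟩
  · simp [selectCmd, selectRowCmd, signCmd]
  · simp [unitsCmd]
  · simp [rowsCmd]
  · simp [maxCmd]
  · simp [boundsCmd, powersCmd, gapBody, slopesCmd, slopeCmd, sortCmd, roundCmd, mergeCmd,
      mergeStep, takeLeft, takeRight, gapCmd]

/-- In dimension one a valid tuple consists of a single signed unit vector, so the other rows are
never read, and only `ε ^ 0` occurs. -/
theorem prepCmd_wp_one (hd1 : 1 ≤ d) (hd2 : ¬ 2 ≤ d) {f : ℕ} (hf : d + 1 ≤ f) :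
    WP (inputEnv w e O c Y) (prepCmd d) f (Prepared w e univ (2 * (d + m)))
      (initState w e) := by
  set v : ℕ → ℕ → ℚ := fun i l =>
    ∑ t ∈ range n, (initState w e).qmem 1 i t * (initState w e).qmem 0 t l with hv
  refine WP.seq' ((unitsCmd_wp v (E := inputEnv w e O c Y) (Nat.le_add_left 1 _)
    (show d ≤ indexBound n m d by unfold indexBound; generalize 3 ^ n = y; omega) ?_).mono hf fun _ h => h) ?_
  · funext i l; simp [initState]
  intro s hF hR
  rw [dif_neg hd2]
  refine WP.skip ?_
  -- Not computed by the program; it is needed only to quote the general statement on functionals.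
  obtain ⟨η, hη⟩ := exists_separated (symRows d fun i l => v i l) (2 * (d + m))
  obtain ⟨h1, h2, h3⟩ := functionals_spec (z := fun i : (univ : Finset (Fin m)) => omega w (e i))
    (v := fun i l => v i l) (M := m) (η := η) (ε := s.qmem 9 0 0) (r := s.row d 2)
    (fun i => ⟨i.1, i.1.2, (omega_eq_sum w e i.1.2).symm⟩) hη (fun t ht k => by
      have := ht k
      rw [if_pos (by omega)] at this
      exact hR.row_eq (M := 0) (by omega)) (fun h => absurd h hd2)
  refine ⟨?_, hF.qmem 0 (by simp [unitsCmd]), ?_, hF.lin (by simp [unitsCmd]),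
    hF.ev (by simp [unitsCmd]), fun h => absurd h hd2, le_rfl, h1, h2, h3⟩
  · rw [hF.imem 0 (by simp [unitsCmd])]; simp [initState]
  · rw [hF.imem 16 (by simp [unitsCmd])]; simp [initState]

/-- The costs of the preparations. -/
structure PrepCost (n m d f : ℕ) : Prop where
  units : d + 1 ≤ f
  select : (m + 1) * (n + 1) ≤ f
  rows : ∀ M ≤ m, (M + 1) * ((d + 1) * (n + 1)) ≤ f
  max : ∀ M ≤ m, (2 * (d + M) + 1) * (d + 1) ≤ f
  bounds : ∀ M ≤ m, M ≤ 3 ^ n → ∀ k, 2 ^ k ≤ 2 * (2 * (d + M)) →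
    (∏ j ∈ range d, ((if j < 2 then 2 * d else 2 * (d + M)) + 1)) * ((k + 1) * (4 * 2 ^ k)) ≤ f

theorem prepCmd_wp_two {𝓕 : Set (Finset (Fin n))} (hd : 2 ≤ d) {f : ℕ} (hf : PrepCost n m d f) :
    WP (inputEnv w e O c Y) (prepCmd d) f (fun s => ∃ (I : Finset (Fin m)) (M : ℕ),
      M ≤ m ∧ (EdgeGuaranteed 𝓕 e → EdgeGuaranteed 𝓕 fun i : I => e i) ∧ (m ≤ 3 ^ n → I = univ) ∧
      Prepared w e I (2 * (d + M)) s) (initState w e) := by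
  classical
  obtain ⟨y1, y2, y3, y4, y5⟩ := cmd_quiet_of_parts (d := d)
  have hM1 : 3 ^ n ≤ (inputEnv w e O c Y).M := Nat.le_add_right _ _
  have hMn : n ≤ (inputEnv w e O c Y).M := by
    change n ≤ indexBound n m d; unfold indexBound; generalize 3 ^ n = y; omega
  have hM4 : 4 * (d + m) ≤ (inputEnv w e O c Y).M := by
    change 4 * (d + m) ≤ indexBound n m d; unfold indexBound; generalize 3 ^ n = y; omega
  have hb2 : 2 ^ inputSize w e ≤ 2 ^ (inputEnv w e O c Y).bd 3 :=
    Nat.pow_le_pow_right (by norm_num) (Nat.le_succ _)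
  refine WP.seq' ((unitsCmd_wp 0 (E := inputEnv w e O c Y) (Nat.le_add_left 1 _)
    (by omega) ?_).mono hf.units fun _ h => h) ?_
  · funext i l; simp [initState]
  intro s₁ F₁ hR
  rw [dif_pos hd]
  have i₁ : ∀ x, x ≠ 20 → s₁.imem x = (initState w e).imem x := fun x hx =>
    F₁.imem x (by simp [unitsCmd, hx])
  have q₁ : ∀ x, x ≠ 2 → s₁.qmem x = (initState w e).qmem x := fun x hx =>
    F₁.qmem x (by simp [unitsCmd, hx])
  refine WP.seq' ((selectCmd_wp (m := m) le_rfl hM1 hMn (by omega) ?_ ?_ ?_).mono hf.select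
    fun _ h => h) ?_
  · rw [i₁ 0 (by omega)]; simp [initState]
  · rw [i₁ 1 (by omega)]; simp [initState]
  · intro h; rw [i₁ 5 (by omega)]; simp [initState]
  intro s₂ F₂ hsel
  set M := s₂.imem 4 0 0 with hM
  set sel := s₂.imem 3 0 with hseldef
  rw [q₁ 1 (by omega)] at hsel
  have hMm := hsel.le
  have i₂ : ∀ x, x < 3 ∨ x = 16 → s₂.imem x = (initState w e).imem x := fun x hx => by
    rw [F₂.imem x (fun h => by have := selectCmd_iw h; omega), i₁ x (by omega)]
  have q₂ : ∀ x, x < 2 → s₂.qmem x = (initState w e).qmem x := fun x hx => by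
    rw [F₂.qmem x (fun h => by have := selectCmd_qw h; omega), q₁ x (by omega)]
  set v : ℕ → ℕ → ℚ := fun i l => ∑ t ∈ range n, s₂.qmem 1 (s₂.imem 3 0 i) t * s₂.qmem 0 t l
    with hv
  have hR₂ : RowsInv v 0 0 s₂ := by
    intro i l
    rw [F₂.qmem 2 (fun h => by have := selectCmd_qw h; omega)]
    exact hR.zero i l
  refine WP.seq' ((rowsCmd_wp (M := M) (v := v) rfl (by omega) hMn (by omega) ?_ rfl hv ?_
    hR₂).mono (hf.rows M hMm) fun _ h => h) ?_
  · rw [i₂ 0 (by omega)]; simp [initState]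
  · intro i hi l hl j hj
    rw [q₂ 0 (by omega), q₂ 1 (by omega)]
    exact (height_sum_row_le w e (hsel.lt i hi) hl hj).trans hb2
  intro s₃ F₃ hR₃
  have i₃ : ∀ x, x < 20 → s₃.imem x = s₂.imem x := fun x hx =>
    F₃.imem x (by simp [rowsCmd]; omega)
  refine WP.seq' ((maxCmd_wp (M := M) le_rfl (Nat.le_add_left 1 _) (by omega)
    (by rw [i₃ 4 (by omega)])).mono (hf.max M hMm) fun _ h => h) ?_
  rintro s₄ F₄ ⟨h9, hA1, hA⟩
  have q₄ : ∀ x, x ≠ 4 → s₄.qmem x = s₃.qmem x := fun x hx => F₄.qmem x (by simp [maxCmd, hx])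
  have hrow : ∀ i < 2 * (d + M), s₄.row d 2 i = symRows d (fun k l => v k l) i := fun i hi => by
    rw [← hR₃.row_eq hi]
    funext l
    rw [State.row, State.row, q₄ 2 (by omega)]
  have hmax : 2 * (d + M) + 1 ≤ f :=
    (Nat.le_mul_of_pos_right _ (by omega)).trans (hf.max M hMm)
  refine (boundsCmd_wp (N := 2 * (d + M)) rfl rfl (slopeBounds_inputEnv w e O c Y _ _) (by omega)
    (by omega) h9 le_rfl rfl ?_ hA1 ?_ hmax (hf.bounds M hMm hsel.le_pow)).frame.mono le_rfl ?_
  · unfold heightFactor; omega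
  · intro i hi l
    rw [State.row, q₄ 2 (by omega)]
    exact hA i hi l l.2
  rintro s₅ ⟨⟨γ, μ, hG, hε⟩, F₅⟩
  have q2₅ : s₅.row d 2 = s₄.row d 2 := by
    funext i l
    rw [State.row, State.row, F₅.qmem 2 (fun h => by have := boundsCmd_qw h; omega)]
  set A := s₄.qmem 4 0 0
  have hsym := symRows_symmetric (fun k (l : Fin d) => v k l) M
  have hsym' : SymmetricRows (s₄.row d 2) (2 * (d + M)) := by
    refine ⟨hsym.le, fun l => ?_, fun l => ?_, fun i hi => ?_⟩
    · rw [hrow _ (by omega), hsym.unit]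
    · rw [hrow _ (by omega), hsym.neg_unit]
    · obtain ⟨j, hj, h⟩ := hsym.neg i hi
      exact ⟨j, hj, by rw [hrow i hi, hrow j hj, h]⟩
  have hsep := hG.separated hsym' rfl rfl
  -- The array agrees with `symRows` only up to the number of rows, so separation is transferred
  -- along the tuples that stay below it.
  have hsep' : Separated (symRows d fun k l => v k l) (2 * (d + M))
      (γ * μ ^ 2 / (d.factorial * A ^ d) ^ 2) := by
    have hdet : ∀ t : Fin d → ℕ, (∀ k, t k < 2 * (d + M)) →
        tupleDet (s₄.row d 2) t = tupleDet (symRows d fun k l => v k l) t := fun t ht => by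
      rw [tupleDet, tupleDet]
      congr 1
      funext k
      exact hrow _ (ht k)
    refine ⟨hsep.1, fun t t' ht ht' h => ?_⟩
    rw [← hdet t ht, ← hdet t' ht']
    exact hsep.2 t t' ht ht' (by rwa [hdet t' ht'])
  set I : Finset (Fin m) := univ.filter fun i => ∃ k < M, sel k = i with hI
  have memI : ∀ i, i ∈ I ↔ ∃ k < M, sel k = i := fun i => by simp [hI]
  refine ⟨I, M, hMm, edgeGuaranteed_of_selected (initState_e w e) hsel memI,
    fun hm => ?_, ?_⟩
  · obtain ⟨h1, h2⟩ := hsel.eq hm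
    ext i
    simp only [memI, Finset.mem_univ, iff_true]
    exact ⟨i, by omega, h2 i (by omega)⟩
  obtain ⟨h1, h2, h3⟩ := functionals_spec (z := fun i : I => omega w (e i))
    (v := fun i l => v i l) (M := M) (η := γ * μ ^ 2 / (d.factorial * A ^ d) ^ 2)
    (ε := s₅.qmem 9 0 0) (r := s₅.row d 2)
    (fun i => by
      obtain ⟨k, hk, hki⟩ := (memI i).1 i.2
      refine ⟨k, hk, ?_⟩
      rw [omega_eq_sum w e i.1.2, hv, q₂ 0 (by omega), q₂ 1 (by omega), ← hki])
    hsep' (fun t ht k => by rw [q2₅]; exact hrow _ (ht.lt (by omega) k)) (fun _ => hε)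
  refine ⟨?_, ?_, ?_, ?_, ?_, fun _ => ?_, by omega, h1, h2, h3⟩
  · rw [F₅.imem 0 (fun h => by have := boundsCmd_iw h; omega), F₄.imem 0 (by simp [maxCmd]),
      i₃ 0 (by omega), i₂ 0 (by omega)]
    simp [initState]
  · rw [F₅.qmem 0 (fun h => by have := boundsCmd_qw h; omega), q₄ 0 (by omega),
      F₃.qmem 0 (by simp [rowsCmd]), q₂ 0 (by omega)]
  · rw [F₅.imem 16 (fun h => (boundsCmd_iw h).2 rfl), F₄.imem 16 (by simp [maxCmd]),
      i₃ 16 (by omega), i₂ 16 (by omega)]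
    simp [initState]
  · rw [F₅.lin (y5 _ _), F₄.lin y4, F₃.lin y3, F₂.lin y1, F₁.lin y2]; rfl
  · rw [F₅.ev (y5 _ _), F₄.ev y4, F₃.ev y3, F₂.ev y1, F₁.ev y2]; rfl
  · rw [F₅.imem 9 (fun h => by have := boundsCmd_iw h; omega), h9]

end prep

end ConvexOpt

namespace ConvexOpt

open Finset

variable {n d : ℕ} {E : Env n d}

/-! ### Resources -/

theorem prod_ite_le (i e x y : ℕ) :
    ∏ j ∈ range (i + e), ((if j < i then x else y) + 1) = (x + 1) ^ i * (y + 1) ^ e := by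
  rw [Finset.prod_range_add]
  congr 1
  · rw [Finset.prod_congr rfl fun j hj => by rw [if_pos (Finset.mem_range.1 hj)]]
    simp
  · rw [Finset.prod_congr rfl fun j _ => by rw [if_neg (by omega)]]
    simp

theorem nest_cost_le {i m M : ℕ} (hi : i ≤ d) (hM : M ≤ m) :
    ∏ j ∈ range d, ((if j < i then 2 * d else 2 * (d + M)) + 1)
      ≤ (2 * d + 3) ^ d * max m 1 ^ (d - i) := by
  obtain ⟨e, rfl⟩ : ∃ e, d = i + e := ⟨d - i, by omega⟩
  set c := 2 * (i + e) + 3 with hc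
  rw [prod_ite_le, Nat.add_sub_cancel_left, pow_add c, mul_assoc, ← mul_pow]
  have hm : 1 ≤ max m 1 := le_max_right _ _
  have hm' : m ≤ max m 1 := le_max_left _ _
  refine Nat.mul_le_mul (Nat.pow_le_pow_left (by omega) _) (Nat.pow_le_pow_left ?_ _)
  rw [hc]
  nlinarith

/-- The constant in the cost of the preparations. -/
def prepConst (d : ℕ) : ℕ := 8 * (d + 5) * (2 * d + 3) ^ (d + 1)

/-- The critical term is the sorting in the nested loops: `m ^ (d - 2)` tuples times a length `2 ^
k` of order `m` times `k + 1`, and `k + 1` is at most `(d + 5) * max n 1` because `M ≤ 3 ^ n`. -/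
theorem prepCost {m : ℕ} (hd : 2 ≤ d) :
    PrepCost n m d (prepConst d * (max n 1 * max m 1 ^ (d - 1))) := by
  set c := 2 * d + 3 with hc
  set u := max n 1 with hu
  set v := max m 1 with hv
  have hu1 : 1 ≤ u := le_max_right _ _
  have hv1 : 1 ≤ v := le_max_right _ _
  have hun : n ≤ u := le_max_left _ _
  have hvm : m ≤ v := le_max_left _ _
  have hc1 : c ≤ c ^ (d + 1) := Nat.le_self_pow (by omega) _
  have hvp : v ≤ v ^ (d - 1) := Nat.le_self_pow (by omega) _
  have huv : u * v ≤ u * v ^ (d - 1) := Nat.mul_le_mul_left _ hvp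
  have hv_uv : v ≤ u * v := Nat.le_mul_of_pos_left _ hu1
  have key : ∀ x, x ≤ 8 * (d + 5) * c * (u * v) →
      x ≤ prepConst d * (u * v ^ (d - 1)) := fun x hx =>
    hx.trans (Nat.mul_le_mul (Nat.mul_le_mul_left _ hc1) huv)
  have huv1 : 1 ≤ u * v := Nat.mul_pos hu1 hv1
  have hN : ∀ M ≤ m, 2 * (d + M) + 1 ≤ c * v := fun M hM => by
    rw [hc]; nlinarith
  have hmn : ∀ M ≤ m, (M + 1) * (n + 1) ≤ 4 * (u * v) := fun M hM => by
    calc (M + 1) * (n + 1) ≤ (2 * v) * (2 * u) := Nat.mul_le_mul (by omega) (by omega)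
      _ = 4 * (u * v) := by ring
  refine ⟨key _ ?_, key _ ?_, fun M hM => key _ ?_, fun M hM => key _ ?_, fun M hM hM3 k hk => ?_⟩
  · calc d + 1 ≤ 8 * (d + 5) * c := by rw [hc]; nlinarith
      _ ≤ _ := Nat.le_mul_of_pos_right _ huv1
  · refine (hmn m le_rfl).trans (Nat.mul_le_mul_right _ ?_)
    rw [hc]; nlinarith
  · calc (M + 1) * ((d + 1) * (n + 1)) = (d + 1) * ((M + 1) * (n + 1)) := by ring
      _ ≤ (d + 1) * (4 * (u * v)) := Nat.mul_le_mul_left _ (hmn M hM)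
      _ = ((d + 1) * 4) * (u * v) := by ring
      _ ≤ _ := Nat.mul_le_mul_right _ (by rw [hc]; nlinarith)
  · calc (2 * (d + M) + 1) * (d + 1) ≤ (c * v) * (d + 1) := Nat.mul_le_mul_right _ (hN M hM)
      _ = ((d + 1) * c) * v := by ring
      _ ≤ (8 * (d + 5) * c) * (u * v) := Nat.mul_le_mul (Nat.mul_le_mul_right _ (by omega)) hv_uv
  -- Passing from 3 to 4 makes the bound a power of two, from which `k` is read off.
  · have h1 : d + M ≤ 2 ^ d * 4 ^ n := by
      have h2 : d + 1 ≤ 2 ^ d := Nat.lt_two_pow_self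
      have h3 : 3 ^ n ≤ 4 ^ n := Nat.pow_le_pow_left (by norm_num) n
      have h4 : 1 ≤ 4 ^ n := Nat.one_le_pow _ _ (by norm_num)
      nlinarith
    have hk2 : k ≤ 2 + d + 2 * n := by
      refine (Nat.pow_le_pow_iff_right (a := 2) (by norm_num)).1 ?_
      rw [pow_add, pow_add, pow_mul]
      norm_num
      calc 2 ^ k ≤ 4 * (d + M) := by omega
        _ ≤ 4 * (2 ^ d * 4 ^ n) := Nat.mul_le_mul_left _ h1
        _ = 4 * 2 ^ d * 4 ^ n := by ring
    have hk3 : k + 1 ≤ (d + 5) * u := by nlinarith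
    have hk4 : 4 * 2 ^ k ≤ 8 * c * v := by
      have := hN M hM
      have : 8 * c * v = 8 * (c * v) := by ring
      omega
    have hpow : v ^ (d - 2) * v = v ^ (d - 1) := by
      rw [← pow_succ]; congr 1; omega
    calc (∏ j ∈ range d, ((if j < 2 then 2 * d else 2 * (d + M)) + 1)) * ((k + 1) * (4 * 2 ^ k))
        ≤ (c ^ d * v ^ (d - 2)) * (((d + 5) * u) * (8 * c * v)) :=
          Nat.mul_le_mul (nest_cost_le hd hM) (Nat.mul_le_mul hk3 hk4)
      _ = 8 * (d + 5) * (c ^ d * c) * (u * (v ^ (d - 2) * v)) := by ring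
      _ = prepConst d * (u * v ^ (d - 1)) := by rw [hpow, ← pow_succ, prepConst]

/-- The constant in the cost of the enumeration. -/
def enumConst (d : ℕ) : ℕ := 2 * (d + 1) * (2 * d + 3) ^ d

theorem enumCost {m M : ℕ} (hd : 1 ≤ d) (hM : M ≤ m) :
    (∏ j ∈ range d, ((if j < 1 then 2 * d else 2 * (d + M)) + 1)) * ((d + 1) * (n + 1))
      ≤ enumConst d * (max n 1 * max m 1 ^ (d - 1)) := by
  have hu1 : 1 ≤ max n 1 := le_max_right _ _
  have hun : n ≤ max n 1 := le_max_left _ _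
  calc _ ≤ ((2 * d + 3) ^ d * max m 1 ^ (d - 1)) * ((d + 1) * (2 * max n 1)) :=
        Nat.mul_le_mul (nest_cost_le hd hM) (Nat.mul_le_mul_left _ (by omega))
    _ = _ := by rw [enumConst]; ring

theorem natSize_indexBound_le (n m d : ℕ) :
    natSize (indexBound n m d) ≤ 8 * (n + m) + 4 * d + 4 := by
  have h1 : Nat.size (3 ^ n) ≤ 2 * n + 1 := Nat.size_le.2 (by
    rw [pow_succ, pow_mul]
    have h3 : 3 ^ n ≤ 4 ^ n := Nat.pow_le_pow_left (by norm_num) n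
    have h4 : 1 ≤ 4 ^ n := Nat.one_le_pow _ _ (by norm_num)
    norm_num
    omega)
  have h2 : Nat.size (4 * (d + m) + n) ≤ 4 * (d + m) + n := Nat.size_le.2 Nat.lt_two_pow_self
  have h3 := natSize_add (3 ^ n) (4 * (d + m) + n)
  unfold indexBound
  unfold natSize at h3 ⊢
  omega

/-- A bound for the running time in the bit model. -/
noncomputable def bitPoly (d A : ℕ) : Polynomial ℕ :=
  Polynomial.C A * (Polynomial.X + 1) ^ d *
    (Polynomial.C (2 * heightFactor d ^ 6 + 8) * (Polynomial.X + 1) + Polynomial.C (4 * d + 7))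

/-- Operations times the maximal size `B`; the latter is linear in the input and answer lengths,
since `indexBound` has only O(n + m) bits for fixed `d`. -/
theorem bitPoly_eval {m : ℕ} (hd : 1 ≤ d) (w : Fin n → Fin d → ℚ) (e : Fin m → Fin n → ℚ)
    (O : (Fin n → ℚ) → Finset (Fin n)) (c : (Fin d → ℚ) → ℚ) (Y A : ℕ) :
    A * (max n 1 * max m 1 ^ (d - 1)) * (inputEnv w e O c Y).B
      ≤ (bitPoly d A).eval (inputSize w e + Y) := by
  simp only [bitPoly, Polynomial.eval_mul, Polynomial.eval_C, Polynomial.eval_pow,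
    Polynomial.eval_add, Polynomial.eval_X, Polynomial.eval_one]
  have hnm : n + m ≤ inputSize w e := by unfold inputSize; omega
  set L := inputSize w e with hL
  have h1 : max n 1 ≤ L + Y + 1 := by omega
  have h2 : max m 1 ≤ L + Y + 1 := by omega
  have hpow : (L + Y + 1) * (L + Y + 1) ^ (d - 1) = (L + Y + 1) ^ d := by
    rw [← pow_succ']; congr 1; omega
  refine Nat.mul_le_mul ?_ ?_
  · rw [← hpow]
    exact Nat.mul_le_mul_left _ (Nat.mul_le_mul h1 (Nat.pow_le_pow_left h2 _))
  · have hB : (inputEnv w e O c Y).B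
        = 2 * (heightFactor d ^ 6 * (L + 1) + Y) + 3 + natSize (indexBound n m d) := rfl
    have h3 := natSize_indexBound_le n m d
    rw [hB]
    have h4 : heightFactor d ^ 6 * (L + 1) ≤ heightFactor d ^ 6 * (L + Y + 1) :=
      Nat.mul_le_mul_left _ (by omega)
    have h5 : (2 * heightFactor d ^ 6 + 8) * (L + Y + 1)
        = 2 * (heightFactor d ^ 6 * (L + Y + 1)) + 8 * (L + Y + 1) := by ring
    omega

theorem length_functionals_le {m M : ℕ} (hd : 1 ≤ d) (hM : M ≤ m) (r : ℕ → Fin d → ℚ) (ε : ℚ) :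
    (functionals r ε (enumTuples d (2 * (d + M)))).length
      ≤ (2 * d + 3) ^ d * max m 1 ^ (d - 1) := by
  rw [functionals, List.length_map]
  refine (List.length_filter_le _ _).trans ?_
  rw [enumTuples, List.length_map, length_tupleList]
  exact (Finset.prod_le_prod' fun j _ => Nat.le_succ _).trans (nest_cost_le hd hM)

/-! ### The theorem -/

theorem sized_initState {m : ℕ} (w : Fin n → Fin d → ℚ) (e : Fin m → Fin n → ℚ)
    (O : (Fin n → ℚ) → Finset (Fin n)) (c : (Fin d → ℚ) → ℚ) :
    Sized (inputEnv w e O c 0) (initState w e) := by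
  constructor
  · intro a i j
    change _ ≤ indexBound n m d
    have : n ≤ indexBound n m d ∧ m ≤ indexBound n m d := by
      unfold indexBound; generalize 3 ^ n = y; omega
    simp only [initState]
    split_ifs <;> omega
  · intro a i j
    by_cases ha : a = 0 ∨ a = 1
    · refine (height_initState_le w e a i j).trans (Nat.pow_le_pow_right (by norm_num) ?_)
      rcases ha with rfl | rfl <;> exact Nat.le_succ _
    · have : (initState w e).qmem a i j = 0 := by
        simp only [initState]
        rw [if_neg (fun h => ha (Or.inl h)), if_neg (fun h => ha (Or.inr h))]
      rw [this]
      exact Nat.one_le_two_pow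

/-- The preparations are analysed with no allowance for answers of the evaluation oracle. The
allowance is raised once their end state has fixed which queries will follow. -/
theorem Sized.raise {m : ℕ} {w : Fin n → Fin d → ℚ} {e : Fin m → Fin n → ℚ}
    {O : (Fin n → ℚ) → Finset (Fin n)} {c : (Fin d → ℚ) → ℚ} {s : State n d} (Y : ℕ)
    (h : Sized (inputEnv w e O c 0) s) : Sized (inputEnv w e O c Y) s := by
  refine ⟨h.imem, fun a i j => (h.qmem a i j).trans (Nat.pow_le_pow_right (by norm_num) ?_)⟩
  change bdFun _ _ 0 a ≤ bdFun _ _ Y a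
  unfold bdFun
  split <;> omega

end ConvexOpt

theorem mainTheorem2 (d : ℕ) (hd : 1 ≤ d) :
    ∃ (P : ConvexOpt.Cmd) (C : ℕ) (poly : Polynomial ℕ),
      ∀ (n m : ℕ) (𝓕 : Set (Finset (Fin n))) (e : Fin m → Fin n → ℚ)
        (O : (Fin n → ℚ) → Finset (Fin n)) (w : Fin n → Fin d → ℚ) (c : (Fin d → ℚ) → ℚ),
        ConvexOpt.EdgeGuaranteed 𝓕 e → ConvexOpt.IsLinearOracle 𝓕 O →
        ConvexOn ℚ Set.univ c →
        -- every run of the algorithm, for any choice of the normal functionals, is correct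
        (∀ fnl lin ev out, ConvexOpt.IsAlgorithmRun w e O c fnl lin ev out →
          ConvexOpt.IsConvexOptimum 𝓕 w c out) ∧
        -- the number of vertices that it enumerates
        {u | ConvexOpt.IsVertex (ConvexOpt.zone fun i => ConvexOpt.omega w (e i)) u}.Finite ∧
        {u | ConvexOpt.IsVertex (ConvexOpt.zone fun i => ConvexOpt.omega w (e i)) u}.ncard
          ≤ C * max m 1 ^ (d - 1) ∧
        -- the program `P` halts, carries out the algorithm, and solves the problem
        ∃ s : ConvexOpt.State n d, ConvexOpt.Exec O c P (ConvexOpt.initState w e) s ∧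
          (∃ (I : Finset (Fin m)) (fnl : List (Fin d → ℚ)),
            ConvexOpt.EdgeGuaranteed 𝓕 (fun i : I => e i) ∧
            (m ≤ 3 ^ n → I = Finset.univ) ∧
            ConvexOpt.IsAlgorithmRun w (fun i : I => e i) O c fnl s.linLog s.evalLog s.output) ∧
          ConvexOpt.IsConvexOptimum 𝓕 w c s.output ∧
          -- within the claimed resources
          s.ops ≤ C * (max n 1 * max m 1 ^ (d - 1)) ∧
          s.linLog.length ≤ C * max m 1 ^ (d - 1) ∧
          s.evalLog.length ≤ C * max m 1 ^ (d - 1) ∧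
          s.bits ≤ poly.eval (ConvexOpt.inputSize w e + ConvexOpt.answerSize c s.evalLog) := by
  open ConvexOpt in
  set A := (prepCmd d).cst * prepConst d + (enumCmd d).cst * enumConst d with hA
  have hK : ∀ x, x ≤ (2 * d + 3) ^ d → ∀ y, x * y ≤ (A + (2 * d + 3) ^ d) * y := fun x hx y =>
    Nat.mul_le_mul_right _ (hx.trans (Nat.le_add_left _ _))
  refine ⟨.seq (prepCmd d) (enumCmd d), A + (2 * d + 3) ^ d, bitPoly d A, ?_⟩
  intro n m 𝓕 e O w c hE hO hc
  obtain ⟨hfin, hcard⟩ := zone_vertices_card hd fun i => omega w (e i)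
  refine ⟨fun fnl lin ev out h => h.isConvexOptimum hE hO hc, hfin, hcard.trans ?_, ?_⟩
  · rw [Fintype.card_fin]
    refine le_trans ?_ (hK _ le_rfl _)
    have h1 : 2 * (d + m) ≤ (2 * d + 3) * max m 1 := by
      have : 1 ≤ max m 1 := le_max_right _ _
      have : m ≤ max m 1 := le_max_left _ _
      nlinarith
    have h2 : (2 * d + 3) * (2 * d + 3) ^ (d - 1) = (2 * d + 3) ^ d := by
      rw [← pow_succ']; congr 1; omega
    calc 2 * d * (2 * (d + m)) ^ (d - 1)
        ≤ (2 * d + 3) * ((2 * d + 3) * max m 1) ^ (d - 1) :=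
          Nat.mul_le_mul (by omega) (Nat.pow_le_pow_left h1 _)
      _ = (2 * d + 3) ^ d * max m 1 ^ (d - 1) := by rw [mul_pow, ← mul_assoc, h2]
  set T := max n 1 * max m 1 ^ (d - 1) with hT
  -- the preparations
  have hprep : WP (inputEnv w e O c 0) (prepCmd d) (prepConst d * T)
      (fun s => ∃ (I : Finset (Fin m)) (M : ℕ), M ≤ m ∧ EdgeGuaranteed 𝓕 (fun i : I => e i) ∧
        (m ≤ 3 ^ n → I = Finset.univ) ∧ Prepared w e I (2 * (d + M)) s) (initState w e) := by
    by_cases hd2 : 2 ≤ d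
    · refine (prepCmd_wp_two w e O c 0 (𝓕 := 𝓕) hd2 (prepCost hd2)).mono le_rfl ?_
      rintro s ⟨I, M, hMm, h1, h2, h3⟩
      exact ⟨I, M, hMm, h1 hE, h2, h3⟩
    · refine (prepCmd_wp_one w e O c 0 hd hd2 ?_).mono le_rfl ?_
      · have h1 : 1 ≤ T := Nat.mul_pos (show 1 ≤ max n 1 from le_max_right _ _)
          (Nat.one_le_pow _ _ (show 1 ≤ max m 1 from le_max_right _ _))
        have h2 : 1 ≤ (2 * d + 3) ^ (d + 1) := Nat.one_le_pow _ _ (by omega)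
        calc d + 1 ≤ 8 * (d + 5) := by omega
          _ ≤ prepConst d := Nat.le_mul_of_pos_right _ h2
          _ ≤ _ := Nat.le_mul_of_pos_right _ h1
      · intro s h
        refine ⟨Finset.univ, m, le_rfl, ⟨hE.1, fun u v huv => ?_⟩, fun _ => rfl, h⟩
        obtain ⟨i, hi⟩ := hE.2 u v huv
        exact ⟨⟨i, Finset.mem_univ i⟩, hi⟩
  obtain ⟨s₁, st₁, sz₁, I, M, hM, hEI, hIu, hP⟩ := hprep (sized_initState w e O c)
  -- the enumeration
  set fnl := functionals (s₁.row d 2) (s₁.qmem 9 0 0) (enumTuples d (2 * (d + M))) with hfnl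
  -- The enumeration is not adaptive: its functionals depend on `s₁` alone, so the total length of
  -- the answers can be named before the enumeration is run.
  set Y := answerSize c (fnl.map fun a => weight w (O (pullback w a))) with hY
  have hMn : n ≤ indexBound n m d ∧ 1 ≤ indexBound n m d ∧ 2 * (d + M) ≤ indexBound n m d := by
    have : 1 ≤ 3 ^ n := Nat.one_le_pow _ _ (by norm_num)
    unfold indexBound; generalize 3 ^ n = y at *; omega
  have henum := enumCmd_wp (E := inputEnv w e O c Y) (s := s₁) (N := 2 * (d + M)) (w := w)
    (enumBounds_inputEnv w e O c Y) hMn.1 hMn.2.1 hMn.2.2 ((by omega : 2 * d ≤ _).trans hMn.2.2)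
    hP.imem0 (by rw [hP.qmem0]; exact initState_w w e) (by
      rw [hP.qmem0]
      exact fun S hS l hl => (height_sum_weights_le w e hS hl).trans
        (Nat.pow_le_pow_right (by norm_num) (Nat.le_succ _))) rfl rfl hP.rows (fun a ha => by
      refine (height_le_two_pow _).trans (Nat.pow_le_pow_right (by norm_num) ?_)
      refine List.single_le_sum (fun _ _ => Nat.zero_le _) _ ?_
      exact List.mem_map.2 ⟨_, List.mem_map.2 ⟨a, ha, rfl⟩, rfl⟩) hP.flag hP.lin hP.ev
  set f₂ := (∏ j ∈ Finset.range d, ((if j < 1 then 2 * d else 2 * (d + M)) + 1))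
    * ((d + 1) * (n + 1)) with hf₂
  obtain ⟨s₂, st₂, -, hI⟩ := henum (sz₁.raise Y)
  obtain ⟨o₁, b₁, ex₁, ho₁, hb₁⟩ := st₁ 0 0
  obtain ⟨o₂, b₂, ex₂, ho₂, hb₂⟩ := st₂ o₁ b₁
  have hlen := length_functionals_le hd hM (s₁.row d 2) (s₁.qmem 9 0 0)
  have hlin : s₂.linLog.length ≤ (A + (2 * d + 3) ^ d) * max m 1 ^ (d - 1) := by
    rw [hI.lin, List.length_map]
    exact hlen.trans (hK _ le_rfl _)
  have hevl : s₂.evalLog = fnl.map fun a => weight w (O (pullback w a)) := by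
    rw [hI.ev, hI.lin, List.map_map]; rfl
  have hcost : (prepCmd d).cst * (prepConst d * T) + (enumCmd d).cst * f₂ ≤ A * T := by
    rw [show A * T = (prepCmd d).cst * (prepConst d * T) + (enumCmd d).cst * (enumConst d * T) by
      rw [hA]; ring]
    exact Nat.add_le_add_left (Nat.mul_le_mul_left _ (enumCost hd hM)) _
  -- The list of functionals is not empty, so some answer has been stored.
  have h16 : s₂.imem 16 0 0 ≠ 0 := fun h => hP.ne_nil (hI.none h)
  have hrun : IsAlgorithmRun w (fun i : I => e i) O c fnl s₂.linLog s₂.evalLog s₂.output :=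
    ⟨hP.normal, hP.all_vertices, hI.lin, hI.ev, hI.mem h16, fun F hF =>
      (hI.max h16 F hF).trans (hI.val h16).le⟩
  refine ⟨s₂.withCost o₂ b₂, Exec.seq ex₁ ex₂, ⟨I, fnl, hEI, hIu, hrun⟩,
    hrun.isConvexOptimum hEI hO hc, ?_, hlin, ?_, ?_⟩
  · change o₂ ≤ _
    have : A * T ≤ (A + (2 * d + 3) ^ d) * T := Nat.mul_le_mul_right _ (Nat.le_add_right _ _)
    omega
  · change s₂.evalLog.length ≤ _
    rw [hI.ev, List.length_map]
    exact hlin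
  · change b₂ ≤ (bitPoly d A).eval (inputSize w e + answerSize c s₂.evalLog)
    rw [hevl, ← hY]
    have hbit : A * T * (inputEnv w e O c Y).B ≤ (bitPoly d A).eval (inputSize w e + Y) :=
      bitPoly_eval hd w e O c Y A
    refine le_trans ?_ hbit
    have hB : (inputEnv w e O c 0).B ≤ (inputEnv w e O c Y).B := by
      change 2 * (_ + 0) + 3 + _ ≤ 2 * (_ + Y) + 3 + _
      omega
    have h1 := Nat.mul_le_mul_right (inputEnv w e O c Y).B hcost
    have h2 := Nat.mul_le_mul_left ((prepCmd d).cst * (prepConst d * T)) hB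
    rw [add_mul] at h1
    omega
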